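/- **Setting.** Units $i=1,2,\dots$ carry i.i.d. families $(W_i,\alpha_i,(X_{it})_{t\ge1},(Y_{it})_{t\ge1})$ with $W_i\in\mathbb R^q$, $\alpha_i\in\mathbb R$, $X_{it}\in\mathbb R^p$, $Y_{it}=X_{it}'\beta_0+\alpha_i+u_{it}$. In the sample of size $N$ the units $i\le N$ are observed for $t\le T=T_N$ (without $\alpha_i$). Write $X_i=(X_{i1},\dots,X_{iT})$, $\bar{\bar Y}_i=\frac1{T-1}\sum_{t<T}Y_{it}$, and $\bar{\bar X}_i,\bar{\bar u}_i$ likewise. The moment function is $m(W_i,\alpha_i,\mu)\in\mathbb R^k$; put $\partial m_i=\partial m(W_i,\alpha_i,\mu_0)/\partial\alpha_i$ (integrable) and $a_i=a(X_i,\alpha_i,\mu_0)=\mathbb E[\partial m_i\mid X_i,\alpha_i]$. Deterministic folds $I_1,\dots,I_L$ ($L$ fixed) partition $\{1,\dots,N\}$ with $|I_l|\ge\lfloor N/L\rfloor$; $\mathcal W_l^C$ denotes the observed data outside $I_l$. The estimates $\tilde\beta_l$ and $\tilde a_l(\cdot,\cdot)$ are measurable functions of $\mathcal W_l^C$. For $i\in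 I_l$ let $\tilde\alpha_{il}=\bar{\bar Y}_i-\bar{\bar X}_i'\tilde\beta_l$ and $\hat{\bar\alpha}_l=|I_l|^{-1}\sum_{i\in I_l}\tilde\alpha_{il}$; let $\hat u_i^2\ge0$ be a measurable function of the residuals $Y_{it}-X_{it}'\tilde\beta_l-\tilde\alpha_{il}$, $t<T$ (for instance $(T-1)^{-2}$ times their sum of squares, or a Newey–West estimate). The shrinkage estimates are $$\tilde\alpha_{il}^{*}=\frac{\hat u_i^2}{\hat u_i^2+s_l}\hat{\bar\alpha}_l+\frac{s_l}{s_l+\hat u_i^2}\tilde\alpha_{il},$$ where for EB $s_l=\frac1{|I_l|-1}\sum_{i\in I_l}(\tilde\alpha_{il}-\hat{\bar\alpha}_l)^2-\frac1{|I_l|-1}\sum_{i\in I_l}\hat u_i^2$, and for SURE $s_l$ is a minimizer over $s\ge0$ (chosen measurably from $\mathcal W_l^C$ and the data $(X_{jt})_{t\le T},(Y_{jt})_{t<T}$, $j\in I_l$) of $$\frac1{|I_l|}\sum_{i\in I_l}\Big(\hat u_i^2+\frac{\hat u_i^4(\tilde\alpha_{il}-\hat{\bar\alpha}_l)^2}{(s+\hat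 u_i^2)^2}-\frac{2\hat u_i^4}{s+\hat u_i^2}\Big).$$ Let $\check\alpha_{il}$ be one of $\tilde\alpha_{il}$, $\tilde\alpha_{il}^{EB}$, $\tilde\alpha_{il}^{SURE}$, and let $\tilde a_{il}=\tilde a_l(X_i,\tilde\alpha_{il})$ or $\tilde a_{il}=\tilde a_l(X_i,\check\alpha_{il})$. **Assumptions.** All limits are for $N\to\infty$; all bounds "$<\infty$" are uniform in $N$ (hence in $T$), for all large $N$, and all statements are for every $l$. 1. $\mathbb E[m(W_i,\alpha_i,\mu_0)]=0$ (with integrability), $\mathbb E[u_{it}\mid X_{it},\alpha_i,(Y_{is},X_{is})_{s<t}]=0$ and $\mathbb E[u_{it}^2]=\sigma^2$ for all $t$. 2. $T\asymp N^g$ with $1/2<g<1$, and $\zeta<1/2$ satisfies $\zeta+g\ge1$. (i) $\tilde\beta_l-\beta_0=O_p((NT)^{-1/2})$; (ii) $\mathbb E[\|\tilde a_{il}-a_i\|^2\mid\mathcal W_l^C]=o_p(N^{-\zeta})$ for $i\in I_l$; (iii) $\tilde a_{il}$ is square integrable; (iv) $|I_l|^{-1}\sum_{i\in I_l}\|\tilde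 a_{il}-a_i\|^2=o_p(N^{-\zeta})$. 3. $|I_l|^{-1}\sum_{i\in I_l}(\check\alpha_{il}-\alpha_i)^2=O_p(T^{-1})$, and the same with $\tilde\alpha_{il}$ for $\check\alpha_{il}$; $\mathbb E[\|\partial m_i-a_i\|^2\bar{\bar u}_i^2]=o(1)$ and $\mathbb E[(\partial m_i-a_i)\bar{\bar u}_i]=o(N^{-1/2})$. 4. Almost surely $\alpha\mapsto m(W_i,\alpha,\mu_0)$ is $C^2$ with second derivative bounded by a constant; for some constant $C$, with probability tending to one $\max_{i\le N}\mathbb E[u_{iT}^2\mid\mathcal F_i]\le C$, where $\mathcal F_i=\sigma(X_i,\bar{\bar Y}_i,\alpha_i)$ if $\tilde a_{il}=\tilde a_l(X_i,\tilde\alpha_{il})$, and $\mathcal F_i=\sigma(X_i,(Y_{it})_{t<T},\alpha_i)$ if $\tilde a_l$ is evaluated at a shrinkage estimate; $\mathbb E\|X_{it}\|^2<\infty$ (uniformly in all $t$), $\mathbb E[\|a_i\|^2\|X_{iT}\|^2]<\infty$, $\mathbb E[\|\tilde a_{il}\|^2\|X_{iT}\|^2]<\infty$, $\mathbb E\|\partial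 m_i-a_i\|^4<\infty$, $\mathbb E[\|\partial m_i-a_i\|\,\|\bar{\bar X}_i\|]<\infty$. 5. Only if $\check\alpha_{il}$ is an EB or SURE estimate: $0<\mathrm{Var}(\alpha_i)<\infty$; for some $\delta>0$ with $g>\frac12+\frac1{2+\delta}$, $\mathbb E[(T\hat u_i^2)^{2+\delta}\mid\mathcal W_l^C]=O_p(1)$ for $i\in I_l$; and $\mathbb E[\|\partial m_i-a_i\|\,|\alpha_i+\bar{\bar u}_i-\mathbb E\alpha_i|]<\infty$. 6. Only if $\check\alpha_{il}$ is the SURE estimate: $T\hat u_i^2$ is bounded away from zero in probability, that is, for every $\varepsilon>0$ there is $c>0$ with $\Pr(T\hat u_i^2<c)\le\varepsilon$ for all large $N$ and all $i\in I_l$. **Conclusion.** $$\frac1{\sqrt N}\sum_{l=1}^L\sum_{i\in I_l}\Big[m(W_i,\check\alpha_{il},\mu_0)+\tilde a_{il}\,(Y_{iT}-X_{iT}'\tilde\beta_l-\check\alpha_{il})\Big]=\frac1{\sqrt N}\sum_{i=1}^N\Big[m(W_i,\alpha_i,\mu_0)+a(X_i,\alpha_i,\mu_0)(Y_{iT}-X_{iT}'\beta_0-\alpha_i)\Big]+o_p(1).$$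 -/

import Mathlib

open MeasureTheory ProbabilityTheory Filter Topology
open scoped ENNReal NNReal

noncomputable section

namespace CrossFit

/-! ### Stochastic orders for nonnegative (extended real) sequences -/

/-- `Z_N = O_p(r_N)`. -/
def IsBigOp {Ω : Type*} [MeasurableSpace Ω] (P : Measure Ω)
    (Z : ℕ → Ω → ℝ≥0∞) (r : ℕ → ℝ) : Prop :=
  ∀ ε : ℝ≥0, 0 < ε → ∃ M : ℝ, 0 < M ∧
    ∀ᶠ N in atTop, P {ω | ENNReal.ofReal (M * r N) < Z N ω} ≤ ε

/-- `Z_N = o_p(r_N)`. -/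
def IsLittleOp {Ω : Type*} [MeasurableSpace Ω] (P : Measure Ω)
    (Z : ℕ → Ω → ℝ≥0∞) (r : ℕ → ℝ) : Prop :=
  ∀ c : ℝ, 0 < c → Tendsto (fun N => P {ω | ENNReal.ofReal (c * r N) < Z N ω}) atTop (𝓝 0)

/-- `Z_{N,i} = O_p(r_N)` for a generic unit `i` of the index set `S_N`, that is, uniformly over the
(identically distributed) units of `S_N`. No supremum over units is taken inside the probability. -/
def IsBigOpUnit {Ω : Type*} [MeasurableSpace Ω] (P : Measure Ω) (S : ℕ → Finset ℕ)
    (Z : ℕ → ℕ → Ω → ℝ≥0∞) (r : ℕ → ℝ) : Prop :=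
  ∀ ε : ℝ≥0, 0 < ε → ∃ M : ℝ, 0 < M ∧
    ∀ᶠ N in atTop, ∀ i ∈ S N, P {ω | ENNReal.ofReal (M * r N) < Z N i ω} ≤ ε

/-- `Z_{N,i} = o_p(r_N)` for a generic unit `i` of the index set `S_N`. -/
def IsLittleOpUnit {Ω : Type*} [MeasurableSpace Ω] (P : Measure Ω) (S : ℕ → Finset ℕ)
    (Z : ℕ → ℕ → Ω → ℝ≥0∞) (r : ℕ → ℝ) : Prop :=
  ∀ c : ℝ, 0 < c → ∀ ε : ℝ≥0, 0 < ε →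
    ∀ᶠ N in atTop, ∀ i ∈ S N, P {ω | ENNReal.ofReal (c * r N) < Z N i ω} ≤ ε

/-! ### The data, the folds and the estimators -/

/-- How the fixed effects are estimated: by plain time averages, or with Empirical Bayes or SURE
shrinkage of these time averages towards the fold mean. -/
inductive Shrinkage
  | none
  | eb
  | sure

/-- The primitive objects. Units are `i = 0, 1, 2, …`, the sample of size `N` being the units
`i < N`; periods are `t = 0, 1, 2, …`, the panel of sample size `N` using the periods `t < T N`, so
that its final period is `T N - 1`.

* `betaT N l`: first-stage estimate of the slope for fold `l`;
* `aT N l ω`: the fitted function of (regressors of a unit, value of the fixed effect) for fold `l`;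
* `V n r`: the estimate of the variance of the mean of `n` residuals computed from the residual
  vector `r`, such as `n⁻² ∑ r_t²` or a Newey-West estimate;
* `tuneSURE N l`: the prior variance selected by SURE in fold `l`. -/
structure Design (Ω : Type*) (p q k d L : ℕ) where
  W : ℕ → Ω → EuclideanSpace ℝ (Fin q)
  α : ℕ → Ω → ℝ
  X : ℕ → ℕ → Ω → EuclideanSpace ℝ (Fin p)
  Y : ℕ → ℕ → Ω → ℝ
  β₀ : EuclideanSpace ℝ (Fin p)
  μ₀ : EuclideanSpace ℝ (Fin d)
  m : EuclideanSpace ℝ (Fin q) → ℝ → EuclideanSpace ℝ (Fin d) → EuclideanSpace ℝ (Fin k)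
  T : ℕ → ℕ
  fold : ℕ → Fin L → Finset ℕ
  betaT : ℕ → Fin L → Ω → EuclideanSpace ℝ (Fin p)
  aT : (N : ℕ) → Fin L → Ω → (Fin (T N) → EuclideanSpace ℝ (Fin p)) → ℝ →
    EuclideanSpace ℝ (Fin k)
  V : (n : ℕ) → (Fin n → ℝ) → ℝ
  tuneSURE : ℕ → Fin L → Ω → ℝ

namespace Design

variable {Ω : Type*} {p q k d L : ℕ} (D : Design Ω p q k d L)

/-- The panel error `u_it = Y_it - X_it'β₀ - α_i`. -/
def u (i t : ℕ) (ω : Ω) : ℝ := D.Y i t ω - inner ℝ (D.X i t ω) D.β₀ - D.α i ω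

/-- The final period. -/
def last (N : ℕ) : ℕ := D.T N - 1

/-- Average of the outcome over all periods but the final one. -/
def Ybar (N i : ℕ) (ω : Ω) : ℝ :=
  (D.last N : ℝ)⁻¹ * ∑ t ∈ Finset.range (D.last N), D.Y i t ω

/-- Average of the regressors over all periods but the final one. -/
def Xbar (N i : ℕ) (ω : Ω) : EuclideanSpace ℝ (Fin p) :=
  (D.last N : ℝ)⁻¹ • ∑ t ∈ Finset.range (D.last N), D.X i t ω

/-- Average of the errors over all periods but the final one. -/
def ubar (N i : ℕ) (ω : Ω) : ℝ :=
  (D.last N : ℝ)⁻¹ * ∑ t ∈ Finset.range (D.last N), D.u i t ω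

/-- The regressors `X_i` of unit `i` in the panel of sample size `N`. -/
def Xpanel (N i : ℕ) (ω : Ω) : Fin (D.T N) → EuclideanSpace ℝ (Fin p) := fun t => D.X i t ω

/-- The outcomes of unit `i` before the final period. -/
def Ypre (N i : ℕ) (ω : Ω) : Fin (D.last N) → ℝ := fun t => D.Y i t ω

/-- The derivative of the moment function in the fixed effect, at the true values. -/
def dm (i : ℕ) (ω : Ω) : EuclideanSpace ℝ (Fin k) :=
  deriv (fun x => D.m (D.W i ω) x D.μ₀) (D.α i ω)

/-- `a(X_i, α_i, μ₀) = E[∂m(W_i, α_i, μ₀)/∂α_i | X_i, α_i]`. -/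
def a [MeasurableSpace Ω] (P : Measure Ω) (N i : ℕ) : Ω → EuclideanSpace ℝ (Fin k) :=
  P[D.dm i | MeasurableSpace.comap (fun ω => (D.Xpanel N i ω, D.α i ω)) inferInstance]

/-- Everything that concerns unit `i`. -/
def unit (i : ℕ) (ω : Ω) :
    EuclideanSpace ℝ (Fin q) × ℝ × (ℕ → EuclideanSpace ℝ (Fin p)) × (ℕ → ℝ) :=
  (D.W i ω, D.α i ω, fun t => D.X i t ω, fun t => D.Y i t ω)

/-- The σ-algebra of the observed data on the units outside fold `l`. -/
abbrev outOfFold (N : ℕ) (l : Fin L) : MeasurableSpace Ω :=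
  ⨆ i ∈ Finset.range N \ D.fold N l, MeasurableSpace.comap
    (fun ω => (D.W i ω, D.Xpanel N i ω, fun t : Fin (D.T N) => D.Y i t ω)) inferInstance

/-- The σ-algebra of the data outside fold `l` and of the panel data of the units in fold `l` up to
the last period but one, with all regressors. -/
abbrev preFinal (N : ℕ) (l : Fin L) : MeasurableSpace Ω :=
  D.outOfFold N l ⊔ ⨆ i ∈ D.fold N l, MeasurableSpace.comap
    (fun ω => (D.Xpanel N i ω, D.Ypre N i ω)) inferInstance

/-- The unshrunk estimate of `α_i` for a unit in fold `l`. -/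
def alphaRaw (N : ℕ) (l : Fin L) (i : ℕ) (ω : Ω) : ℝ :=
  D.Ybar N i ω - inner ℝ (D.Xbar N i ω) (D.betaT N l ω)

/-- The fold average of the unshrunk estimates. -/
def alphaMean (N : ℕ) (l : Fin L) (ω : Ω) : ℝ :=
  ((D.fold N l).card : ℝ)⁻¹ * ∑ i ∈ D.fold N l, D.alphaRaw N l i ω

/-- The estimated sampling variance of the unshrunk estimate of `α_i`, a function of the residuals
of unit `i` before the final period. -/
def uhatSq (N : ℕ) (l : Fin L) (i : ℕ) (ω : Ω) : ℝ :=
  D.V (D.last N) fun t =>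
    D.Y i t ω - inner ℝ (D.X i t ω) (D.betaT N l ω) - D.alphaRaw N l i ω

/-- The Empirical Bayes estimate of the variance of the fixed effects. -/
def tuneEB (N : ℕ) (l : Fin L) (ω : Ω) : ℝ :=
  (((D.fold N l).card : ℝ) - 1)⁻¹ *
      ∑ i ∈ D.fold N l, (D.alphaRaw N l i ω - D.alphaMean N l ω) ^ 2
    - (((D.fold N l).card : ℝ) - 1)⁻¹ * ∑ i ∈ D.fold N l, D.uhatSq N l i ω

/-- Stein's unbiased risk estimate in fold `l` as a function of the prior variance `s`. -/
def ure (N : ℕ) (l : Fin L) (ω : Ω) (s : ℝ) : ℝ :=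
  ((D.fold N l).card : ℝ)⁻¹ * ∑ i ∈ D.fold N l,
    (D.uhatSq N l i ω
      + D.uhatSq N l i ω ^ 2 * (D.alphaRaw N l i ω - D.alphaMean N l ω) ^ 2
          / (s + D.uhatSq N l i ω) ^ 2
      - 2 * D.uhatSq N l i ω ^ 2 / (s + D.uhatSq N l i ω))

/-- Shrinkage towards the fold mean with prior variance `s`. -/
def shrink (N : ℕ) (l : Fin L) (i : ℕ) (ω : Ω) (s : ℝ) : ℝ :=
  D.uhatSq N l i ω / (D.uhatSq N l i ω + s) * D.alphaMean N l ω
    + s / (s + D.uhatSq N l i ω) * D.alphaRaw N l i ω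

/-- The estimate of `α_i` for a unit in fold `l`. -/
def alphaT : Shrinkage → ℕ → Fin L → ℕ → Ω → ℝ
  | .none, N, l, i, ω => D.alphaRaw N l i ω
  | .eb, N, l, i, ω => D.shrink N l i ω (D.tuneEB N l ω)
  | .sure, N, l, i, ω => D.shrink N l i ω (D.tuneSURE N l ω)

/-- The estimate of `a(X_i, α_i, μ₀)` for a unit in fold `l`: the fitted function, evaluated at the
regressors of the unit and at the estimate of its fixed effect. -/
def aHat (κ : Shrinkage) (N : ℕ) (l : Fin L) (i : ℕ) (ω : Ω) : EuclideanSpace ℝ (Fin k) :=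
  D.aT N l ω (D.Xpanel N i ω) (D.alphaT κ N l i ω)

/-- The pre-final information on unit `i` that enters `aHat κ`, together with `α_i`: regressors and
time average of the outcomes if no shrinkage is used in `aHat`, regressors and all pre-final
outcomes otherwise. -/
abbrev info (κ : Shrinkage) (N i : ℕ) : MeasurableSpace Ω :=
  match κ with
  | .none => MeasurableSpace.comap
      (fun ω => (D.Xpanel N i ω, D.Ybar N i ω, D.α i ω)) inferInstance
  | _ => MeasurableSpace.comap
      (fun ω => (D.Xpanel N i ω, D.Ypre N i ω, D.α i ω)) inferInstance

/-- The scaled cross-fitted orthogonal sample moment at `μ₀`: the fixed effects are estimated by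
method `κ`, and method `κ'` supplies the value at which the fitted function is evaluated. -/
def feasible (κ κ' : Shrinkage) (N : ℕ) (ω : Ω) : EuclideanSpace ℝ (Fin k) :=
  (Real.sqrt N)⁻¹ • ∑ l : Fin L, ∑ i ∈ D.fold N l,
    (D.m (D.W i ω) (D.alphaT κ N l i ω) D.μ₀
      + (D.Y i (D.last N) ω - inner ℝ (D.X i (D.last N) ω) (D.betaT N l ω)
          - D.alphaT κ N l i ω) • D.aHat κ' N l i ω)

/-- The infeasible scaled sum of the orthogonal moments at the true values. -/
def infeasible [MeasurableSpace Ω] (P : Measure Ω) (N : ℕ) (ω : Ω) :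
    EuclideanSpace ℝ (Fin k) :=
  (Real.sqrt N)⁻¹ • ∑ i ∈ Finset.range N,
    (D.m (D.W i ω) (D.α i ω) D.μ₀
      + (D.Y i (D.last N) ω - inner ℝ (D.X i (D.last N) ω) D.β₀ - D.α i ω) • D.a P N i ω)

/-! ### Assumptions -/

/-- Measurability, independent and identically distributed units, a partition of the sample into
`L` folds, and estimates that are functions of the data they are allowed to use. -/
structure Setup [MeasurableSpace Ω] (P : Measure Ω) : Prop where
  measurable_W : ∀ i, Measurable (D.W i)
  measurable_α : ∀ i, Measurable (D.α i)
  measurable_X : ∀ i t, Measurable (D.X i t)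
  measurable_Y : ∀ i t, Measurable (D.Y i t)
  measurable_m : Measurable fun z : EuclideanSpace ℝ (Fin q) × ℝ => D.m z.1 z.2 D.μ₀
  indep : iIndepFun D.unit P
  ident : ∀ i, IdentDistrib (D.unit i) (D.unit 0) P P
  fold_disjoint : ∀ N, Pairwise fun l l' => Disjoint (D.fold N l) (D.fold N l')
  fold_union : ∀ N, Finset.univ.biUnion (D.fold N) = Finset.range N
  fold_card : ∀ N l, N / L ≤ (D.fold N l).card
  measurable_betaT : ∀ N l, Measurable[D.outOfFold N l] (D.betaT N l)
  measurable_aT : ∀ N l, Measurable[(D.outOfFold N l).prod inferInstance]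
    fun z : Ω × (Fin (D.T N) → EuclideanSpace ℝ (Fin p)) × ℝ => D.aT N l z.1 z.2.1 z.2.2

/-- The moment condition and sequential exogeneity with finite error variance. -/
structure MomentModel [MeasurableSpace Ω] (P : Measure Ω) (σ : ℝ) : Prop where
  integrable_m : ∀ i, Integrable (fun ω => D.m (D.W i ω) (D.α i ω) D.μ₀) P
  moment : ∀ i, ∫ ω, D.m (D.W i ω) (D.α i ω) D.μ₀ ∂P = 0
  memLp_u : ∀ i t, MemLp (D.u i t) 2 P
  var_u : ∀ i t, ∫ ω, D.u i t ω ^ 2 ∂P = σ ^ 2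
  exogenous : ∀ i t, P[D.u i t | MeasurableSpace.comap
    (fun ω => (D.X i t ω, D.α i ω, fun s : Fin t => (D.Y i s ω, D.X i s ω)))
    inferInstance] =ᵐ[P] 0

/-- Rates for the slope estimate and for the estimate of `a(X_i, α_i, μ₀)`. -/
structure NuisanceRates [MeasurableSpace Ω] (P : Measure Ω) (κ' : Shrinkage) (ζ : ℝ) : Prop where
  beta_rate : ∀ l, IsBigOp P (fun N ω => ‖D.betaT N l ω - D.β₀‖ₑ)
    (fun N => (Real.sqrt (N * D.T N))⁻¹)
  a_cond_rate : ∀ l, IsLittleOpUnit P (fun N => D.fold N l)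
    (fun N i => P⁻[fun ω => ‖D.aHat κ' N l i ω - D.a P N i ω‖ₑ ^ 2 | D.outOfFold N l])
    (fun N => (N : ℝ) ^ (-ζ))
  a_sq_integrable : ∀ l, ∀ᶠ N in atTop, ∀ i ∈ D.fold N l, MemLp (D.aHat κ' N l i) 2 P
  a_emp_rate : ∀ l, IsLittleOp P
    (fun N ω => ENNReal.ofReal (((D.fold N l).card : ℝ)⁻¹ *
      ∑ i ∈ D.fold N l, ‖D.aHat κ' N l i ω - D.a P N i ω‖ ^ 2))
    (fun N => (N : ℝ) ^ (-ζ))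

/-- The mean square error over each fold of the estimated fixed effects is `O_p(1/T)`. -/
def AlphaRate [MeasurableSpace Ω] (P : Measure Ω) (κ : Shrinkage) : Prop :=
  ∀ l, IsBigOp P
    (fun N ω => ENNReal.ofReal (((D.fold N l).card : ℝ)⁻¹ *
      ∑ i ∈ D.fold N l, (D.alphaT κ N l i ω - D.α i ω) ^ 2))
    (fun N => (D.T N : ℝ)⁻¹)

/-- Control of the correlation between `∂m/∂α - a` and the time average of the errors. -/
structure ErrorCorrelation [MeasurableSpace Ω] (P : Measure Ω) : Prop where
  second : ∀ ε : ℝ≥0, 0 < ε → ∀ᶠ N in atTop, ∀ i < N,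
    ∫⁻ ω, ‖D.dm i ω - D.a P N i ω‖ₑ ^ 2 * ‖D.ubar N i ω‖ₑ ^ 2 ∂P ≤ ε
  first : ∀ ε : ℝ, 0 < ε → ∀ᶠ N : ℕ in atTop, ∀ i < N,
    ‖∫ ω, D.ubar N i ω • (D.dm i ω - D.a P N i ω) ∂P‖ ≤ ε * (Real.sqrt N)⁻¹

/-- Smoothness and moment conditions, with bounds that do not depend on the sample size. -/
structure MomentBounds [MeasurableSpace Ω] (P : Measure Ω) (κ' : Shrinkage) : Prop where
  smooth : ∀ i, ∀ᵐ ω ∂P, ContDiff ℝ 2 fun x => D.m (D.W i ω) x D.μ₀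
  second_deriv : ∃ C : ℝ, ∀ i, ∀ᵐ ω ∂P, ∀ x,
    ‖iteratedDeriv 2 (fun x => D.m (D.W i ω) x D.μ₀) x‖ ≤ C
  integrable_dm : ∀ i, Integrable (D.dm i) P
  cond_var : ∃ C : ℝ, Tendsto (fun N => P {ω | ∃ i < N,
    C < (P[fun ω' => D.u i (D.last N) ω' ^ 2 | D.info κ' N i]) ω}) atTop (𝓝 0)
  X_sq : ∃ C : ℝ≥0, ∀ i t, ∫⁻ ω, ‖D.X i t ω‖ₑ ^ 2 ∂P ≤ C
  a_X : ∃ C : ℝ≥0, ∀ᶠ N in atTop, ∀ i < N,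
    ∫⁻ ω, ‖D.a P N i ω‖ₑ ^ 2 * ‖D.X i (D.last N) ω‖ₑ ^ 2 ∂P ≤ C
  aHat_X : ∃ C : ℝ≥0, ∀ᶠ N in atTop, ∀ l, ∀ i ∈ D.fold N l,
    ∫⁻ ω, ‖D.aHat κ' N l i ω‖ₑ ^ 2 * ‖D.X i (D.last N) ω‖ₑ ^ 2 ∂P ≤ C
  dm_fourth : ∃ C : ℝ≥0, ∀ᶠ N in atTop, ∀ i < N,
    ∫⁻ ω, ‖D.dm i ω - D.a P N i ω‖ₑ ^ 4 ∂P ≤ C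
  dm_Xbar : ∃ C : ℝ≥0, ∀ᶠ N in atTop, ∀ i < N,
    ∫⁻ ω, ‖D.dm i ω - D.a P N i ω‖ₑ * ‖D.Xbar N i ω‖ₑ ∂P ≤ C

/-- The additional conditions for shrinkage: heterogeneous fixed effects, moments of the estimated
sampling variances, and one more moment bound. -/
structure ShrinkageConditions [MeasurableSpace Ω] (P : Measure Ω) (g : ℝ) : Prop where
  measurable_V : ∀ n, Measurable (D.V n)
  nonneg_V : ∀ n r, 0 ≤ D.V n r
  memLp_α : ∀ i, MemLp (D.α i) 2 P
  var_α : ∀ i, 0 < Var[D.α i; P]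
  uhat_moment : ∃ δ : ℝ, 0 < δ ∧ 1 / 2 + 1 / (2 + δ) < g ∧
    ∀ l, IsBigOpUnit P (fun N => D.fold N l)
      (fun N i => P⁻[fun ω => ENNReal.ofReal ((D.T N * D.uhatSq N l i ω) ^ (2 + δ))
        | D.outOfFold N l]) (fun _ => 1)
  dm_α : ∃ C : ℝ≥0, ∀ᶠ N in atTop, ∀ i < N,
    ∫⁻ ω, ‖D.dm i ω - D.a P N i ω‖ₑ * ‖D.α i ω + D.ubar N i ω - ∫ ω', D.α i ω' ∂P‖ₑ ∂P ≤ C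

/-- The SURE prior variance is a function of the data it may use and minimizes the risk estimate
over `[0, ∞)`; the estimated sampling variances are not of smaller order than `1/T`. -/
structure SUREConditions [MeasurableSpace Ω] (P : Measure Ω) : Prop where
  measurable_tune : ∀ N l, Measurable[D.preFinal N l] (D.tuneSURE N l)
  nonneg_tune : ∀ N l ω, 0 ≤ D.tuneSURE N l ω
  isMinOn_tune : ∀ N l ω, IsMinOn (D.ure N l ω) (Set.Ici 0) (D.tuneSURE N l ω)
  uhat_nondegenerate : ∀ l, ∀ ε : ℝ≥0, 0 < ε → ∃ c : ℝ, 0 < c ∧ ∀ᶠ N in atTop,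
    ∀ i ∈ D.fold N l, P {ω | D.T N * D.uhatSq N l i ω < c} ≤ ε

end Design

end CrossFit

end

/-! Write `u` for the final-period error, `X` for the final-period regressor, `b` for the slope
error, `A` for the error of the estimated fixed effect, and `R` for the estimate of `a` minus `a`.
Expand `m` in the fixed effect to first order. The term `A ∂m` meets `-A a` from the correction
term, so each unit contributes a Taylor remainder, `A (∂m - a)`, `-A R`, `u R`, and `X'b` times the
estimate of `a`. The error `A` is the average past error, minus the average regressor times `b`,
plus the effect of shrinkage. This gives the seven sums of `sum_moment_sub_eq`, each negligible
after division by `√N`.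

Several of them are matters of rates. The Taylor remainder is of order `√N / T`, which vanishes as
`g > 1/2`. The product `A R` is handled by Cauchy-Schwarz and `ζ + g ≥ 1`. The two slope terms use
`√N b → 0`. The average past error times `∂m - a` is a sum of independent vectors with vanishing
second moments and means `o(N^{-1/2})`.

The term `u R` needs cross-fitting (`lintegral_weighted_noise_le`). The estimate of `a` may depend
on the pre-final data of the whole fold, but not on final outcomes inside it. Conditionally on a
unit's own pre-final information and on all other units, its final error still has mean zero, so the
summands are uncorrelated across units. Truncation to an event on which `R` and the conditional
variances are small, itself determined by the pre-final information, allows second moments to be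
used.

The shrinkage term is at most (largest estimated sampling variance) / `s` times averages that are
bounded in probability. A moment of order `2 + δ` bounds the largest variance by order `N^{1/(2+δ)}
/ T`, which is `o(N^{-1/2})`. It remains to keep `s` away from zero (`tuneEB_lower`,
`tuneSURE_lower`). For EB the dispersion of the estimates dominates that of the fixed effects. For
SURE, comparing the minimizer with `s → ∞` shows that a small `s` would force a small dispersion of
the estimates, which the positive variance of the fixed effects excludes. -/

namespace CrossFit

/-! ### Calculus of stochastic orders for real sequences -/

section Calculus

variable {Ω : Type*} [MeasurableSpace Ω] {P : Measure Ω}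

/-- `Z_N` is bounded above in probability. -/
def BddInProb (P : Measure Ω) (Z : ℕ → Ω → ℝ) : Prop :=
  ∀ ε : ℝ≥0∞, 0 < ε → ∃ M : ℝ, 0 < M ∧ ∀ᶠ N in atTop, P {ω | M < Z N ω} ≤ ε

/-- The positive part of `Z_N` tends to zero in probability. -/
def SmallInProb (P : Measure Ω) (Z : ℕ → Ω → ℝ) : Prop :=
  ∀ c : ℝ, 0 < c → ∀ ε : ℝ≥0∞, 0 < ε → ∀ᶠ N in atTop, P {ω | c < Z N ω} ≤ ε

lemma measure_le_of_forall_ae_imp {A B : Ω → Prop} (h : ∀ᵐ ω ∂P, A ω → B ω) :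
    P {ω | A ω} ≤ P {ω | B ω} := measure_mono_ae h

lemma measure_or_le (A B : Ω → Prop) :
    P {ω | A ω ∨ B ω} ≤ P {ω | A ω} + P {ω | B ω} := measure_union_le _ _

lemma SmallInProb.bdd {Z : ℕ → Ω → ℝ} (h : SmallInProb P Z) : BddInProb P Z :=
  fun ε hε => ⟨1, one_pos, h 1 one_pos ε hε⟩

lemma BddInProb.mono {Z Z' : ℕ → Ω → ℝ} (h : BddInProb P Z)
    (hZ : ∀ᶠ N in atTop, ∀ᵐ ω ∂P, Z' N ω ≤ Z N ω) : BddInProb P Z' := by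
  intro ε hε
  obtain ⟨M, hM, h⟩ := h ε hε
  refine ⟨M, hM, ?_⟩
  filter_upwards [h, hZ] with N h1 h2
  refine (measure_le_of_forall_ae_imp ?_).trans h1
  filter_upwards [h2] with ω h3 h4 using h4.trans_le h3

lemma SmallInProb.mono {Z Z' : ℕ → Ω → ℝ} (h : SmallInProb P Z)
    (hZ : ∀ᶠ N in atTop, ∀ᵐ ω ∂P, Z' N ω ≤ Z N ω) : SmallInProb P Z' := by
  intro c hc ε hε
  filter_upwards [h c hc ε hε, hZ] with N h1 h2
  refine (measure_le_of_forall_ae_imp ?_).trans h1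
  filter_upwards [h2] with ω h3 h4 using h4.trans_le h3

lemma BddInProb.add {Z Z' : ℕ → Ω → ℝ} (h : BddInProb P Z) (h' : BddInProb P Z') :
    BddInProb P (fun N ω => Z N ω + Z' N ω) := by
  intro ε hε
  obtain ⟨M, hM, h⟩ := h (ε / 2) (ENNReal.half_pos hε.ne')
  obtain ⟨M', hM', h'⟩ := h' (ε / 2) (ENNReal.half_pos hε.ne')
  refine ⟨M + M', by positivity, ?_⟩
  filter_upwards [h, h'] with N h1 h2
  calc _ ≤ P {ω | M < Z N ω ∨ M' < Z' N ω} := by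
        refine measure_mono fun ω hω => ?_
        simp only [Set.mem_ofPred_eq] at hω ⊢
        by_contra! hcon
        linarith
    _ ≤ _ := measure_or_le _ _
    _ ≤ ε / 2 + ε / 2 := add_le_add h1 h2
    _ = ε := ENNReal.add_halves ε

lemma SmallInProb.add {Z Z' : ℕ → Ω → ℝ} (h : SmallInProb P Z) (h' : SmallInProb P Z') :
    SmallInProb P (fun N ω => Z N ω + Z' N ω) := by
  intro c hc ε hε
  filter_upwards [h (c / 2) (half_pos hc) (ε / 2) (ENNReal.half_pos hε.ne'),
    h' (c / 2) (half_pos hc) (ε / 2) (ENNReal.half_pos hε.ne')] with N h1 h2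
  calc _ ≤ P {ω | c / 2 < Z N ω ∨ c / 2 < Z' N ω} := by
        refine measure_mono fun ω hω => ?_
        simp only [Set.mem_ofPred_eq] at hω ⊢
        by_contra! hcon
        linarith
    _ ≤ _ := measure_or_le _ _
    _ ≤ ε / 2 + ε / 2 := add_le_add h1 h2
    _ = ε := ENNReal.add_halves ε

/-- Only upper bounds are at stake, so one nonnegative factor suffices: `Z Z' ≤ Z M' ≤ M M'`,
whatever the sign of `Z'`. -/
lemma BddInProb.mul {Z Z' : ℕ → Ω → ℝ} (h : BddInProb P Z) (h' : BddInProb P Z')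
    (h0 : ∀ N ω, 0 ≤ Z N ω) :
    BddInProb P (fun N ω => Z N ω * Z' N ω) := by
  intro ε hε
  obtain ⟨M, hM, h⟩ := h (ε / 2) (ENNReal.half_pos hε.ne')
  obtain ⟨M', hM', h'⟩ := h' (ε / 2) (ENNReal.half_pos hε.ne')
  refine ⟨M * M', by positivity, ?_⟩
  filter_upwards [h, h'] with N h1 h2
  calc _ ≤ P {ω | M < Z N ω ∨ M' < Z' N ω} := by
        refine measure_mono fun ω hω => ?_
        simp only [Set.mem_ofPred_eq] at hω ⊢
        by_contra! hcon
        nlinarith [h0 N ω, mul_le_mul_of_nonneg_left hcon.2 (h0 N ω),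
          mul_le_mul_of_nonneg_right hcon.1 hM'.le]
    _ ≤ _ := measure_or_le _ _
    _ ≤ ε / 2 + ε / 2 := add_le_add h1 h2
    _ = ε := ENNReal.add_halves ε

lemma SmallInProb.mul_bdd {Z Z' : ℕ → Ω → ℝ} (h : SmallInProb P Z) (h' : BddInProb P Z')
    (h0 : ∀ N ω, 0 ≤ Z N ω) :
    SmallInProb P (fun N ω => Z N ω * Z' N ω) := by
  intro c hc ε hε
  obtain ⟨M', hM', h'⟩ := h' (ε / 2) (ENNReal.half_pos hε.ne')
  filter_upwards [h (c / M') (by positivity) (ε / 2) (ENNReal.half_pos hε.ne'), h'] with N h1 h2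
  calc _ ≤ P {ω | c / M' < Z N ω ∨ M' < Z' N ω} := by
        refine measure_mono fun ω hω => ?_
        simp only [Set.mem_ofPred_eq] at hω ⊢
        by_contra! hcon
        have := mul_le_mul_of_nonneg_left hcon.2 (h0 N ω)
        have h3 := mul_le_mul_of_nonneg_right hcon.1 hM'.le
        rw [div_mul_cancel₀ _ hM'.ne'] at h3
        linarith
    _ ≤ _ := measure_or_le _ _
    _ ≤ ε / 2 + ε / 2 := add_le_add h1 h2
    _ = ε := ENNReal.add_halves ε

lemma SmallInProb.of_tendsto {r : ℕ → ℝ} (h : Tendsto r atTop (𝓝 0)) :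
    SmallInProb P (fun N _ => r N) := by
  intro c hc ε _
  filter_upwards [h.eventually_lt_const hc] with N hN
  simp [hN.not_gt]

lemma BddInProb.const (C : ℝ) : BddInProb P (fun _ _ => C) := by
  intro ε _
  refine ⟨|C| + 1, by positivity, Eventually.of_forall fun N => ?_⟩
  have : ¬ |C| + 1 < C := by linarith [le_abs_self C]
  simp [this]

lemma BddInProb.const_mul {Z : ℕ → Ω → ℝ} (h : BddInProb P Z) {C : ℝ} (hC : 0 ≤ C) :
    BddInProb P (fun N ω => C * Z N ω) :=
  (BddInProb.const C).mul h fun _ _ => hC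

lemma BddInProb.tendsto_mul {Z : ℕ → Ω → ℝ} (h : BddInProb P Z) {r : ℕ → ℝ}
    (hr : Tendsto r atTop (𝓝 0)) (hr0 : ∀ N, 0 ≤ r N) :
    SmallInProb P (fun N ω => r N * Z N ω) :=
  (SmallInProb.of_tendsto hr).mul_bdd h fun N _ => hr0 N

lemma SmallInProb.const_mul {Z : ℕ → Ω → ℝ} (h : SmallInProb P Z) (C : ℝ)
    (h0 : ∀ N ω, 0 ≤ Z N ω) : SmallInProb P (fun N ω => C * Z N ω) := by
  refine (h.mul_bdd (BddInProb.const C) h0).mono (Eventually.of_forall fun N =>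
    Eventually.of_forall fun ω => (mul_comm _ _).le)

lemma SmallInProb.sqrt {Z : ℕ → Ω → ℝ} (h : SmallInProb P Z) :
    SmallInProb P (fun N ω => √(Z N ω)) := by
  intro c hc ε hε
  filter_upwards [h (c ^ 2) (by positivity) ε hε] with N hN
  refine le_trans (measure_mono fun ω hω => ?_) hN
  exact (Real.lt_sqrt hc.le).1 hω

lemma BddInProb.sqrt {Z : ℕ → Ω → ℝ} (h : BddInProb P Z) :
    BddInProb P (fun N ω => √(Z N ω)) := by
  intro ε hε
  obtain ⟨M, hM, h⟩ := h ε hε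
  refine ⟨√M, by positivity, ?_⟩
  filter_upwards [h] with N hN
  exact le_trans (measure_mono fun ω hω => (Real.sqrt_lt_sqrt_iff hM.le).1 hω) hN

lemma SmallInProb.sum {ι : Type*} (s : Finset ι) {Z : ι → ℕ → Ω → ℝ}
    (h : ∀ j ∈ s, SmallInProb P (Z j)) : SmallInProb P (fun N ω => ∑ j ∈ s, Z j N ω) := by
  classical
  induction s using Finset.induction_on with
  | empty => simpa using SmallInProb.of_tendsto (P := P) (tendsto_const_nhds (x := (0 : ℝ)))
  | insert j s hj ih =>
    simp only [Finset.sum_insert hj]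
    exact (h j (by simp)).add (ih fun i hi => h i (by simp [hi]))

/-- It suffices to dominate `Z` by a negligible sequence up to events of small probability. -/
lemma SmallInProb.of_forall_eps {Z : ℕ → Ω → ℝ}
    (h : ∀ ε : ℝ≥0∞, 0 < ε → ∃ Z' : ℕ → Ω → ℝ, SmallInProb P Z' ∧
      ∀ᶠ N in atTop, P {ω | Z' N ω < Z N ω} ≤ ε) : SmallInProb P Z := by
  intro c hc ε hε
  obtain ⟨Z', hs, hZ⟩ := h (ε / 2) (ENNReal.half_pos hε.ne')
  filter_upwards [hs c hc (ε / 2) (ENNReal.half_pos hε.ne'), hZ] with N h1 h2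
  calc _ ≤ P {ω | c < Z' N ω ∨ Z' N ω < Z N ω} := by
        refine measure_mono fun ω hω => ?_
        simp only [Set.mem_ofPred_eq] at hω ⊢
        by_contra! hcon
        linarith
    _ ≤ _ := measure_or_le _ _
    _ ≤ ε / 2 + ε / 2 := add_le_add h1 h2
    _ = ε := ENNReal.add_halves ε

/-- Passes from the extended-real order with a rate to a normalized real sequence. The rate
multiplies `Z'` instead of dividing `Z`, which avoids division in `ℝ≥0∞`. -/
lemma IsBigOp.bddInProb {Z : ℕ → Ω → ℝ≥0∞} {r : ℕ → ℝ} (h : IsBigOp P Z r)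
    (hr : ∀ᶠ N in atTop, 0 < r N) (Z' : ℕ → Ω → ℝ)
    (hZ : ∀ᶠ N in atTop, ∀ ω, ENNReal.ofReal (r N * Z' N ω) ≤ Z N ω) : BddInProb P Z' := by
  intro ε hε
  obtain ⟨ε', h0, hε'⟩ := ENNReal.lt_iff_exists_nnreal_btwn.1 hε
  obtain ⟨M, hM, h⟩ := h ε' (by simpa using h0)
  refine ⟨M, hM, ?_⟩
  filter_upwards [h, hr, hZ] with N h1 h2 h3
  refine le_trans (measure_mono fun ω hω => ?_) (h1.trans hε'.le)
  refine lt_of_lt_of_le ?_ (h3 ω)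
  simp only [Set.mem_ofPred_eq] at hω
  have : 0 < Z' N ω := hM.trans hω
  rw [ENNReal.ofReal_lt_ofReal_iff (by positivity), mul_comm]
  exact mul_lt_mul_of_pos_left hω h2

lemma IsLittleOp.smallInProb {Z : ℕ → Ω → ℝ≥0∞} {r : ℕ → ℝ} (h : IsLittleOp P Z r)
    (hr : ∀ᶠ N in atTop, 0 < r N) (Z' : ℕ → Ω → ℝ)
    (hZ : ∀ᶠ N in atTop, ∀ ω, ENNReal.ofReal (r N * Z' N ω) ≤ Z N ω) : SmallInProb P Z' := by
  intro c hc ε hε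
  filter_upwards [(h c hc).eventually_lt_const hε, hr, hZ] with N h1 h2 h3
  refine le_trans (measure_mono fun ω hω => ?_) h1.le
  refine lt_of_lt_of_le ?_ (h3 ω)
  simp only [Set.mem_ofPred_eq] at hω
  have : 0 < Z' N ω := hc.trans hω
  rw [ENNReal.ofReal_lt_ofReal_iff (by positivity), mul_comm]
  exact mul_lt_mul_of_pos_left hω h2

/-- Markov's inequality for the positive part. -/
lemma measure_lt_le_of_lintegral_le {f : Ω → ℝ} (hf : AEMeasurable f P) {C : ℝ≥0∞}
    (h : ∫⁻ ω, ENNReal.ofReal (f ω) ∂P ≤ C) {M : ℝ} (hM : 0 < M) :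
    P {ω | M < f ω} ≤ C / ENNReal.ofReal M := by
  refine le_trans (measure_mono fun ω hω => ?_)
    ((meas_ge_le_lintegral_div (μ := P) (f := fun ω => ENNReal.ofReal (f ω))
      hf.ennreal_ofReal (by simpa using hM : ENNReal.ofReal M ≠ 0) ENNReal.ofReal_ne_top).trans
      (ENNReal.div_le_div_right h _))
  exact ENNReal.ofReal_le_ofReal (le_of_lt hω)

lemma BddInProb.of_lintegral_le {Z : ℕ → Ω → ℝ} {C : ℝ≥0}
    (hm : ∀ᶠ N in atTop, AEMeasurable (Z N) P)
    (h : ∀ᶠ N in atTop, ∫⁻ ω, ENNReal.ofReal (Z N ω) ∂P ≤ C) : BddInProb P Z := by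
  intro ε hε
  obtain ⟨ε', h0, hε'⟩ := ENNReal.lt_iff_exists_nnreal_btwn.1 hε
  have h0' : 0 < ε' := by simpa using h0
  refine ⟨(C + 1) / ε', by positivity, ?_⟩
  filter_upwards [hm, h] with N h1 h2
  refine (measure_lt_le_of_lintegral_le h1 h2 (by positivity)).trans (le_trans ?_ hε'.le)
  have : ENNReal.ofReal (((C : ℝ) + 1) / ε') = ((C + 1) / ε' : ℝ≥0) := by
    rw [← ENNReal.ofReal_coe_nnreal]; congr 1
  rw [this, ← ENNReal.coe_div (by positivity)]
  norm_cast
  rw [div_div_eq_mul_div]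
  refine div_le_of_le_mul₀ (by positivity) (by positivity) ?_
  rw [mul_comm]
  gcongr
  exact le_self_add

lemma SmallInProb.of_lintegral {Z : ℕ → Ω → ℝ}
    (hm : ∀ᶠ N in atTop, AEMeasurable (Z N) P)
    (h : ∀ ε : ℝ≥0∞, 0 < ε → ∀ᶠ N in atTop, ∫⁻ ω, ENNReal.ofReal (Z N ω) ∂P ≤ ε) :
    SmallInProb P Z := by
  intro c hc ε hε
  have hc' : ENNReal.ofReal c ≠ 0 := by simpa using hc
  filter_upwards [hm, h (ε * ENNReal.ofReal c) (by positivity)] with N h1 h2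
  refine (measure_lt_le_of_lintegral_le h1 h2 hc).trans ?_
  rw [ENNReal.mul_div_cancel_right hc' ENNReal.ofReal_ne_top]

lemma SmallInProb.tendstoInMeasure {E : Type*} [NormedAddCommGroup E] {f : ℕ → Ω → E}
    (h : SmallInProb P (fun N ω => ‖f N ω‖)) : TendstoInMeasure P f atTop (fun _ => 0) := by
  refine tendstoInMeasure_of_ne_top fun ε hε hε' => ?_
  rw [ENNReal.tendsto_nhds_zero]
  intro η hη
  have hpos := ENNReal.toReal_pos hε.ne' hε'
  -- Halving `ε` turns the non-strict inequality of convergence in measure into a strict one.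
  filter_upwards [h (ε.toReal / 2) (half_pos hpos) η hη] with N hN
  refine le_trans (measure_mono fun ω hω => ?_) hN
  simp only [Set.mem_ofPred_eq, edist_zero_right] at hω ⊢
  have := ENNReal.toReal_mono (by simp) hω
  rw [toReal_enorm] at this
  linarith

end Calculus

/-! ### Averages over finite index sets -/

section Average

/-- The average of `f` over `S`. -/
noncomputable def avg (S : Finset ℕ) (f : ℕ → ℝ) : ℝ := (S.card : ℝ)⁻¹ * ∑ i ∈ S, f i

variable {S : Finset ℕ} {f g : ℕ → ℝ}

lemma avg_nonneg (h : ∀ i ∈ S, 0 ≤ f i) : 0 ≤ avg S f :=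
  mul_nonneg (by positivity) (Finset.sum_nonneg h)

lemma avg_mono (h : ∀ i ∈ S, f i ≤ g i) : avg S f ≤ avg S g :=
  mul_le_mul_of_nonneg_left (Finset.sum_le_sum h) (by positivity)

lemma avg_add : avg S (fun i => f i + g i) = avg S f + avg S g := by
  simp [avg, Finset.sum_add_distrib, mul_add]

lemma avg_sub : avg S (fun i => f i - g i) = avg S f - avg S g := by
  simp [avg, Finset.sum_sub_distrib, mul_sub]

lemma avg_const_mul (c : ℝ) : avg S (fun i => c * f i) = c * avg S f := by
  simp only [avg, ← Finset.mul_sum]; ring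

lemma avg_const (h : S.Nonempty) (c : ℝ) : avg S (fun _ => c) = c := by
  have : (S.card : ℝ) ≠ 0 := by simpa using h.ne_empty
  simp [avg, this]

lemma sum_eq_card_mul_avg : ∑ i ∈ S, f i = S.card * avg S f := by
  rcases S.eq_empty_or_nonempty with rfl | h
  · simp [avg]
  · have : (S.card : ℝ) ≠ 0 := by simpa using h.ne_empty
    rw [avg, mul_inv_cancel_left₀ this]

/-- Cauchy-Schwarz for averages. -/
lemma avg_mul_le_sqrt :
    avg S (fun i => f i * g i) ≤ √(avg S fun i => f i ^ 2) * √(avg S fun i => g i ^ 2) := by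
  have h := Real.sum_mul_le_sqrt_mul_sqrt S f g
  have hc : (0 : ℝ) ≤ (S.card : ℝ)⁻¹ := by positivity
  unfold avg
  rw [Real.sqrt_mul hc, Real.sqrt_mul hc]
  calc _ ≤ (S.card : ℝ)⁻¹ * (√(∑ i ∈ S, f i ^ 2) * √(∑ i ∈ S, g i ^ 2)) :=
        mul_le_mul_of_nonneg_left h hc
    _ = √(S.card : ℝ)⁻¹ * √(S.card : ℝ)⁻¹ * (√(∑ i ∈ S, f i ^ 2) * √(∑ i ∈ S, g i ^ 2)) := by
        rw [Real.mul_self_sqrt hc]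
    _ = _ := by ring

/-- A scaled sum of vectors over a subset of a sample of size `N`. -/
lemma norm_scaled_sum_le {E : Type*} [NormedAddCommGroup E] [NormedSpace ℝ E] {N : ℕ}
    (hS : S.card ≤ N) {v : ℕ → E} (h : ∀ i ∈ S, ‖v i‖ ≤ f i) :
    ‖(√(N : ℝ))⁻¹ • ∑ i ∈ S, v i‖ ≤ √(N : ℝ) * avg S f := by
  have h1 : ‖∑ i ∈ S, v i‖ ≤ S.card * avg S f := by
    rw [← sum_eq_card_mul_avg]
    exact (norm_sum_le _ _).trans (Finset.sum_le_sum h)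
  have h0 : 0 ≤ avg S f := avg_nonneg fun i hi => (norm_nonneg _).trans (h i hi)
  rw [norm_smul, norm_inv, Real.norm_of_nonneg (Real.sqrt_nonneg _)]
  rcases Nat.eq_zero_or_pos N with rfl | hN
  · simp
  · have hN' : (0 : ℝ) < √(N : ℝ) := by positivity
    rw [inv_mul_le_iff₀ hN']
    refine h1.trans ?_
    rw [← mul_assoc, Real.mul_self_sqrt (by positivity)]
    exact mul_le_mul_of_nonneg_right (by exact_mod_cast hS) h0

variable {Ω : Type*} [MeasurableSpace Ω] {P : Measure Ω}

/-- The positive part of a sum is at most the sum of the positive parts, so no sign condition is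
needed. -/
lemma lintegral_avg_le {F : ℕ → Ω → ℝ} (hm : ∀ i ∈ S, AEMeasurable (F i) P)
    {C : ℝ≥0∞} (h : ∀ i ∈ S, ∫⁻ ω, ENNReal.ofReal (F i ω) ∂P ≤ C) :
    ∫⁻ ω, ENNReal.ofReal (avg S fun i => F i ω) ∂P ≤ C := by
  rcases S.eq_empty_or_nonempty with rfl | hS
  · simp [avg]
  have hc : (S.card : ℝ≥0∞) ≠ 0 := by simpa using hS.ne_empty
  calc _ ≤ ∫⁻ ω, (S.card : ℝ≥0∞)⁻¹ * ∑ i ∈ S, ENNReal.ofReal (F i ω) ∂P := by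
        refine lintegral_mono fun ω => ?_
        unfold avg
        rw [ENNReal.ofReal_mul (by positivity), ENNReal.ofReal_inv_of_pos
          (by exact_mod_cast hS.card_pos), ENNReal.ofReal_natCast]
        gcongr
        calc ENNReal.ofReal (∑ i ∈ S, F i ω) ≤ ENNReal.ofReal (∑ i ∈ S, max (F i ω) 0) :=
              ENNReal.ofReal_le_ofReal (Finset.sum_le_sum fun i _ => le_max_left _ _)
          _ = ∑ i ∈ S, ENNReal.ofReal (max (F i ω) 0) :=
              ENNReal.ofReal_sum_of_nonneg fun i _ => le_max_right _ _
          _ = _ := by simp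
    _ = (S.card : ℝ≥0∞)⁻¹ * ∑ i ∈ S, ∫⁻ ω, ENNReal.ofReal (F i ω) ∂P := by
        rw [lintegral_const_mul' _ _ (by simpa using hS.ne_empty),
          lintegral_finsetSum' _ fun i hi => (hm i hi).ennreal_ofReal]
    _ ≤ (S.card : ℝ≥0∞)⁻¹ * ∑ _i ∈ S, C := by gcongr with i hi; exact h i hi
    _ = C := by
        rw [Finset.sum_const, nsmul_eq_mul, ← mul_assoc, ENNReal.inv_mul_cancel hc (by simp),
          one_mul]

lemma aemeasurable_avg {F : ℕ → Ω → ℝ} (hm : ∀ i ∈ S, AEMeasurable (F i) P) :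
    AEMeasurable (fun ω => avg S fun i => F i ω) P :=
  (Finset.aemeasurable_fun_sum S hm).const_mul _

lemma BddInProb.avg_of_lintegral_le {S : ℕ → Finset ℕ} {F : ℕ → ℕ → Ω → ℝ} {C : ℝ≥0}
    (hm : ∀ᶠ N in atTop, ∀ i ∈ S N, AEMeasurable (F N i) P)
    (h : ∀ᶠ N in atTop, ∀ i ∈ S N, ∫⁻ ω, ENNReal.ofReal (F N i ω) ∂P ≤ C) :
    BddInProb P (fun N ω => avg (S N) fun i => F N i ω) :=
  BddInProb.of_lintegral_le (hm.mono fun _ h => aemeasurable_avg h)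
    (by filter_upwards [hm, h] with N h1 h2 using lintegral_avg_le h1 h2)

end Average

end CrossFit

namespace CrossFit

/-! ### Conditional expectations and independence -/

section Conditional

variable {Ω : Type*} {m0 : MeasurableSpace Ω} {P : Measure Ω}

lemma isPiSystem_inter_measurableSet (F H : MeasurableSpace Ω) :
    IsPiSystem {s | ∃ a b, MeasurableSet[F] a ∧ MeasurableSet[H] b ∧ a ∩ b = s} := by
  rintro _ ⟨a, b, ha, hb, rfl⟩ _ ⟨a', b', ha', hb', rfl⟩ -
  exact ⟨a ∩ a', b ∩ b', ha.inter ha', hb.inter hb', by ext; simp; tauto⟩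

/-- Together with the preceding lemma this lets the π-λ theorem reduce identities over a join to
intersections `a ∩ b`. -/
lemma sup_eq_generateFrom_inter (F H : MeasurableSpace Ω) :
    F ⊔ H = MeasurableSpace.generateFrom
      {s | ∃ a b, MeasurableSet[F] a ∧ MeasurableSet[H] b ∧ a ∩ b = s} := by
  refine le_antisymm (sup_le ?_ ?_) (MeasurableSpace.generateFrom_le ?_)
  · intro a ha
    exact MeasurableSpace.measurableSet_generateFrom ⟨a, Set.univ, ha, .univ, by simp⟩
  · intro b hb
    exact MeasurableSpace.measurableSet_generateFrom ⟨Set.univ, b, .univ, hb, by simp⟩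
  · rintro _ ⟨a, b, ha, hb, rfl⟩
    exact ((le_sup_left : F ≤ F ⊔ H) _ ha).inter ((le_sup_right : H ≤ F ⊔ H) _ hb)

/-- The function `φ` cut off to `a` is `M`-measurable, hence its conditional expectation given `H`
is constant; integrate that constant over `b`. -/
lemma setIntegral_inter_of_indep [IsProbabilityMeasure P] {M H : MeasurableSpace Ω} (hM : M ≤ m0)
    (hH : H ≤ m0) (hind : Indep M H P) {φ : Ω → ℝ} (hφ : StronglyMeasurable[M] φ)
    (hint : Integrable φ P) {a b : Set Ω} (ha : MeasurableSet[M] a) (hb : MeasurableSet[H] b) :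
    ∫ ω in a ∩ b, φ ω ∂P = P.real b * ∫ ω in a, φ ω ∂P := by
  have h := condExp_indep_eq hM hH (hφ.indicator ha) hind
  rw [Set.inter_comm, ← setIntegral_indicator (hM _ ha),
    ← setIntegral_condExp hH (hint.indicator (hM _ ha)) hb,
    setIntegral_congr_ae (hH _ hb) (h.mono fun ω hω _ => hω), setIntegral_const,
    integral_indicator (hM _ ha), smul_eq_mul]

/-- Enlarging the conditioning σ-algebra by independent information does not change the conditional
expectation. -/
lemma condExp_sup_of_indep [IsProbabilityMeasure P] {F M H : MeasurableSpace Ω} (hFM : F ≤ M)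
    (hM : M ≤ m0) (hH : H ≤ m0) (hind : Indep M H P) {f : Ω → ℝ} (hf : StronglyMeasurable[M] f)
    (hint : Integrable f P) : P[f | F ⊔ H] =ᵐ[P] P[f | F] := by
  have hF := hFM.trans hM
  refine (ae_eq_condExp_of_forall_setIntegral_eq (sup_le hF hH) hint
    (fun s _ _ => integrable_condExp.integrableOn) (fun s hs _ => ?_)
    (stronglyMeasurable_condExp.mono le_sup_left).aestronglyMeasurable).symm
  have hle : F ⊔ H ≤ m0 := sup_le hF hH
  -- On `a ∩ b` independence pulls the factor `P b` out of both sides, and what is left is the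
  -- defining property of `P[f | F]` on `a`.
  induction s, hs using MeasurableSpace.induction_on_inter (sup_eq_generateFrom_inter F H)
    (isPiSystem_inter_measurableSet F H) with
  | empty => simp
  | basic t ht =>
    obtain ⟨a, b, ha, hb, rfl⟩ := ht
    rw [setIntegral_inter_of_indep hM hH hind (stronglyMeasurable_condExp.mono hFM)
      integrable_condExp (hFM _ ha) hb, setIntegral_inter_of_indep hM hH hind hf hint (hFM _ ha) hb,
      setIntegral_condExp hF hint ha]
  | compl t ht ih =>
    have h1 := integral_add_compl (hle _ ht) (integrable_condExp (f := f) (μ := P) (m := F))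
    have h2 := integral_add_compl (hle _ ht) hint
    have h3 : ∫ ω, (P[f | F]) ω ∂P = ∫ ω, f ω ∂P := integral_condExp hF
    linarith [ih (measure_lt_top _ _)]
  | iUnion g hd hg ih =>
    rw [integral_iUnion (fun i => hle _ (hg i)) hd integrable_condExp.integrableOn,
      integral_iUnion (fun i => hle _ (hg i)) hd hint.integrableOn]
    exact tsum_congr fun i => ih i (measure_lt_top _ _)

lemma integral_mul_eq_zero_of_condExp_eq_zero [IsFiniteMeasure P] {F : MeasurableSpace Ω}
    (hF : F ≤ m0) {f g : Ω → ℝ} (hf : StronglyMeasurable[F] f) (hg : Integrable g P)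
    (hfg : Integrable (f * g) P) (h : P[g | F] =ᵐ[P] 0) : ∫ ω, f ω * g ω ∂P = 0 := by
  have h1 := condExp_mul_of_stronglyMeasurable_left hf hfg hg
  have h2 : ∫ ω, (P[f * g | F]) ω ∂P = ∫ ω, (f * g) ω ∂P := integral_condExp hF
  change ∫ ω, (f * g) ω ∂P = 0
  rw [← h2]
  refine integral_eq_zero_of_ae ?_
  filter_upwards [h1, h] with ω h3 h4
  simp [h3, h4]

variable {E : Type*} [NormedAddCommGroup E] [InnerProductSpace ℝ E]

lemma MemLp.integrable_inner_of_two {f g : Ω → E} (hf : MemLp f 2 P) (hg : MemLp g 2 P) :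
    Integrable (fun ω => inner ℝ (f ω) (g ω)) P := by
  refine Integrable.mono' (g := fun ω => ‖f ω‖ * ‖g ω‖) (hf.norm.integrable_mul hg.norm)
    (hf.1.inner hg.1) (Eventually.of_forall fun ω => ?_)
  exact norm_inner_le_norm _ _

/-- The second moment of a sum of uncorrelated random vectors. -/
lemma integral_norm_sum_sq_of_orthogonal {S : Finset ℕ} {v : ℕ → Ω → E}
    (hv : ∀ i ∈ S, MemLp (v i) 2 P)
    (ho : ∀ i ∈ S, ∀ j ∈ S, i ≠ j → ∫ ω, inner ℝ (v i ω) (v j ω) ∂P = 0) :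
    ∫ ω, ‖∑ i ∈ S, v i ω‖ ^ 2 ∂P = ∑ i ∈ S, ∫ ω, ‖v i ω‖ ^ 2 ∂P := by
  have h : ∀ ω, ‖∑ i ∈ S, v i ω‖ ^ 2 = ∑ i ∈ S, ∑ j ∈ S, inner ℝ (v i ω) (v j ω) := by
    intro ω
    rw [← real_inner_self_eq_norm_sq, sum_inner]
    simp_rw [inner_sum]
  simp_rw [h]
  rw [integral_finsetSum _ fun i hi => integrable_finsetSum _ fun j hj =>
    MemLp.integrable_inner_of_two (hv i hi) (hv j hj)]
  refine Finset.sum_congr rfl fun i hi => ?_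
  rw [integral_finsetSum _ fun j hj => MemLp.integrable_inner_of_two (hv i hi) (hv j hj),
    Finset.sum_eq_single i (fun j hj hji => ho i hi j hj hji.symm) (fun h => (h hi).elim)]
  simp_rw [real_inner_self_eq_norm_sq]

/-- Chebyshev bound for sums of uncorrelated random vectors. -/
lemma lintegral_norm_scaled_sum_sq_le [IsFiniteMeasure P] {S : Finset ℕ} {N : ℕ}
    (hS : S.card ≤ N) {v : ℕ → Ω → E}
    (hv : ∀ i ∈ S, MemLp (v i) 2 P)
    (ho : ∀ i ∈ S, ∀ j ∈ S, i ≠ j → ∫ ω, inner ℝ (v i ω) (v j ω) ∂P = 0) {C : ℝ}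
    (hC : ∑ i ∈ S, ∫ ω, ‖v i ω‖ ^ 2 ∂P ≤ N * C) (hC0 : 0 ≤ C) :
    ∫⁻ ω, ENNReal.ofReal (‖(√(N : ℝ))⁻¹ • ∑ i ∈ S, v i ω‖ ^ 2) ∂P ≤ ENNReal.ofReal C := by
  have hsum : MemLp (fun ω => (√(N : ℝ))⁻¹ • ∑ i ∈ S, v i ω) 2 P :=
    (memLp_finsetSum S hv).const_smul _
  rw [← ofReal_integral_eq_lintegral_ofReal (hsum.integrable_norm_pow (by simp))
    (Eventually.of_forall fun ω => by positivity)]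
  refine ENNReal.ofReal_le_ofReal ?_
  simp_rw [norm_smul, mul_pow]
  rw [integral_const_mul, integral_norm_sum_sq_of_orthogonal hv ho, norm_inv, inv_pow,
    Real.norm_of_nonneg (Real.sqrt_nonneg _), Real.sq_sqrt (by positivity)]
  rcases Nat.eq_zero_or_pos N with rfl | hN
  · simpa using hC0
  · rwa [inv_mul_le_iff₀ (by positivity)]

end Conditional

/-! ### Measurability and independence of the units -/

namespace Design

variable {Ω : Type*} {p q k d L : ℕ} (D : Design Ω p q k d L)

/-- The σ-algebra generated by unit `i`. -/
abbrev unitAlg (i : ℕ) : MeasurableSpace Ω := MeasurableSpace.comap (D.unit i) inferInstance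

/-- The σ-algebra generated by all units except `i`. -/
abbrev othersAlg (i : ℕ) : MeasurableSpace Ω := ⨆ j ∈ ({i}ᶜ : Set ℕ), D.unitAlg j

lemma unitAlg_le_othersAlg {i j : ℕ} (h : j ≠ i) : D.unitAlg j ≤ D.othersAlg i :=
  le_iSup₂ (f := fun j (_ : j ∈ ({i}ᶜ : Set ℕ)) => D.unitAlg j) j h

lemma measurable_unit_W (i : ℕ) : Measurable[D.unitAlg i] (D.W i) :=
  measurable_fst.comp (comap_measurable (D.unit i))

lemma measurable_unit_α (i : ℕ) : Measurable[D.unitAlg i] (D.α i) :=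
  (measurable_fst.comp measurable_snd).comp (comap_measurable (D.unit i))

lemma measurable_unit_X (i t : ℕ) : Measurable[D.unitAlg i] (D.X i t) :=
  ((measurable_pi_apply t).comp (measurable_fst.comp (measurable_snd.comp measurable_snd))).comp
    (comap_measurable (D.unit i))

lemma measurable_unit_Y (i t : ℕ) : Measurable[D.unitAlg i] (D.Y i t) :=
  ((measurable_pi_apply t).comp (measurable_snd.comp (measurable_snd.comp measurable_snd))).comp
    (comap_measurable (D.unit i))

lemma measurable_unit_u (i t : ℕ) : Measurable[D.unitAlg i] (D.u i t) :=
  ((D.measurable_unit_Y i t).sub ((D.measurable_unit_X i t).inner measurable_const)).sub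
    (D.measurable_unit_α i)

lemma measurable_unit_ubar (N i : ℕ) : Measurable[D.unitAlg i] (D.ubar N i) :=
  (Finset.measurable_fun_sum _ fun t _ => D.measurable_unit_u i t).const_mul _

lemma measurable_unit_Ybar (N i : ℕ) : Measurable[D.unitAlg i] (D.Ybar N i) :=
  (Finset.measurable_fun_sum _ fun t _ => D.measurable_unit_Y i t).const_mul _

lemma measurable_unit_Xbar (N i : ℕ) : Measurable[D.unitAlg i] (D.Xbar N i) :=
  (Finset.measurable_fun_sum _ fun t _ => D.measurable_unit_X i t).fun_const_smul _

lemma measurable_unit_Xpanel (N i : ℕ) : Measurable[D.unitAlg i] (D.Xpanel N i) :=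
  @measurable_pi_lambda _ _ _ (D.unitAlg i) _ _ fun t => D.measurable_unit_X i t

lemma measurable_unit_Ypre (N i : ℕ) : Measurable[D.unitAlg i] (D.Ypre N i) :=
  @measurable_pi_lambda _ _ _ (D.unitAlg i) _ _ fun t => D.measurable_unit_Y i t

lemma info_le_unitAlg (κ : Shrinkage) (N i : ℕ) : D.info κ N i ≤ D.unitAlg i := by
  cases κ
  · exact Measurable.comap_le ((D.measurable_unit_Xpanel N i).prodMk
      ((D.measurable_unit_Ybar N i).prodMk (D.measurable_unit_α i)))
  all_goals exact Measurable.comap_le ((D.measurable_unit_Xpanel N i).prodMk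
      ((D.measurable_unit_Ypre N i).prodMk (D.measurable_unit_α i)))

/-- This is where cross-fitting enters: nothing estimated outside the fold uses a unit inside it. -/
lemma outOfFold_le_othersAlg {N : ℕ} {l : Fin L} {i : ℕ} (hi : i ∈ D.fold N l) :
    D.outOfFold N l ≤ D.othersAlg i := by
  refine iSup₂_le fun j hj => ?_
  have hji : j ≠ i := by
    rintro rfl
    exact (Finset.mem_sdiff.1 hj).2 hi
  refine le_trans (Measurable.comap_le ?_) (D.unitAlg_le_othersAlg hji)
  exact (D.measurable_unit_W j).prodMk ((D.measurable_unit_Xpanel N j).prodMk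
    (@measurable_pi_lambda _ _ _ (D.unitAlg j) _ _ fun t => D.measurable_unit_Y j t))

lemma measurable_info_Xpanel (κ : Shrinkage) (N i : ℕ) :
    Measurable[D.info κ N i] (D.Xpanel N i) := by
  cases κ
  · exact measurable_fst.comp (comap_measurable fun ω => (D.Xpanel N i ω, D.Ybar N i ω, D.α i ω))
  all_goals
    exact measurable_fst.comp (comap_measurable fun ω => (D.Xpanel N i ω, D.Ypre N i ω, D.α i ω))

lemma measurable_info_α (κ : Shrinkage) (N i : ℕ) : Measurable[D.info κ N i] (D.α i) := by
  cases κ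
  · exact (measurable_snd.comp measurable_snd).comp
      (comap_measurable fun ω => (D.Xpanel N i ω, D.Ybar N i ω, D.α i ω))
  all_goals
    exact (measurable_snd.comp measurable_snd).comp
      (comap_measurable fun ω => (D.Xpanel N i ω, D.Ypre N i ω, D.α i ω))

lemma measurable_info_Ypre {κ : Shrinkage} (hκ : κ ≠ .none) (N i : ℕ) :
    Measurable[D.info κ N i] (D.Ypre N i) := by
  cases κ
  · exact (hκ rfl).elim
  all_goals
    exact (measurable_fst.comp measurable_snd).comp
      (comap_measurable fun ω => (D.Xpanel N i ω, D.Ypre N i ω, D.α i ω))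

lemma measurable_info_X (κ : Shrinkage) (N i : ℕ) {t : ℕ} (ht : t < D.T N) :
    Measurable[D.info κ N i] (D.X i t) :=
  (measurable_pi_apply (⟨t, ht⟩ : Fin (D.T N))).comp (D.measurable_info_Xpanel κ N i)

lemma measurable_info_Y {κ : Shrinkage} (hκ : κ ≠ .none) (N i : ℕ) {t : ℕ} (ht : t < D.last N) :
    Measurable[D.info κ N i] (D.Y i t) :=
  (measurable_pi_apply (⟨t, ht⟩ : Fin (D.last N))).comp (D.measurable_info_Ypre hκ N i)

lemma lt_T_of_lt_last {N t : ℕ} (ht : t < D.last N) : t < D.T N :=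
  ht.trans_le (Nat.sub_le _ _)

lemma measurable_info_Xbar (κ : Shrinkage) (N i : ℕ) : Measurable[D.info κ N i] (D.Xbar N i) :=
  (Finset.measurable_fun_sum _ fun _ ht => D.measurable_info_X κ N i
    (D.lt_T_of_lt_last (Finset.mem_range.1 ht))).fun_const_smul _

lemma measurable_info_Ybar (κ : Shrinkage) (N i : ℕ) : Measurable[D.info κ N i] (D.Ybar N i) := by
  by_cases hκ : κ = .none
  · subst hκ
    exact (measurable_fst.comp measurable_snd).comp
      (comap_measurable fun ω => (D.Xpanel N i ω, D.Ybar N i ω, D.α i ω))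
  · exact (Finset.measurable_fun_sum _ fun _ ht => D.measurable_info_Y hκ N i
      (Finset.mem_range.1 ht)).const_mul _

lemma stronglyMeasurable_info_a [MeasurableSpace Ω] (P : Measure Ω) (κ : Shrinkage) (N i : ℕ) :
    StronglyMeasurable[D.info κ N i] (D.a P N i) := by
  refine StronglyMeasurable.mono stronglyMeasurable_condExp (Measurable.comap_le ?_)
  exact (D.measurable_info_Xpanel κ N i).prodMk (D.measurable_info_α κ N i)

/-- The σ-algebra of the data outside fold `l` and of the pre-final information on the units in
fold `l` that is used with shrinkage method `κ`. -/
noncomputable abbrev foldInfo (κ : Shrinkage) (N : ℕ) (l : Fin L) : MeasurableSpace Ω :=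
  D.outOfFold N l ⊔ ⨆ i ∈ D.fold N l, D.info κ N i

lemma info_le_foldInfo (κ : Shrinkage) {N : ℕ} {l : Fin L} {i : ℕ} (hi : i ∈ D.fold N l) :
    D.info κ N i ≤ D.foldInfo κ N l :=
  (le_iSup₂ (f := fun j (_ : j ∈ D.fold N l) => D.info κ N j) i hi).trans le_sup_right

/-- Shrinkage mixes the units of a fold, so estimates for one unit involve its neighbours. The
larger σ-algebra on the right adds to the unit's own pre-final information only data independent of
the unit, and hence leaves the conditional mean of its final error at zero. -/
lemma foldInfo_le (κ : Shrinkage) {N : ℕ} {l : Fin L} {i : ℕ} (hi : i ∈ D.fold N l) :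
    D.foldInfo κ N l ≤ D.info κ N i ⊔ D.othersAlg i := by
  refine sup_le ((D.outOfFold_le_othersAlg hi).trans le_sup_right) (iSup₂_le fun j hj => ?_)
  by_cases hji : j = i
  · subst hji; exact le_sup_left
  · exact ((D.info_le_unitAlg κ N j).trans (D.unitAlg_le_othersAlg hji)).trans le_sup_right

/-- Without shrinkage `info` retains only the time average of the outcomes, which does not determine
the individual outcomes. -/
lemma preFinal_le_foldInfo {κ : Shrinkage} (hκ : κ ≠ .none) (N : ℕ) (l : Fin L) :
    D.preFinal N l ≤ D.foldInfo κ N l := by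
  refine sup_le le_sup_left (iSup₂_le fun j hj => le_trans (Measurable.comap_le ?_)
    (D.info_le_foldInfo κ hj))
  exact (D.measurable_info_Xpanel κ N j).prodMk (D.measurable_info_Ypre hκ N j)

variable {D} [MeasurableSpace Ω] {P : Measure Ω}

lemma Setup.measurable_unit (h : D.Setup P) (i : ℕ) : Measurable (D.unit i) :=
  (h.measurable_W i).prodMk ((h.measurable_α i).prodMk
    ((measurable_pi_lambda _ fun t => h.measurable_X i t).prodMk
      (measurable_pi_lambda _ fun t => h.measurable_Y i t)))

lemma Setup.unitAlg_le (h : D.Setup P) (i : ℕ) : D.unitAlg i ≤ ‹MeasurableSpace Ω› :=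
  (h.measurable_unit i).comap_le

lemma Setup.othersAlg_le (h : D.Setup P) (i : ℕ) : D.othersAlg i ≤ ‹MeasurableSpace Ω› :=
  iSup₂_le fun j _ => h.unitAlg_le j

lemma Setup.outOfFold_le (h : D.Setup P) (N : ℕ) (l : Fin L) :
    D.outOfFold N l ≤ ‹MeasurableSpace Ω› := by
  refine iSup₂_le fun j _ => Measurable.comap_le ?_
  exact (h.measurable_W j).prodMk ((measurable_pi_lambda (D.Xpanel N j) fun t => h.measurable_X j t).prodMk
    (measurable_pi_lambda _ fun t => h.measurable_Y j t))

lemma Setup.info_le (h : D.Setup P) (κ : Shrinkage) (N i : ℕ) :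
    D.info κ N i ≤ ‹MeasurableSpace Ω› :=
  (D.info_le_unitAlg κ N i).trans (h.unitAlg_le i)

lemma Setup.foldInfo_le (h : D.Setup P) (κ : Shrinkage) (N : ℕ) (l : Fin L) :
    D.foldInfo κ N l ≤ ‹MeasurableSpace Ω› :=
  sup_le (h.outOfFold_le N l) (iSup₂_le fun i _ => h.info_le κ N i)

lemma Setup.iIndep_unitAlg (h : D.Setup P) : iIndep D.unitAlg P := h.indep

lemma Setup.indep_othersAlg (h : D.Setup P) (i : ℕ) : Indep (D.unitAlg i) (D.othersAlg i) P := by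
  have := indep_iSup_of_disjoint h.unitAlg_le h.iIndep_unitAlg
    (disjoint_compl_right (a := ({i} : Set ℕ)))
  rwa [iSup_singleton] at this

lemma Setup.mem_fold_lt (h : D.Setup P) {N : ℕ} {l : Fin L} {i : ℕ} (hi : i ∈ D.fold N l) :
    i < N := by
  have : i ∈ Finset.univ.biUnion (D.fold N) := Finset.mem_biUnion.2 ⟨l, Finset.mem_univ _, hi⟩
  rw [h.fold_union] at this
  exact Finset.mem_range.1 this

lemma Setup.card_fold_le (h : D.Setup P) (N : ℕ) (l : Fin L) : (D.fold N l).card ≤ N := by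
  simpa using Finset.card_le_card fun i hi => Finset.mem_range.2 (h.mem_fold_lt (l := l) hi)

lemma Setup.tendsto_card_fold (h : D.Setup P) (l : Fin L) :
    Tendsto (fun N => (D.fold N l).card) atTop atTop := by
  have hL : L ≠ 0 := fun h0 => (h0 ▸ l).elim0
  exact tendsto_atTop_mono (fun N => h.fold_card N l) (Nat.tendsto_div_const_atTop hL)

lemma Setup.measurable_foldInfo_alphaRaw (h : D.Setup P) (κ : Shrinkage) {N : ℕ} {l : Fin L}
    {i : ℕ} (hi : i ∈ D.fold N l) : Measurable[D.foldInfo κ N l] (D.alphaRaw N l i) := by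
  have hle := D.info_le_foldInfo κ hi
  exact ((D.measurable_info_Ybar κ N i).mono hle le_rfl).sub
    (((D.measurable_info_Xbar κ N i).mono hle le_rfl).inner
      ((h.measurable_betaT N l).mono le_sup_left le_rfl))

lemma Setup.measurable_foldInfo_uhatSq (h : D.Setup P) (hV : ∀ n, Measurable (D.V n))
    {κ : Shrinkage} (hκ : κ ≠ .none) {N : ℕ} {l : Fin L}
    {i : ℕ} (hi : i ∈ D.fold N l) : Measurable[D.foldInfo κ N l] (D.uhatSq N l i) := by
  have hle := D.info_le_foldInfo κ hi
  refine (hV _).comp (@measurable_pi_lambda _ _ _ (D.foldInfo κ N l) _ _ fun t => ?_)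
  exact (((D.measurable_info_Y hκ N i t.2).mono hle le_rfl).sub
    (((D.measurable_info_X κ N i (D.lt_T_of_lt_last t.2)).mono hle le_rfl).inner
      ((h.measurable_betaT N l).mono le_sup_left le_rfl))).sub
    (h.measurable_foldInfo_alphaRaw κ hi)

lemma Setup.measurable_foldInfo_alphaMean (h : D.Setup P) (κ : Shrinkage) (N : ℕ) (l : Fin L) :
    Measurable[D.foldInfo κ N l] (D.alphaMean N l) :=
  (Finset.measurable_fun_sum _ fun _ hi => h.measurable_foldInfo_alphaRaw κ hi).const_mul _

lemma Setup.measurable_foldInfo_shrink (h : D.Setup P) (hV : ∀ n, Measurable (D.V n))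
    {κ : Shrinkage} (hκ : κ ≠ .none) {N : ℕ} {l : Fin L}
    {i : ℕ} (hi : i ∈ D.fold N l) {s : Ω → ℝ} (hs : Measurable[D.foldInfo κ N l] s) :
    Measurable[D.foldInfo κ N l] (fun ω => D.shrink N l i ω (s ω)) := by
  have hu := h.measurable_foldInfo_uhatSq hV hκ hi
  exact ((hu.div (hu.add hs)).mul (h.measurable_foldInfo_alphaMean κ N l)).add
    ((hs.div (hs.add hu)).mul (h.measurable_foldInfo_alphaRaw κ hi))

lemma Setup.measurable_foldInfo_tuneEB (h : D.Setup P) (hV : ∀ n, Measurable (D.V n))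
    {κ : Shrinkage} (hκ : κ ≠ .none) (N : ℕ) (l : Fin L) :
    Measurable[D.foldInfo κ N l] (D.tuneEB N l) :=
  ((Finset.measurable_fun_sum _ fun _ hi => ((h.measurable_foldInfo_alphaRaw κ hi).sub
      (h.measurable_foldInfo_alphaMean κ N l)).pow_const 2).const_mul _).sub
    ((Finset.measurable_fun_sum _ fun _ hi => h.measurable_foldInfo_uhatSq hV hκ hi).const_mul _)

lemma Setup.measurable_foldInfo_alphaT (h : D.Setup P) {κ : Shrinkage}
    (hV : κ ≠ .none → ∀ n, Measurable (D.V n))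
    (hs : κ = .sure → ∀ N l, Measurable[D.preFinal N l] (D.tuneSURE N l))
    {N : ℕ} {l : Fin L} {i : ℕ} (hi : i ∈ D.fold N l) :
    Measurable[D.foldInfo κ N l] (D.alphaT κ N l i) := by
  cases κ
  · exact h.measurable_foldInfo_alphaRaw .none hi
  · exact h.measurable_foldInfo_shrink (hV (by simp)) (by simp) hi
      (h.measurable_foldInfo_tuneEB (hV (by simp)) (by simp) N l)
  · exact h.measurable_foldInfo_shrink (hV (by simp)) (by simp) hi
      ((hs rfl N l).mono (D.preFinal_le_foldInfo (by simp) N l) le_rfl)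

lemma Setup.measurable_foldInfo_aHat (h : D.Setup P) {κ : Shrinkage}
    (hV : κ ≠ .none → ∀ n, Measurable (D.V n))
    (hs : κ = .sure → ∀ N l, Measurable[D.preFinal N l] (D.tuneSURE N l))
    {N : ℕ} {l : Fin L} {i : ℕ} (hi : i ∈ D.fold N l) :
    Measurable[D.foldInfo κ N l] (D.aHat κ N l i) := by
  -- The fitted function is random as well as its argument. The first coordinate `ω` carries only
  -- the out-of-fold σ-algebra, and joint measurability of `aT` does the rest.
  have h1 : @Measurable Ω (Ω × (Fin (D.T N) → EuclideanSpace ℝ (Fin p)) × ℝ)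
      (D.foldInfo κ N l) ((D.outOfFold N l).prod inferInstance)
      (fun ω => (ω, D.Xpanel N i ω, D.alphaT κ N l i ω)) := by
    refine @Measurable.prodMk _ _ _ _ (D.outOfFold N l) _ _ _ ?_ ?_
    · exact measurable_id.mono le_sup_left le_rfl
    · exact ((D.measurable_info_Xpanel κ N i).mono (D.info_le_foldInfo κ hi) le_rfl).prodMk
        (h.measurable_foldInfo_alphaT hV hs hi)
  exact (h.measurable_aT N l).comp h1

/-- The derivative of the moment function is, up to a null set, a function of the unit. -/
lemma Setup.exists_measurable_dm (h : D.Setup P)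
    (hsm : ∀ i, ∀ᵐ ω ∂P, ContDiff ℝ 2 fun x => D.m (D.W i ω) x D.μ₀) (i : ℕ) :
    ∃ f, Measurable[D.unitAlg i] f ∧ f =ᵐ[P] D.dm i := by
  -- Difference quotients with step `1/(n+1)`: each is a measurable function of `(W_i, α_i)`, and
  -- they converge almost surely to the derivative.
  let q : ℕ → EuclideanSpace ℝ (Fin q) × ℝ → EuclideanSpace ℝ (Fin k) := fun n z =>
    ((n : ℝ) + 1) • (D.m z.1 (z.2 + ((n : ℝ) + 1)⁻¹) D.μ₀ - D.m z.1 z.2 D.μ₀)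
  have hq : ∀ n, Measurable (q n) := fun n =>
    ((h.measurable_m.comp (measurable_fst.prodMk (measurable_snd.add_const _))).sub
      h.measurable_m).fun_const_smul _
  have hWα : Measurable fun ω => (D.W i ω, D.α i ω) :=
    (h.measurable_W i).prodMk (h.measurable_α i)
  have hlim : ∀ᵐ ω ∂P, Tendsto (fun n => q n (D.W i ω, D.α i ω)) atTop (𝓝 (D.dm i ω)) := by
    filter_upwards [hsm i] with ω hω
    have hd : HasDerivAt (fun x => D.m (D.W i ω) x D.μ₀) (D.dm i ω) (D.α i ω) :=
      (hω.differentiable (by norm_num) _).hasDerivAt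
    have hn : Tendsto (fun n : ℕ => ((n : ℝ) + 1)⁻¹) atTop (𝓝[≠] 0) :=
      tendsto_nhdsWithin_iff.2 ⟨tendsto_inv_atTop_zero.comp
        (tendsto_atTop_add_const_right _ _ tendsto_natCast_atTop_atTop),
        Eventually.of_forall fun n => by
          have : (0 : ℝ) < (n + 1 : ℝ)⁻¹ := by positivity
          exact this.ne'⟩
    refine ((hasDerivAt_iff_tendsto_slope_zero.1 hd).comp hn).congr fun n => ?_
    simp [q]
  -- Convergence is moved to the law of `(W_i, α_i)`, so that the measurable limit is a function of
  -- these two variables and not merely of `ω`.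
  have hex : ∀ᵐ z ∂(P.map fun ω => (D.W i ω, D.α i ω)), ∃ y,
      Tendsto (fun n => q n z) atTop (𝓝 y) := by
    rw [ae_map_iff hWα.aemeasurable (measurableSet_exists_tendsto hq)]
    exact hlim.mono fun ω hω => ⟨_, hω⟩
  obtain ⟨φ, hφ, hφl⟩ := measurable_limit_of_tendsto_metrizable_ae
    (fun n => (hq n).aemeasurable) hex
  refine ⟨fun ω => φ (D.W i ω, D.α i ω),
    hφ.comp ((D.measurable_unit_W i).prodMk (D.measurable_unit_α i)), ?_⟩
  filter_upwards [hlim, ae_of_ae_map hWα.aemeasurable hφl] with ω h1 h2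
  exact tendsto_nhds_unique h2 h1

lemma Setup.measurable_u (h : D.Setup P) (i t : ℕ) : Measurable (D.u i t) :=
  (D.measurable_unit_u i t).mono (h.unitAlg_le i) le_rfl

lemma Setup.measurable_ubar (h : D.Setup P) (N i : ℕ) : Measurable (D.ubar N i) :=
  (D.measurable_unit_ubar N i).mono (h.unitAlg_le i) le_rfl

lemma Setup.measurable_Xbar (h : D.Setup P) (N i : ℕ) : Measurable (D.Xbar N i) :=
  (D.measurable_unit_Xbar N i).mono (h.unitAlg_le i) le_rfl

lemma Setup.measurable_a (h : D.Setup P) (N i : ℕ) : Measurable (D.a P N i) :=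
  ((D.stronglyMeasurable_info_a P .none N i).mono (h.info_le .none N i)).measurable

end Design

end CrossFit

namespace CrossFit

/-! ### Rates -/

/-- Only the lower half of the order of `T` matters: `N^g ≤ C T` makes the ratio at most `C
N^{e-g}`. -/
lemma tendsto_rpow_mul_inv_of_isTheta {T : ℕ → ℕ} {g e : ℝ} (he : e < g)
    (hT : (fun N => (T N : ℝ)) =Θ[atTop] fun N : ℕ => (N : ℝ) ^ g) :
    Tendsto (fun N : ℕ => (N : ℝ) ^ e * (T N : ℝ)⁻¹) atTop (𝓝 0) := by
  obtain ⟨C, hC, h⟩ := hT.2.exists_pos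
  have hlim : Tendsto (fun N : ℕ => C * (N : ℝ) ^ (-(g - e))) atTop (𝓝 0) := by
    simpa using ((tendsto_rpow_neg_atTop (sub_pos.2 he)).comp
      tendsto_natCast_atTop_atTop).const_mul C
  refine squeeze_zero' (Eventually.of_forall fun N => by positivity) ?_ hlim
  filter_upwards [h.bound, eventually_gt_atTop 0] with N hN h0
  have h0' : (0 : ℝ) < N := by exact_mod_cast h0
  have hg : 0 < (N : ℝ) ^ g := Real.rpow_pos_of_pos h0' g
  rw [Real.norm_of_nonneg hg.le, Real.norm_of_nonneg (by positivity)] at hN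
  have hTpos : (0 : ℝ) < T N := by
    by_contra hcon
    have : (T N : ℝ) = 0 := le_antisymm (not_lt.1 hcon) (by positivity)
    rw [this] at hN
    linarith
  rw [mul_inv_le_iff₀ hTpos]
  have h1 : (N : ℝ) ^ e = (N : ℝ) ^ (-(g - e)) * (N : ℝ) ^ g := by
    rw [← Real.rpow_add h0']; ring_nf
  rw [h1]
  have h2 : 0 ≤ (N : ℝ) ^ (-(g - e)) := by positivity
  nlinarith [mul_le_mul_of_nonneg_left hN h2]

lemma eventually_rpow_le_of_isTheta {T : ℕ → ℕ} {g e : ℝ} (he : e ≤ g)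
    (hT : (fun N => (T N : ℝ)) =Θ[atTop] fun N : ℕ => (N : ℝ) ^ g) :
    ∃ C : ℝ, 0 < C ∧ ∀ᶠ N : ℕ in atTop, (N : ℝ) ^ e ≤ C * T N := by
  obtain ⟨C, hC, h⟩ := hT.2.exists_pos
  refine ⟨C, hC, ?_⟩
  filter_upwards [h.bound, eventually_ge_atTop 1] with N hN h1
  rw [Real.norm_of_nonneg (by positivity), Real.norm_of_nonneg (by positivity)] at hN
  exact (Real.rpow_le_rpow_of_exponent_le (by exact_mod_cast h1) he).trans hN

lemma tendsto_atTop_of_isTheta {T : ℕ → ℕ} {g : ℝ} (hg : 0 < g)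
    (hT : (fun N => (T N : ℝ)) =Θ[atTop] fun N : ℕ => (N : ℝ) ^ g) :
    Tendsto T atTop atTop := by
  obtain ⟨C, hC, h⟩ := eventually_rpow_le_of_isTheta le_rfl hT
  have h1 : Tendsto (fun N : ℕ => (N : ℝ) ^ g / C) atTop atTop :=
    ((tendsto_rpow_atTop hg).comp tendsto_natCast_atTop_atTop).atTop_div_const hC
  refine tendsto_natCast_atTop_iff.1 (tendsto_atTop_mono' _ ?_ h1 : Tendsto
    (fun N => (T N : ℝ)) atTop atTop)
  filter_upwards [h] with N hN
  rwa [div_le_iff₀ hC, mul_comm]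

namespace Design

variable {Ω : Type*} {p q k d L : ℕ}

/-! ### The final-period errors -/

/-- The variables on which the errors of period `t` of unit `i` have conditional mean zero. -/
def past (D : Design Ω p q k d L) (i t : ℕ) (ω : Ω) :
    EuclideanSpace ℝ (Fin p) × ℝ × (Fin t → ℝ × EuclideanSpace ℝ (Fin p)) :=
  (D.X i t ω, D.α i ω, fun s => (D.Y i s ω, D.X i s ω))

/-- Sequential exogeneity conditions on the current regressor and on all earlier outcomes and
regressors. At the final period this covers the whole regressor panel. -/
lemma info_le_comap_past (D : Design Ω p q k d L) (κ : Shrinkage) {N : ℕ} (i : ℕ) :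
    D.info κ N i ≤ MeasurableSpace.comap (D.past i (D.last N)) inferInstance := by
  have hX : Measurable[MeasurableSpace.comap (D.past i (D.last N)) inferInstance]
      (D.X i (D.last N)) := measurable_fst.comp (comap_measurable (D.past i (D.last N)))
  have hα : Measurable[MeasurableSpace.comap (D.past i (D.last N)) inferInstance] (D.α i) :=
    (measurable_fst.comp measurable_snd).comp (comap_measurable (D.past i (D.last N)))
  have hYX : ∀ s : Fin (D.last N), Measurable[MeasurableSpace.comap (D.past i (D.last N))
      inferInstance] fun ω => (D.Y i s ω, D.X i s ω) := fun s =>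
    ((measurable_pi_apply s).comp (measurable_snd.comp measurable_snd)).comp
      (comap_measurable (D.past i (D.last N)))
  have hY : ∀ s < D.last N, Measurable[MeasurableSpace.comap (D.past i (D.last N))
      inferInstance] (D.Y i s) := fun s hs => measurable_fst.comp (hYX ⟨s, hs⟩)
  have hX' : ∀ s : Fin (D.T N), Measurable[MeasurableSpace.comap (D.past i (D.last N))
      inferInstance] (D.X i s) := by
    intro s
    -- Earlier regressors belong to the past; the final one is the current regressor.
    rcases (Nat.le_sub_one_of_lt s.2 : (s : ℕ) ≤ D.last N).lt_or_eq with hs | hs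
    · exact measurable_snd.comp (hYX ⟨s, hs⟩)
    · rw [hs]; exact hX
  have hXp : Measurable[MeasurableSpace.comap (D.past i (D.last N)) inferInstance]
    (D.Xpanel N i) := @measurable_pi_lambda _ _ _ (_) _ _ hX'
  cases κ
  · exact Measurable.comap_le (hXp.prodMk (((Finset.measurable_fun_sum _ fun s hs =>
      hY s (Finset.mem_range.1 hs)).const_mul _).prodMk hα))
  all_goals
    exact Measurable.comap_le (hXp.prodMk
      ((@measurable_pi_lambda _ _ _ (_) _ _ fun s : Fin (D.last N) => hY s s.2).prodMk hα))

lemma MomentModel.condExp_info_u_eq_zero [MeasurableSpace Ω] {P : Measure Ω}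
    [IsProbabilityMeasure P] {D : Design Ω p q k d L} {σ : ℝ} (h : D.Setup P)
    (hm : D.MomentModel P σ) (κ : Shrinkage) (N i : ℕ) :
    P[D.u i (D.last N) | D.info κ N i] =ᵐ[P] 0 := by
  have hF0 : MeasurableSpace.comap (D.past i (D.last N)) inferInstance ≤ ‹MeasurableSpace Ω› :=
    Measurable.comap_le ((h.measurable_X i _).prodMk ((h.measurable_α i).prodMk
      (measurable_pi_lambda _ fun s => (h.measurable_Y i s).prodMk (h.measurable_X i s))))
  refine (condExp_condExp_of_le (D.info_le_comap_past κ i) hF0).symm.trans ?_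
  refine (condExp_congr_ae (hm.exogenous i (D.last N))).trans ?_
  rw [condExp_zero]

variable {D : Design Ω p q k d L} [MeasurableSpace Ω] {P : Measure Ω}

variable {E : Type*} [NormedAddCommGroup E] [InnerProductSpace ℝ E]

lemma memLp_smul_of_bounded {f : Ω → ℝ} (hf : MemLp f 2 P) {w : Ω → E}
    (hw : AEStronglyMeasurable w P) {B : ℝ} (hB : ∀ ω, ‖w ω‖ ≤ B) :
    MemLp (fun ω => f ω • w ω) 2 P := by
  refine MemLp.of_le_mul (c := B) hf (hf.1.smul hw) (Eventually.of_forall fun ω => ?_)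
  rw [norm_smul, mul_comm]
  exact mul_le_mul_of_nonneg_right (hB ω) (norm_nonneg _)

/-- Final-period errors, weighted by bounded functions of the pre-final information, are
uncorrelated over the units of a fold. -/
lemma Setup.lintegral_weighted_noise_le [IsProbabilityMeasure P] (h : D.Setup P) {κ : Shrinkage}
    {N : ℕ} {l : Fin L} (hu : ∀ i, MemLp (D.u i (D.last N)) 2 P)
    (hex : ∀ i, P[D.u i (D.last N) | D.info κ N i] =ᵐ[P] 0) {w : ℕ → Ω → E}
    (hw : ∀ i ∈ D.fold N l, StronglyMeasurable[D.foldInfo κ N l] (w i)) {B C K : ℝ}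
    (hB : ∀ i ∈ D.fold N l, ∀ ω, ‖w i ω‖ ≤ B) (hC : 0 ≤ C) (hK : 0 ≤ K)
    (hwC : ∀ i ∈ D.fold N l, ∀ ω, w i ω ≠ 0 →
      (P[fun ω' => D.u i (D.last N) ω' ^ 2 | D.info κ N i]) ω ≤ C)
    (hwK : ∀ ω, ∑ i ∈ D.fold N l, ‖w i ω‖ ^ 2 ≤ N * K) :
    ∫⁻ ω, ENNReal.ofReal (‖(√(N : ℝ))⁻¹ • ∑ i ∈ D.fold N l, D.u i (D.last N) ω • w i ω‖ ^ 2) ∂P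
      ≤ ENNReal.ofReal (C * K) := by
  have hG := h.foldInfo_le κ N l
  have hwm : ∀ i ∈ D.fold N l, AEStronglyMeasurable (w i) P := fun i hi =>
    ((hw i hi).mono hG).aestronglyMeasurable
  have hw2 : ∀ i ∈ D.fold N l, Integrable (fun ω => ‖w i ω‖ ^ 2) P := fun i hi =>
    Integrable.of_bound (C := B ^ 2) ((hwm i hi).norm.pow 2) (Eventually.of_forall fun ω => by
      rw [Real.norm_of_nonneg (by positivity)]
      exact pow_le_pow_left₀ (norm_nonneg _) (hB i hi ω) 2)
  refine lintegral_norm_scaled_sum_sq_le (h.card_fold_le N l)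
    (fun i hi => memLp_smul_of_bounded (hu i) (hwm i hi) (hB i hi)) ?_ ?_ (by positivity)
  -- Off-diagonal terms: given the information on `i` and all other units, `u_j` and both weights
  -- are known, and `u_i` has conditional mean zero.
  · intro i hi j hj hij
    have hle : D.info κ N i ⊔ D.othersAlg i ≤ ‹MeasurableSpace Ω› :=
      sup_le (h.info_le κ N i) (h.othersAlg_le i)
    have hz : P[D.u i (D.last N) | D.info κ N i ⊔ D.othersAlg i] =ᵐ[P] 0 :=
      (condExp_sup_of_indep (D.info_le_unitAlg κ N i) (h.unitAlg_le i) (h.othersAlg_le i)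
        (h.indep_othersAlg i) (D.measurable_unit_u i _).stronglyMeasurable
        ((hu i).integrable (by norm_num))).trans (hex i)
    have hφ : StronglyMeasurable[D.info κ N i ⊔ D.othersAlg i]
        (fun ω => D.u j (D.last N) ω * inner ℝ (w i ω) (w j ω)) := by
      have hg := D.foldInfo_le κ hi
      refine StronglyMeasurable.mul ?_ (((hw i hi).mono hg).inner ((hw j hj).mono hg))
      exact (D.measurable_unit_u j _).stronglyMeasurable.mono
        ((D.unitAlg_le_othersAlg hij.symm).trans le_sup_right)
    have heq : ∀ ω, inner ℝ (D.u i (D.last N) ω • w i ω) (D.u j (D.last N) ω • w j ω)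
        = (D.u j (D.last N) ω * inner ℝ (w i ω) (w j ω)) * D.u i (D.last N) ω := by
      intro ω
      rw [real_inner_smul_left, real_inner_smul_right]; ring
    simp_rw [heq]
    refine integral_mul_eq_zero_of_condExp_eq_zero hle hφ ((hu i).integrable (by norm_num)) ?_ hz
    refine (MemLp.integrable_inner_of_two (memLp_smul_of_bounded (hu i) (hwm i hi) (hB i hi))
      (memLp_smul_of_bounded (hu j) (hwm j hj) (hB j hj))).congr (Eventually.of_forall heq)
  -- Diagonal terms: condition on the same σ-algebra and replace `u_i²` by its conditional variance,
  -- which is at most `C` wherever the weight is nonzero. The pathwise bound on the sum of squared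
  -- weights is applied under the integral.
  · calc ∑ i ∈ D.fold N l, ∫ ω, ‖D.u i (D.last N) ω • w i ω‖ ^ 2 ∂P
        ≤ ∑ i ∈ D.fold N l, C * ∫ ω, ‖w i ω‖ ^ 2 ∂P := by
          refine Finset.sum_le_sum fun i hi => ?_
          have hle : D.info κ N i ⊔ D.othersAlg i ≤ ‹MeasurableSpace Ω› :=
            sup_le (h.info_le κ N i) (h.othersAlg_le i)
          have hu2 := (hu i).integrable_sq
          have hc := condExp_sup_of_indep (D.info_le_unitAlg κ N i) (h.unitAlg_le i)
            (h.othersAlg_le i) (h.indep_othersAlg i)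
            ((D.measurable_unit_u i (D.last N)).pow_const 2).stronglyMeasurable hu2
          have hwg : StronglyMeasurable[D.info κ N i ⊔ D.othersAlg i] (fun ω => ‖w i ω‖ ^ 2) :=
            (((hw i hi).mono (D.foldInfo_le κ hi)).norm).pow 2
          have hint : Integrable ((fun ω => ‖w i ω‖ ^ 2) * fun ω => D.u i (D.last N) ω ^ 2) P :=
            hu2.bdd_mul ((hwm i hi).norm.pow 2) (c := B ^ 2) (Eventually.of_forall fun ω => by
              rw [Real.norm_of_nonneg (by positivity)]
              exact pow_le_pow_left₀ (norm_nonneg _) (hB i hi ω) 2)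
          have hpull := condExp_mul_of_stronglyMeasurable_left hwg hint hu2
          rw [← integral_const_mul]
          calc ∫ ω, ‖D.u i (D.last N) ω • w i ω‖ ^ 2 ∂P
              = ∫ ω, ((fun ω => ‖w i ω‖ ^ 2) * fun ω => D.u i (D.last N) ω ^ 2) ω ∂P := by
                congr 1; ext ω
                simp only [norm_smul, mul_pow, Real.norm_eq_abs, sq_abs, Pi.mul_apply]
                ring
            _ = ∫ ω, (P[(fun ω => ‖w i ω‖ ^ 2) * fun ω => D.u i (D.last N) ω ^ 2 |
                  D.info κ N i ⊔ D.othersAlg i]) ω ∂P := (integral_condExp hle).symm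
            _ ≤ ∫ ω, C * ‖w i ω‖ ^ 2 ∂P := by
                refine integral_mono_ae integrable_condExp ((hw2 i hi).const_mul C) ?_
                filter_upwards [hpull, hc] with ω h1 h2
                rw [h1, Pi.mul_apply, h2]
                by_cases h0 : w i ω = 0
                · simp [h0]
                · rw [mul_comm]
                  exact mul_le_mul_of_nonneg_right (hwC i hi ω h0) (by positivity)
      _ = C * ∫ ω, ∑ i ∈ D.fold N l, ‖w i ω‖ ^ 2 ∂P := by
          rw [integral_finsetSum _ hw2, Finset.mul_sum]
      _ ≤ C * ∫ _ω, (N : ℝ) * K ∂P := by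
          refine mul_le_mul_of_nonneg_left (integral_mono (integrable_finsetSum _ hw2)
            (integrable_const _) hwK) hC
      _ = N * (C * K) := by simp; ring

/-- The final-period errors do not interact with the estimation error of the conditional mean
derivative. -/
theorem small_noise [IsProbabilityMeasure P] {σ ζ : ℝ} {κ : Shrinkage} (h : D.Setup P)
    (hm : D.MomentModel P σ) (hV : κ ≠ .none → ∀ n, Measurable (D.V n))
    (hs : κ = .sure → ∀ N l, Measurable[D.preFinal N l] (D.tuneSURE N l))
    (hnuis : D.NuisanceRates P κ ζ) (hζ : 0 < ζ) (hmom : D.MomentBounds P κ)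
    (l : Fin L) :
    SmallInProb P (fun N ω => ‖(√(N : ℝ))⁻¹ • ∑ i ∈ D.fold N l,
      D.u i (D.last N) ω • (D.aHat κ N l i ω - D.a P N i ω)‖) := by
  obtain ⟨C, hC⟩ := hmom.cond_var
  -- Since this event lies in `foldInfo`, cutting the weights off to it preserves uncorrelatedness,
  -- while the bounds needed hold on it for every `ω`.
  set good : ℕ → Set Ω := fun N => {ω | avg (D.fold N l)
      (fun i => ‖D.aHat κ N l i ω - D.a P N i ω‖ ^ 2) ≤ (N : ℝ) ^ (-ζ) ∧
    ∀ i ∈ D.fold N l, (P[fun ω' => D.u i (D.last N) ω' ^ 2 | D.info κ N i]) ω ≤ C} with hgood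
  have hdiff : ∀ N, ∀ i ∈ D.fold N l, StronglyMeasurable[D.foldInfo κ N l]
      (fun ω => D.aHat κ N l i ω - D.a P N i ω) := fun N i hi =>
    (h.measurable_foldInfo_aHat hV hs hi).stronglyMeasurable.sub
      ((D.stronglyMeasurable_info_a P κ N i).mono (D.info_le_foldInfo κ hi))
  have hgm : ∀ N, MeasurableSet[D.foldInfo κ N l] (good N) := by
    intro N
    have heq : good N = {ω | avg (D.fold N l) (fun i => ‖D.aHat κ N l i ω - D.a P N i ω‖ ^ 2)
        ≤ (N : ℝ) ^ (-ζ)} ∩ ⋂ i ∈ D.fold N l,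
          {ω | (P[fun ω' => D.u i (D.last N) ω' ^ 2 | D.info κ N i]) ω ≤ C} := by
      ext; simp [hgood]
    rw [heq]
    refine MeasurableSet.inter ?_ (Finset.measurableSet_biInter _ fun i hi => measurableSet_le
      ((stronglyMeasurable_condExp.mono (D.info_le_foldInfo κ hi)).measurable) measurable_const)
    exact measurableSet_le ((Finset.measurable_fun_sum _ fun i hi =>
      ((hdiff N i hi).norm.pow 2).measurable).const_mul _) measurable_const
  set w : ℕ → ℕ → Ω → EuclideanSpace ℝ (Fin k) := fun N i =>
    (good N).indicator fun ω => D.aHat κ N l i ω - D.a P N i ω with hwdef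
  have hsum : ∀ N ω, ∑ i ∈ D.fold N l, ‖w N i ω‖ ^ 2 ≤ N * (N : ℝ) ^ (-ζ) := by
    intro N ω
    by_cases hω : ω ∈ good N
    · simp only [hwdef, Set.indicator_of_mem hω]
      rw [sum_eq_card_mul_avg]
      exact mul_le_mul (by exact_mod_cast h.card_fold_le N l) hω.1
        (avg_nonneg fun i _ => by positivity) (by positivity)
    · simp only [hwdef, Set.indicator_of_notMem hω]
      simp only [norm_zero, ne_eq, OfNat.ofNat_ne_zero, not_false_eq_true, zero_pow,
        Finset.sum_const_zero]
      positivity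
  have hbound : ∀ᶠ N : ℕ in atTop, ∫⁻ ω, ENNReal.ofReal (‖(√(N : ℝ))⁻¹ • ∑ i ∈ D.fold N l,
      D.u i (D.last N) ω • w N i ω‖ ^ 2) ∂P ≤ ENNReal.ofReal (max C 0 * (N : ℝ) ^ (-ζ)) := by
    refine Eventually.of_forall fun N => ?_
    -- The individual bound `B` is read off from the bound on the sum of squares; it serves
    -- integrability and does not enter the conclusion.
    refine h.lintegral_weighted_noise_le (κ := κ) (B := √(N * (N : ℝ) ^ (-ζ)))
      (fun i => hm.memLp_u i _) (fun i => hm.condExp_info_u_eq_zero h κ N i)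
      (fun i hi => (hdiff N i hi).indicator (hgm N)) ?_ (le_max_right _ _) (by positivity) ?_
      (hsum N)
    · intro i hi ω
      refine Real.le_sqrt_of_sq_le (le_trans ?_ (hsum N ω))
      exact Finset.single_le_sum (f := fun i => ‖w N i ω‖ ^ 2) (fun j _ => by positivity) hi
    · intro i hi ω hne
      have hω : ω ∈ good N := by
        by_contra hcon
        exact hne (Set.indicator_of_notMem hcon _)
      exact (hω.2 i hi).trans (le_max_left _ _)
  have hlim : Tendsto (fun N : ℕ => max C 0 * (N : ℝ) ^ (-ζ)) atTop (𝓝 0) := by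
    simpa using ((tendsto_rpow_neg_atTop hζ).comp
      tendsto_natCast_atTop_atTop).const_mul (max C 0)
  have hwm : ∀ N, ∀ i ∈ D.fold N l, StronglyMeasurable (w N i) := fun N i hi =>
    ((hdiff N i hi).indicator (hgm N)).mono (h.foldInfo_le κ N l)
  have hsmall : SmallInProb P (fun N ω => ‖(√(N : ℝ))⁻¹ • ∑ i ∈ D.fold N l,
      D.u i (D.last N) ω • w N i ω‖ ^ 2) := by
    refine SmallInProb.of_lintegral (Eventually.of_forall fun N => ?_) fun ε hε => ?_
    · refine (((Finset.measurable_fun_sum _ fun i hi => ?_).fun_const_smul _).norm.pow_const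
        2).aemeasurable
      exact (h.measurable_u i _).smul (hwm N i hi).measurable
    · have h1 : Tendsto (fun N : ℕ => ENNReal.ofReal (max C 0 * (N : ℝ) ^ (-ζ))) atTop (𝓝 0) := by
        simpa using ENNReal.tendsto_ofReal hlim
      filter_upwards [hbound, h1.eventually_le_const hε] with N h2 h3 using h2.trans h3
  have hbad : ∀ ε : ℝ≥0∞, 0 < ε → ∀ᶠ N in atTop, P (good N)ᶜ ≤ ε := by
    intro ε hε
    have hemp : SmallInProb P (fun N ω => ((N : ℝ) ^ (-ζ))⁻¹ * avg (D.fold N l)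
        fun i => ‖D.aHat κ N l i ω - D.a P N i ω‖ ^ 2) := by
      have hpos : ∀ᶠ N : ℕ in atTop, 0 < (N : ℝ) ^ (-ζ) := by
        filter_upwards [eventually_gt_atTop 0] with N hN
        have : (0 : ℝ) < N := by exact_mod_cast hN
        positivity
      refine (hnuis.a_emp_rate l).smallInProb hpos _ ?_
      filter_upwards [hpos] with N hN ω
      rw [mul_inv_cancel_left₀ hN.ne']
      exact le_rfl
    filter_upwards [hemp (1 / 2) (by norm_num) (ε / 2) (ENNReal.half_pos hε.ne'),
      (hC.eventually_le_const (ENNReal.half_pos hε.ne')), eventually_gt_atTop 0] with N h1 h2 h3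
    have h3' : (0 : ℝ) < N := by exact_mod_cast h3
    have hpos : 0 < (N : ℝ) ^ (-ζ) := by positivity
    calc P (good N)ᶜ ≤ P {ω | 1 / 2 < ((N : ℝ) ^ (-ζ))⁻¹ * avg (D.fold N l)
            (fun i => ‖D.aHat κ N l i ω - D.a P N i ω‖ ^ 2) ∨
            ∃ i < N, C < (P[fun ω' => D.u i (D.last N) ω' ^ 2 | D.info κ N i]) ω} := by
          refine measure_mono fun ω hω => ?_
          simp only [Set.mem_ofPred_eq]
          by_contra! hcon
          refine hω ⟨?_, fun i hi => hcon.2 i (h.mem_fold_lt hi)⟩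
          have := hcon.1
          rw [inv_mul_le_iff₀ hpos] at this
          linarith
      _ ≤ ε / 2 + ε / 2 := (measure_or_le _ _).trans (add_le_add h1 h2)
      _ = ε := ENNReal.add_halves ε
  -- On the good event the truncated and the original sums coincide.
  refine SmallInProb.of_forall_eps fun ε hε => ⟨_, hsmall.sqrt, ?_⟩
  filter_upwards [hbad ε hε] with N hN
  refine le_trans (measure_mono fun ω hω => ?_) hN
  intro hg
  simp only [Set.mem_ofPred_eq, hwdef, Set.indicator_of_mem hg] at hω
  rw [Real.sqrt_sq (norm_nonneg _)] at hω
  exact lt_irrefl _ hω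

end Design

end CrossFit

namespace CrossFit

namespace Design

variable {Ω : Type*} {p q k d L : ℕ} {D : Design Ω p q k d L} [MeasurableSpace Ω] {P : Measure Ω}

/-! ### The average errors and the deviations of `∂m/∂α` from its conditional mean -/

lemma Setup.indepFun_of_measurable_unit (h : D.Setup P) {i j : ℕ} (hij : i ≠ j) {E E' : Type*}
    [MeasurableSpace E] [MeasurableSpace E'] {f : Ω → E} {f' : Ω → E'}
    (hf : Measurable[D.unitAlg i] f) (hf' : Measurable[D.unitAlg j] f') : f ⟂ᵢ[P] f' :=
  indep_of_indep_of_le_left (indep_of_indep_of_le_right (h.iIndep_unitAlg.indep hij)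
    hf'.comap_le) hf.comap_le

lemma Setup.aestronglyMeasurable_diff (h : D.Setup P) (hdm : ∀ i, Integrable (D.dm i) P)
    (N i : ℕ) : AEStronglyMeasurable (fun ω => D.dm i ω - D.a P N i ω) P :=
  (hdm i).1.sub (h.measurable_a N i).aestronglyMeasurable

lemma measurable_unit_a (D : Design Ω p q k d L) (N i : ℕ) : Measurable[D.unitAlg i] (D.a P N i) :=
  ((D.stronglyMeasurable_info_a P .none N i).mono (D.info_le_unitAlg .none N i)).measurable

/-- `∂m/∂α` is almost uncorrelated with the average error, so that the interaction is negligible. -/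
theorem small_errorCorrelation [IsProbabilityMeasure P] {κ : Shrinkage} (h : D.Setup P)
    (hmom : D.MomentBounds P κ) (hcorr : D.ErrorCorrelation P) (l : Fin L) :
    SmallInProb P (fun N ω => ‖(√(N : ℝ))⁻¹ • ∑ i ∈ D.fold N l,
      D.ubar N i ω • (D.dm i ω - D.a P N i ω)‖) := by
  set z : ℕ → ℕ → Ω → EuclideanSpace ℝ (Fin k) := fun N i ω =>
    D.ubar N i ω • (D.dm i ω - D.a P N i ω) with hz
  set c : ℕ → ℕ → EuclideanSpace ℝ (Fin k) := fun N i => ∫ ω, z N i ω ∂P with hc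
  have hzm : ∀ N i, AEStronglyMeasurable (z N i) P := fun N i =>
    (h.measurable_ubar N i).aestronglyMeasurable.smul
      (h.aestronglyMeasurable_diff hmom.integrable_dm N i)
  have hz2 : ∀ N i ω, ENNReal.ofReal (‖z N i ω‖ ^ 2) =
      ‖D.dm i ω - D.a P N i ω‖ₑ ^ 2 * ‖D.ubar N i ω‖ₑ ^ 2 := by
    intro N i ω
    rw [ENNReal.ofReal_pow (norm_nonneg _), ofReal_norm, hz, enorm_smul, mul_pow, mul_comm]
  have hbd : ∀ ε : ℝ, 0 < ε → ∀ᶠ N in atTop, ∀ i < N, MemLp (z N i) 2 P ∧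
      ∫ ω, ‖z N i ω‖ ^ 2 ∂P ≤ ε := by
    intro ε hε
    filter_upwards [hcorr.second ε.toNNReal (by simpa using hε)] with N hN i hi
    have h1 : ∫⁻ ω, ENNReal.ofReal (‖z N i ω‖ ^ 2) ∂P ≤ ENNReal.ofReal ε := by
      simp_rw [hz2]; exact hN i hi
    have hint : Integrable (fun ω => ‖z N i ω‖ ^ 2) P := by
      refine ⟨(hzm N i).norm.pow 2, ?_⟩
      rw [hasFiniteIntegral_iff_ofReal (Eventually.of_forall fun ω => by positivity)]
      exact h1.trans_lt ENNReal.ofReal_lt_top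
    refine ⟨(memLp_two_iff_integrable_sq_norm (hzm N i)).2 hint, ?_⟩
    rw [← ofReal_integral_eq_lintegral_ofReal hint
      (Eventually.of_forall fun ω => by positivity)] at h1
    exact (ENNReal.ofReal_le_ofReal_iff hε.le).1 h1
  have hcb : ∀ ε : ℝ, 0 < ε → ∀ᶠ N : ℕ in atTop, ∀ i < N, ‖c N i‖ ≤ ε * (√(N : ℝ))⁻¹ :=
    fun ε hε => hcorr.first ε hε
  -- The derivative is a function of the unit only up to a null set, so independence is proved for
  -- measurable versions and transferred.
  have hindep : ∀ N i j, i ≠ j → z N i ⟂ᵢ[P] z N j := by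
    intro N i j hij
    obtain ⟨f, hf, hfe⟩ := h.exists_measurable_dm hmom.smooth i
    obtain ⟨f', hf', hfe'⟩ := h.exists_measurable_dm hmom.smooth j
    refine IndepFun.congr (h.indepFun_of_measurable_unit hij
      ((D.measurable_unit_ubar N i).smul (hf.sub (D.measurable_unit_a (P := P) N i)))
      ((D.measurable_unit_ubar N j).smul (hf'.sub (D.measurable_unit_a (P := P) N j)))) ?_ ?_
    · filter_upwards [hfe] with ω hω
      simp [hz, hω]
    · filter_upwards [hfe'] with ω hω
      simp [hz, hω]
  have hcent : SmallInProb P (fun N ω => ‖(√(N : ℝ))⁻¹ • ∑ i ∈ D.fold N l,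
      (z N i ω - c N i)‖ ^ 2) := by
    refine SmallInProb.of_lintegral (Eventually.of_forall fun N => ?_) fun ε hε => ?_
    · refine AEMeasurable.pow_const ?_ 2
      refine (AEStronglyMeasurable.norm ?_).aemeasurable
      exact (Finset.aestronglyMeasurable_fun_sum _ fun i _ =>
        (hzm N i).sub aestronglyMeasurable_const).fun_const_smul _
    · obtain ⟨η, hη0, hη⟩ : ∃ η : ℝ, 0 < η ∧ ENNReal.ofReal η ≤ ε := by
        obtain ⟨η, h0, h1⟩ := ENNReal.lt_iff_exists_nnreal_btwn.1 hε
        exact ⟨η, by simpa using h0, by simpa using h1.le⟩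
      -- With second moment and squared mean each at most `η/4`, the bound `2‖z‖² + 2‖c‖²` for the
      -- centered square integrates to at most `η`.
      filter_upwards [hbd (η / 4) (by positivity), hcb (√(η / 4)) (by positivity),
        eventually_ge_atTop 1] with N h1 h2 h3
      refine le_trans (lintegral_norm_scaled_sum_sq_le (h.card_fold_le N l) (C := η) ?_ ?_ ?_
        hη0.le) hη
      · exact fun i hi => (h1 i (h.mem_fold_lt hi)).1.sub (memLp_const _)
      · intro i hi j hj hij
        have hi1 := (h1 i (h.mem_fold_lt hi)).1.integrable (by norm_num)
        have hj1 := (h1 j (h.mem_fold_lt hj)).1.integrable (by norm_num)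
        have hind : (fun ω => z N i ω - c N i) ⟂ᵢ[P] (fun ω => z N j ω - c N j) :=
          (hindep N i j hij).comp (measurable_id.sub_const (c N i))
            (measurable_id.sub_const (c N j))
        have h0 : ∫ ω, (z N i ω - c N i) ∂P = 0 := by
          rw [integral_sub hi1 (integrable_const _)]
          simp [hc]
        have := hind.integral_bilin (hi1.sub (integrable_const _))
          (hj1.sub (integrable_const _)) (innerSL ℝ)
        rw [h0, map_zero] at this
        exact this
      · calc ∑ i ∈ D.fold N l, ∫ ω, ‖z N i ω - c N i‖ ^ 2 ∂P
            ≤ ∑ _i ∈ D.fold N l, η := by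
              refine Finset.sum_le_sum fun i hi => ?_
              have hi2 := h1 i (h.mem_fold_lt hi)
              have hc2 : ‖c N i‖ ^ 2 ≤ η / 4 := by
                have h4 : (√(N : ℝ))⁻¹ ≤ 1 := inv_le_one_of_one_le₀
                  (Real.one_le_sqrt.2 (by exact_mod_cast h3))
                have h5 : ‖c N i‖ ≤ √(η / 4) := (h2 i (h.mem_fold_lt hi)).trans
                  (mul_le_of_le_one_right (by positivity) h4)
                calc ‖c N i‖ ^ 2 ≤ √(η / 4) ^ 2 := pow_le_pow_left₀ (norm_nonneg _) h5 2
                  _ = η / 4 := Real.sq_sqrt (by positivity)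
              have hint := hi2.1.integrable_norm_pow (by simp)
              calc ∫ ω, ‖z N i ω - c N i‖ ^ 2 ∂P
                  ≤ ∫ ω, (2 * ‖z N i ω‖ ^ 2 + η / 2) ∂P := by
                    refine integral_mono ((hi2.1.sub (memLp_const _)).integrable_norm_pow
                      (by simp)) ((hint.const_mul 2).add (integrable_const _)) fun ω => ?_
                    have h6 := norm_sub_le (z N i ω) (c N i)
                    have h7 : ‖z N i ω - c N i‖ ^ 2 ≤ (‖z N i ω‖ + ‖c N i‖) ^ 2 :=
                      pow_le_pow_left₀ (norm_nonneg _) h6 2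
                    nlinarith [sq_nonneg (‖z N i ω‖ - ‖c N i‖)]
                _ = 2 * ∫ ω, ‖z N i ω‖ ^ 2 ∂P + η / 2 := by
                    rw [integral_add (hint.const_mul 2) (integrable_const _), integral_const_mul]
                    simp
                _ ≤ η := by linarith [hi2.2]
          _ = (D.fold N l).card * η := by simp
          _ ≤ N * η := mul_le_mul_of_nonneg_right (by exact_mod_cast h.card_fold_le N l) hη0.le
  -- At most `N` means of size `o(N^{-1/2})`, divided by `√N`.
  have hmean : Tendsto (fun N : ℕ => ‖(√(N : ℝ))⁻¹ • ∑ i ∈ D.fold N l, c N i‖) atTop (𝓝 0) := by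
    rw [Metric.tendsto_atTop']
    intro ε hε
    obtain ⟨N₀, hN₀⟩ := eventually_atTop.1 ((hcb (ε / 2) (half_pos hε)).and
      (eventually_gt_atTop 0))
    refine ⟨N₀, fun N hN => ?_⟩
    obtain ⟨h1, h2⟩ := hN₀ N hN.le
    have hN0 : (0 : ℝ) < √(N : ℝ) := Real.sqrt_pos.2 (by exact_mod_cast h2)
    have h3 := norm_scaled_sum_le (h.card_fold_le N l) (v := c N)
      (f := fun _ => ε / 2 * (√(N : ℝ))⁻¹) fun i hi => h1 i (h.mem_fold_lt hi)
    rw [Real.dist_0_eq_abs, abs_norm]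
    refine h3.trans_lt ?_
    have h4 : avg (D.fold N l) (fun _ => ε / 2 * (√(N : ℝ))⁻¹) ≤ ε / 2 * (√(N : ℝ))⁻¹ := by
      rcases (D.fold N l).eq_empty_or_nonempty with he | hne
      · rw [he]; simp only [avg, Finset.sum_empty, mul_zero]; positivity
      · rw [avg_const hne]
    calc √(N : ℝ) * avg (D.fold N l) (fun _ => ε / 2 * (√(N : ℝ))⁻¹)
        ≤ √(N : ℝ) * (ε / 2 * (√(N : ℝ))⁻¹) := mul_le_mul_of_nonneg_left h4 hN0.le
      _ = ε / 2 := by field_simp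
      _ < ε := half_lt_self hε
  refine (hcent.sqrt.add (SmallInProb.of_tendsto hmean)).mono (Eventually.of_forall fun N =>
    Eventually.of_forall fun ω => ?_)
  rw [Real.sqrt_sq (norm_nonneg _)]
  refine le_trans (le_of_eq ?_) (norm_add_le _ _)
  rw [← smul_add, ← Finset.sum_add_distrib]
  simp [hz]

/-! ### Remainder terms controlled by first moments and by the rates of the estimates -/

/-- The rate `(NT)^{-1/2}` leaves a factor `T^{-1/2}` to spare. -/
lemma NuisanceRates.small_beta {κ : Shrinkage} {ζ : ℝ} (hn : D.NuisanceRates P κ ζ)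
    (hT : Tendsto D.T atTop atTop) (l : Fin L) :
    SmallInProb P (fun N ω => √(N : ℝ) * ‖D.betaT N l ω - D.β₀‖) := by
  have hpos : ∀ᶠ N : ℕ in atTop, 0 < √((N : ℝ) * D.T N) := by
    filter_upwards [eventually_gt_atTop 0, hT.eventually_gt_atTop 0] with N h1 h2
    have h1' : (0 : ℝ) < N := by exact_mod_cast h1
    have h2' : (0 : ℝ) < D.T N := by exact_mod_cast h2
    positivity
  have hb : BddInProb P (fun N ω => √((N : ℝ) * D.T N) * ‖D.betaT N l ω - D.β₀‖) := by
    refine (hn.beta_rate l).bddInProb (hpos.mono fun N h => inv_pos.2 h) _ ?_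
    filter_upwards [hpos] with N hN ω
    rw [inv_mul_cancel_left₀ hN.ne', ofReal_norm]
  have hr : Tendsto (fun N => (√(D.T N : ℝ))⁻¹) atTop (𝓝 0) :=
    tendsto_inv_atTop_zero.comp (Real.tendsto_sqrt_atTop.comp
      (tendsto_natCast_atTop_atTop.comp hT))
  refine (hb.tendsto_mul hr fun N => by positivity).mono ?_
  filter_upwards [hT.eventually_gt_atTop 0] with N h2
  refine Eventually.of_forall fun ω => le_of_eq ?_
  have h2' : (0 : ℝ) < √(D.T N : ℝ) := Real.sqrt_pos.2 (by exact_mod_cast h2)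
  rw [Real.sqrt_mul (by positivity)]
  field_simp

lemma AlphaRate.bdd {κ : Shrinkage} (ha : D.AlphaRate P κ) (hT : Tendsto D.T atTop atTop)
    (l : Fin L) : BddInProb P (fun N ω => (D.T N : ℝ) *
      avg (D.fold N l) fun i => (D.alphaT κ N l i ω - D.α i ω) ^ 2) := by
  have hpos : ∀ᶠ N in atTop, (0 : ℝ) < (D.T N : ℝ)⁻¹ := by
    filter_upwards [hT.eventually_gt_atTop 0] with N h2
    have h2' : (0 : ℝ) < D.T N := by exact_mod_cast h2
    positivity
  refine (ha l).bddInProb hpos _ ?_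
  filter_upwards [hpos] with N hN ω
  rw [inv_mul_cancel_left₀ (inv_pos.1 hN).ne']
  exact le_rfl

lemma NuisanceRates.small_aHat {κ : Shrinkage} {ζ : ℝ} (hn : D.NuisanceRates P κ ζ) (l : Fin L) :
    SmallInProb P (fun N ω => (N : ℝ) ^ ζ *
      avg (D.fold N l) fun i => ‖D.aHat κ N l i ω - D.a P N i ω‖ ^ 2) := by
  have hpos : ∀ᶠ N : ℕ in atTop, 0 < (N : ℝ) ^ (-ζ) := by
    filter_upwards [eventually_gt_atTop 0] with N h2
    have h2' : (0 : ℝ) < N := by exact_mod_cast h2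
    positivity
  refine (hn.a_emp_rate l).smallInProb hpos _ ?_
  filter_upwards [hpos, eventually_gt_atTop 0] with N hN h2 ω
  have h2' : (0 : ℝ) < N := by exact_mod_cast h2
  rw [← mul_assoc, ← Real.rpow_add h2', neg_add_cancel, Real.rpow_zero, one_mul]
  exact le_rfl

/-- The interaction of the two estimation errors is negligible. -/
theorem small_product {κ κ' : Shrinkage} {g ζ : ℝ} (h : D.Setup P)
    (hn : D.NuisanceRates P κ' ζ) (ha : D.AlphaRate P κ) (hg : 0 < g) (hζg : 1 ≤ ζ + g)
    (hT : (fun N => (D.T N : ℝ)) =Θ[atTop] fun N : ℕ => (N : ℝ) ^ g) (l : Fin L) :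
    SmallInProb P (fun N ω => ‖(√(N : ℝ))⁻¹ • ∑ i ∈ D.fold N l,
      (D.alphaT κ N l i ω - D.α i ω) • (D.aHat κ' N l i ω - D.a P N i ω)‖) := by
  have hT' := tendsto_atTop_of_isTheta hg hT
  -- Splitting `N = N^ζ N^{1-ζ}` and bounding `N^{1-ζ}` by `C T` gives each mean square error in the
  -- Cauchy-Schwarz bound its own rate.
  obtain ⟨C, hC, hCN⟩ := eventually_rpow_le_of_isTheta (e := 1 - ζ) (by linarith) hT
  have hs := (((hn.small_aHat l).sqrt.mul_bdd (ha.bdd hT' l).sqrt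
    fun N ω => Real.sqrt_nonneg _).const_mul √C fun N ω => by positivity)
  refine hs.mono ?_
  filter_upwards [hCN, eventually_gt_atTop 0] with N hN h2
  have h2' : (0 : ℝ) < N := by exact_mod_cast h2
  refine Eventually.of_forall fun ω => ?_
  set A := avg (D.fold N l) fun i => ‖D.aHat κ' N l i ω - D.a P N i ω‖ ^ 2
  set R := avg (D.fold N l) fun i => (D.alphaT κ N l i ω - D.α i ω) ^ 2
  have hA : 0 ≤ A := avg_nonneg fun i _ => by positivity
  have hR : 0 ≤ R := avg_nonneg fun i _ => by positivity
  refine (norm_scaled_sum_le (h.card_fold_le N l) (f := fun i =>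
    |D.alphaT κ N l i ω - D.α i ω| * ‖D.aHat κ' N l i ω - D.a P N i ω‖)
    fun i _ => (norm_smul_le _ _)).trans ?_
  calc _ ≤ √(N : ℝ) * (√R * √A) := by
        refine mul_le_mul_of_nonneg_left (avg_mul_le_sqrt.trans (le_of_eq ?_)) (by positivity)
        simp_rw [sq_abs]; rfl
    _ = √(N * (R * A)) := by rw [← Real.sqrt_mul hR, ← Real.sqrt_mul h2'.le]
    _ ≤ √(C * ((N : ℝ) ^ ζ * A * (D.T N * R))) := by
        refine Real.sqrt_le_sqrt ?_
        have h3 : (N : ℝ) = (N : ℝ) ^ ζ * (N : ℝ) ^ (1 - ζ) := by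
          rw [← Real.rpow_add h2']; simp
        calc N * (R * A) = (N : ℝ) ^ (1 - ζ) * ((N : ℝ) ^ ζ * (R * A)) := by
              rw [← mul_assoc ((N : ℝ) ^ (1 - ζ)), mul_comm ((N : ℝ) ^ (1 - ζ)), ← h3]
          _ ≤ C * D.T N * ((N : ℝ) ^ ζ * (R * A)) :=
              mul_le_mul_of_nonneg_right hN (by positivity)
          _ = _ := by ring
    _ = _ := by
        rw [Real.sqrt_mul hC.le, Real.sqrt_mul (by positivity)]

/-- A vector-valued function with second derivative bounded by `C` is close to its linearization. -/
lemma norm_taylor_remainder_le {E : Type*} [NormedAddCommGroup E] [NormedSpace ℝ E] {f : ℝ → E}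
    (hf : ContDiff ℝ 2 f) {C : ℝ} (hC : ∀ x, ‖iteratedDeriv 2 f x‖ ≤ C) (x y : ℝ) :
    ‖f y - f x - (y - x) • deriv f x‖ ≤ C * (y - x) ^ 2 := by
  have hd : Differentiable ℝ f := hf.differentiable (by norm_num)
  have hf' : ContDiff ℝ 1 (deriv f) := by
    have := (contDiff_succ_iff_deriv (n := 1) (f := f)).1 (by simpa using! hf)
    exact this.2.2
  have hd' : Differentiable ℝ (deriv f) := hf'.differentiable (by norm_num)
  have hlip : ∀ z, ‖deriv f z - deriv f x‖ ≤ C * ‖z - x‖ := fun z =>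
    Convex.norm_image_sub_le_of_norm_deriv_le (s := Set.univ) (fun w _ => hd' w)
      (fun w _ => by simpa [iteratedDeriv_succ, iteratedDeriv_zero] using hC w) convex_univ
      (Set.mem_univ _) (Set.mem_univ _)
  have hC0 : 0 ≤ C := (norm_nonneg _).trans (hC 0)
  have hder : ∀ z, HasDerivAt (fun z => f z - z • deriv f x) (deriv f z - deriv f x) z := fun z => by
    simpa using (hd z).hasDerivAt.fun_sub ((hasDerivAt_id z).smul_const (deriv f x))
  -- The mean value inequality for `f` minus its linear part, on the segment only, where the
  -- Lipschitz bound for the derivative is at most `C |y - x|`. The sharper constant `C/2` is not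
  -- needed.
  have hmain := Convex.norm_image_sub_le_of_norm_hasDerivWithin_le (s := Set.uIcc x y)
    (f := fun z => f z - z • deriv f x) (C := C * |y - x|) (fun z _ => (hder z).hasDerivWithinAt)
    (fun z hz => (hlip z).trans (mul_le_mul_of_nonneg_left (Set.abs_sub_left_of_mem_uIcc hz) hC0))
    (convex_uIcc x y) Set.left_mem_uIcc Set.right_mem_uIcc
  calc ‖f y - f x - (y - x) • deriv f x‖
      = ‖f y - y • deriv f x - (f x - x • deriv f x)‖ := by congr 1; rw [sub_smul]; abel
    _ ≤ C * |y - x| * ‖y - x‖ := hmain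
    _ = C * (y - x) ^ 2 := by rw [Real.norm_eq_abs, mul_assoc, ← sq, sq_abs]

/-- The remainder of the expansion in the fixed effects is negligible. -/
theorem small_taylor {κ κ' : Shrinkage} {g : ℝ} (h : D.Setup P) (hmom : D.MomentBounds P κ')
    (ha : D.AlphaRate P κ) (hg : 1 / 2 < g)
    (hT : (fun N => (D.T N : ℝ)) =Θ[atTop] fun N : ℕ => (N : ℝ) ^ g) (l : Fin L) :
    SmallInProb P (fun N ω => ‖(√(N : ℝ))⁻¹ • ∑ i ∈ D.fold N l,
      (D.m (D.W i ω) (D.alphaT κ N l i ω) D.μ₀ - D.m (D.W i ω) (D.α i ω) D.μ₀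
        - (D.alphaT κ N l i ω - D.α i ω) • D.dm i ω)‖) := by
  have hT' := tendsto_atTop_of_isTheta (by linarith) hT
  obtain ⟨C, hC⟩ := hmom.second_deriv
  -- This is `√N / T → 0`, the place where `g > 1/2` is needed for the Taylor remainder.
  have hr := tendsto_rpow_mul_inv_of_isTheta hg hT
  have hs := ((ha.bdd hT' l).const_mul (abs_nonneg C)).tendsto_mul hr fun N => by positivity
  refine hs.mono ?_
  filter_upwards [hT'.eventually_gt_atTop 0] with N h2
  have h2' : (D.T N : ℝ) ≠ 0 := by exact_mod_cast h2.ne'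
  filter_upwards [ae_all_iff.2 hC, ae_all_iff.2 hmom.smooth] with ω h1 hsm
  refine (norm_scaled_sum_le (h.card_fold_le N l) (f := fun i =>
    |C| * (D.alphaT κ N l i ω - D.α i ω) ^ 2) fun i _ => ?_).trans (le_of_eq ?_)
  · exact (norm_taylor_remainder_le (hsm i) (h1 i) _ _).trans
      (mul_le_mul_of_nonneg_right (le_abs_self C) (sq_nonneg _))
  · rw [avg_const_mul, Real.sqrt_eq_rpow]
    field_simp

/-- The effect of the slope estimate on the final-period residuals is negligible. -/
theorem small_slope_final [IsProbabilityMeasure P] {κ : Shrinkage} {ζ : ℝ} (h : D.Setup P)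
    (hn : D.NuisanceRates P κ ζ) (hmom : D.MomentBounds P κ) (hT : Tendsto D.T atTop atTop)
    (l : Fin L) :
    SmallInProb P (fun N ω => ‖(√(N : ℝ))⁻¹ • ∑ i ∈ D.fold N l,
      (inner ℝ (D.X i (D.last N) ω) (D.betaT N l ω - D.β₀) : ℝ) • D.aHat κ N l i ω‖) := by
  obtain ⟨C, hC⟩ := hmom.aHat_X
  have hb : BddInProb P (fun N ω => avg (D.fold N l) fun i =>
      ‖D.X i (D.last N) ω‖ * ‖D.aHat κ N l i ω‖) := by
    refine BddInProb.avg_of_lintegral_le (C := 1 + C) ?_ ?_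
    · filter_upwards [hn.a_sq_integrable l] with N hN i hi
      exact (h.measurable_X i _).norm.aemeasurable.mul (hN i hi).1.norm.aemeasurable
    · filter_upwards [hC] with N hN i hi
      -- The first moment is bounded through `x ≤ 1 + x²`.
      calc ∫⁻ ω, ENNReal.ofReal (‖D.X i (D.last N) ω‖ * ‖D.aHat κ N l i ω‖) ∂P
          ≤ ∫⁻ ω, (1 + ‖D.aHat κ N l i ω‖ₑ ^ 2 * ‖D.X i (D.last N) ω‖ₑ ^ 2) ∂P := by
            refine lintegral_mono fun ω => ?_
            rw [← ofReal_norm, ← ofReal_norm,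
              ← ENNReal.ofReal_pow (norm_nonneg _), ← ENNReal.ofReal_pow (norm_nonneg _),
              ← ENNReal.ofReal_mul (by positivity), ← ENNReal.ofReal_one,
              ← ENNReal.ofReal_add zero_le_one (by positivity)]
            refine ENNReal.ofReal_le_ofReal ?_
            nlinarith [sq_nonneg (‖D.X i (D.last N) ω‖ * ‖D.aHat κ N l i ω‖ - 1),
              sq_nonneg (‖D.X i (D.last N) ω‖ * ‖D.aHat κ N l i ω‖)]
        _ ≤ 1 + C := by
            rw [lintegral_add_left measurable_const]
            simpa using hN l i hi
        _ = ((1 + C : ℝ≥0) : ℝ≥0∞) := by simp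
  refine ((hn.small_beta hT l).mul_bdd hb fun N ω => by positivity).mono
    (Eventually.of_forall fun N => Eventually.of_forall fun ω => ?_)
  refine (norm_scaled_sum_le (h.card_fold_le N l) (f := fun i => ‖D.betaT N l ω - D.β₀‖ *
    (‖D.X i (D.last N) ω‖ * ‖D.aHat κ N l i ω‖)) fun i _ => ?_).trans (le_of_eq ?_)
  · rw [norm_smul, ← mul_assoc]
    refine mul_le_mul_of_nonneg_right ?_ (norm_nonneg _)
    rw [mul_comm]
    exact norm_inner_le_norm _ _
  · rw [avg_const_mul, mul_assoc]

/-- The factor that remains once the slope error is pulled out of the inner product with the average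
regressors; it occurs in the slope term and again in the shrinkage term. -/
lemma bdd_avg_diff_Xbar {κ : Shrinkage} (h : D.Setup P) (hmom : D.MomentBounds P κ) (l : Fin L) :
    BddInProb P (fun N ω => avg (D.fold N l) fun i =>
      ‖D.dm i ω - D.a P N i ω‖ * ‖D.Xbar N i ω‖) := by
  obtain ⟨C, hC⟩ := hmom.dm_Xbar
  refine BddInProb.avg_of_lintegral_le (C := C) (Eventually.of_forall fun N i hi => ?_) ?_
  · exact (h.aestronglyMeasurable_diff hmom.integrable_dm N i).norm.aemeasurable.mul
      (h.measurable_Xbar N i).norm.aemeasurable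
  · filter_upwards [hC] with N hN i hi
    simp_rw [ENNReal.ofReal_mul (norm_nonneg _), ofReal_norm]
    exact hN i (h.mem_fold_lt hi)

/-- The effect of the slope estimate on the estimated fixed effects is negligible. -/
theorem small_slope_mean {κ : Shrinkage} {ζ : ℝ} (h : D.Setup P)
    (hn : D.NuisanceRates P κ ζ) (hmom : D.MomentBounds P κ) (hT : Tendsto D.T atTop atTop)
    (l : Fin L) :
    SmallInProb P (fun N ω => ‖(√(N : ℝ))⁻¹ • ∑ i ∈ D.fold N l,
      (inner ℝ (D.Xbar N i ω) (D.betaT N l ω - D.β₀) : ℝ) • (D.dm i ω - D.a P N i ω)‖) := by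
  refine ((hn.small_beta hT l).mul_bdd (bdd_avg_diff_Xbar h hmom l)
    fun N ω => by positivity).mono
    (Eventually.of_forall fun N => Eventually.of_forall fun ω => ?_)
  refine (norm_scaled_sum_le (h.card_fold_le N l) (f := fun i => ‖D.betaT N l ω - D.β₀‖ *
    (‖D.dm i ω - D.a P N i ω‖ * ‖D.Xbar N i ω‖)) fun i _ => ?_).trans (le_of_eq ?_)
  · rw [norm_smul, mul_left_comm, mul_comm (‖D.dm i ω - D.a P N i ω‖)]
    refine mul_le_mul_of_nonneg_right ?_ (norm_nonneg _)
    rw [mul_comm]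
    exact norm_inner_le_norm _ _
  · rw [avg_const_mul, mul_assoc]

end Design

end CrossFit

namespace CrossFit

/-! ### Conditional expectations of identically distributed units -/

section Conditional

variable {Ω B Z : Type*} {G m0 : MeasurableSpace Ω} {P : Measure Ω} [MeasurableSpace B]
  [MeasurableSpace Z]

/-- Functions of conditioning variables and of identically distributed variables that are
independent of the conditioning σ-algebra have the same conditional expectation. -/
lemma condLExp_congr_of_identDistrib [IsProbabilityMeasure P] (hG : G ≤ m0)
    {b : Ω → B} (hb : Measurable[G] b) {z z' : Ω → Z} (hz : Measurable[m0] z)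
    (hz' : Measurable[m0] z')
    (hi : Indep G (MeasurableSpace.comap z inferInstance) P)
    (hi' : Indep G (MeasurableSpace.comap z' inferInstance) P) (hid : IdentDistrib z z' P P)
    {Φ : B × Z → ℝ≥0∞} (hΦ : Measurable Φ) :
    P⁻[fun ω => Φ (b ω, z ω) | G] =ᵐ[P] P⁻[fun ω => Φ (b ω, z' ω) | G] := by
  refine ae_eq_condLExp hG P _ (measurable_condLExp _ _ _) fun s hs => ?_
  rw [setLIntegral_condLExp hG P _ hs]
  -- The test set is absorbed into the conditioning variable. Each integral over `s` then depends
  -- only on the law of `U` and the law of the independent unit.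
  set U : Ω → ℝ≥0∞ × B := fun ω => (s.indicator (fun _ => 1) ω, b ω)
  have hUG : Measurable[G] U :=
    (measurable_const.indicator hs).prodMk hb
  have hU : Measurable[m0] U := hUG.mono hG le_rfl
  have key : ∀ y : Ω → Z, Measurable[m0] y → Indep G (MeasurableSpace.comap y inferInstance) P →
      ∫⁻ ω in s, Φ (b ω, y ω) ∂P =
        ∫⁻ v : (ℝ≥0∞ × B) × Z, v.1.1 * Φ (v.1.2, v.2) ∂((P.map U).prod (P.map y)) := by
    intro y hy hiy
    have hind : U ⟂ᵢ[P] y := indep_of_indep_of_le_left hiy hUG.comap_le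
    have hm : Measurable fun v : (ℝ≥0∞ × B) × Z => v.1.1 * Φ (v.1.2, v.2) := by fun_prop
    rw [← (indepFun_iff_map_prod_eq_prod_map_map hU.aemeasurable hy.aemeasurable).1 hind,
      lintegral_map hm (hU.prodMk hy), ← lintegral_indicator (hG _ hs)]
    refine lintegral_congr fun ω => ?_
    by_cases hω : ω ∈ s <;> simp [U, hω]
  rw [key z hz hi, key z' hz' hi', hid.map_eq]

end Conditional

namespace Design

variable {Ω : Type*} {p q k d L : ℕ}

/-! ### Moments of the estimated sampling variances -/

/-- The estimated sampling variance as a function of the slope estimate and of the unit. -/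
noncomputable def uhatSqFun (D : Design Ω p q k d L) (N : ℕ) (v : EuclideanSpace ℝ (Fin p) ×
    (EuclideanSpace ℝ (Fin q) × ℝ × (ℕ → EuclideanSpace ℝ (Fin p)) × (ℕ → ℝ))) : ℝ :=
  D.V (D.last N) fun t => v.2.2.2.2 t - inner ℝ (v.2.2.2.1 t) v.1 -
    ((D.last N : ℝ)⁻¹ * ∑ s ∈ Finset.range (D.last N), v.2.2.2.2 s
      - inner ℝ ((D.last N : ℝ)⁻¹ • ∑ s ∈ Finset.range (D.last N), v.2.2.2.1 s) v.1)

lemma measurable_uhatSqFun (D : Design Ω p q k d L) (hV : ∀ n, Measurable (D.V n)) (N : ℕ) :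
    Measurable (D.uhatSqFun N) := by
  have hX : ∀ t : ℕ, Measurable fun v : EuclideanSpace ℝ (Fin p) × (EuclideanSpace ℝ (Fin q) ×
      ℝ × (ℕ → EuclideanSpace ℝ (Fin p)) × (ℕ → ℝ)) => v.2.2.2.1 t := fun t =>
    (measurable_pi_apply t).comp (measurable_fst.comp (measurable_snd.comp
      (measurable_snd.comp measurable_snd)))
  have hY : ∀ t : ℕ, Measurable fun v : EuclideanSpace ℝ (Fin p) × (EuclideanSpace ℝ (Fin q) ×
      ℝ × (ℕ → EuclideanSpace ℝ (Fin p)) × (ℕ → ℝ)) => v.2.2.2.2 t := fun t =>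
    (measurable_pi_apply t).comp (measurable_snd.comp (measurable_snd.comp
      (measurable_snd.comp measurable_snd)))
  refine (hV _).comp (measurable_pi_lambda _ fun t => ?_)
  exact ((hY t).sub ((hX t).inner measurable_fst)).sub
    (((Finset.measurable_fun_sum _ fun s _ => hY s).const_mul _).sub
      (((Finset.measurable_fun_sum _ fun s _ => hX s).fun_const_smul _).inner measurable_fst))

variable {D : Design Ω p q k d L} [MeasurableSpace Ω] {P : Measure Ω}

lemma Setup.measurable_uhatSq (h : D.Setup P) (hV : ∀ n, Measurable (D.V n)) (N : ℕ) (l : Fin L)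
    (i : ℕ) : Measurable (D.uhatSq N l i) :=
  (D.measurable_uhatSqFun hV N).comp
    (((h.measurable_betaT N l).mono (h.outOfFold_le N l) le_rfl).prodMk (h.measurable_unit i))

/-- The conditional moments of the estimated sampling variances are the same for all units of a
fold. -/
lemma Setup.condLExp_uhatSq_congr [IsProbabilityMeasure P] (h : D.Setup P)
    (hV : ∀ n, Measurable (D.V n)) {N : ℕ} {l : Fin L} {i j : ℕ} (hi : i ∈ D.fold N l)
    (hj : j ∈ D.fold N l) {f : ℝ → ℝ≥0∞} (hf : Measurable f) :
    P⁻[fun ω => f (D.uhatSq N l i ω) | D.outOfFold N l] =ᵐ[P]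
      P⁻[fun ω => f (D.uhatSq N l j ω) | D.outOfFold N l] := by
  have hind : ∀ i ∈ D.fold N l, Indep (D.outOfFold N l) (D.unitAlg i) P := fun i hi =>
    indep_of_indep_of_le_left (h.indep_othersAlg i).symm (D.outOfFold_le_othersAlg hi)
  exact condLExp_congr_of_identDistrib (h.outOfFold_le N l) (h.measurable_betaT N l)
    (h.measurable_unit i) (h.measurable_unit j) (hind i hi) (hind j hj)
    ((h.ident i).trans (h.ident j).symm) (hf.comp (D.measurable_uhatSqFun hV N))

/-- The fold average of the scaled estimated sampling variances, raised to a power with bounded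
conditional moments, is bounded in probability. -/
theorem bdd_avg_uhatSq_rpow [IsProbabilityMeasure P] (h : D.Setup P)
    (hV : ∀ n, Measurable (D.V n)) {e : ℝ} {l : Fin L}
    (hb : IsBigOpUnit P (fun N => D.fold N l)
      (fun N i => P⁻[fun ω => ENNReal.ofReal ((D.T N * D.uhatSq N l i ω) ^ e)
        | D.outOfFold N l]) (fun _ => 1)) :
    BddInProb P (fun N ω => avg (D.fold N l) fun i => (D.T N * D.uhatSq N l i ω) ^ e) := by
  intro ε hε
  obtain ⟨η, h0, hη⟩ := ENNReal.lt_iff_exists_nnreal_btwn.1 (ENNReal.half_pos hε.ne')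
  have h0' : 0 < η := by simpa using h0
  obtain ⟨M, hM, hb⟩ := hb η h0'
  refine ⟨M / η, by positivity, ?_⟩
  filter_upwards [hb, (h.tendsto_card_fold l).eventually_gt_atTop 0] with N h1 h2
  -- One unit represents the fold. On the event `A` its conditional moment is at most `M`, and the
  -- conditional moments of all units agree almost surely, so no union bound over units is needed.
  obtain ⟨j, hj⟩ := Finset.card_pos.1 h2
  set E : ℕ → Ω → ℝ≥0∞ := fun i => P⁻[fun ω => ENNReal.ofReal ((D.T N * D.uhatSq N l i ω) ^ e)
        | D.outOfFold N l] with hE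
  set A : Set Ω := {ω | E j ω ≤ ENNReal.ofReal (M * 1)} with hA
  have hAm : MeasurableSet[D.outOfFold N l] A :=
    measurableSet_le (measurable_condLExp _ _ _) measurable_const
  have hG := h.outOfFold_le N l
  have hfm : ∀ i, Measurable fun ω => (D.T N * D.uhatSq N l i ω) ^ e := fun i =>
    ((h.measurable_uhatSq hV N l i).const_mul _).pow_const e
  have hint : ∫⁻ ω, ENNReal.ofReal (avg (D.fold N l) fun i =>
      A.indicator (fun ω => (D.T N * D.uhatSq N l i ω) ^ e) ω) ∂P ≤ M.toNNReal := by
    refine lintegral_avg_le (fun i _ => ((hfm i).indicator (hG _ hAm)).aemeasurable) fun i hi => ?_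
    have hcongr := h.condLExp_uhatSq_congr hV hi hj
      (f := fun x => ENNReal.ofReal ((D.T N * x) ^ e)) (by fun_prop)
    calc ∫⁻ ω, ENNReal.ofReal (A.indicator (fun ω => (D.T N * D.uhatSq N l i ω) ^ e) ω) ∂P
        = ∫⁻ ω in A, ENNReal.ofReal ((D.T N * D.uhatSq N l i ω) ^ e) ∂P := by
          rw [← lintegral_indicator (hG _ hAm)]
          refine lintegral_congr fun ω => ?_
          by_cases hω : ω ∈ A <;> simp [hω]
      _ = ∫⁻ ω in A, E i ω ∂P := (setLIntegral_condLExp hG P _ hAm).symm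
      _ = ∫⁻ ω in A, E j ω ∂P := setLIntegral_congr_fun_ae (hG _ hAm)
          (hcongr.mono fun ω hω _ => hω)
      _ ≤ ∫⁻ _ω in A, ENNReal.ofReal (M * 1) ∂P :=
          setLIntegral_mono measurable_const fun ω hω => hω
      _ ≤ M.toNNReal := by
          rw [setLIntegral_const, mul_one]
          exact mul_le_of_le_one_right' prob_le_one
  -- The level `M / η` makes Markov's bound equal to `η`.
  have hmark := measure_lt_le_of_lintegral_le (aemeasurable_avg fun i _ =>
    ((hfm i).indicator (hG _ hAm)).aemeasurable) hint (show 0 < M / η by positivity)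
  calc _ ≤ P {ω | ENNReal.ofReal (M * 1) < E j ω ∨ M / η < avg (D.fold N l) fun i =>
        A.indicator (fun ω => (D.T N * D.uhatSq N l i ω) ^ e) ω} := by
        refine measure_mono fun ω hω => ?_
        simp only [Set.mem_ofPred_eq] at hω ⊢
        by_contra! hcon
        have hωA : ω ∈ A := hcon.1
        simp only [Set.indicator_of_mem hωA] at hcon
        exact absurd hω hcon.2.not_gt
    _ ≤ _ := measure_or_le _ _
    _ ≤ ε / 2 + ε / 2 := by
        refine add_le_add ((h1 j hj).trans hη.le) (hmark.trans (le_trans (le_of_eq ?_) hη.le))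
        rw [ENNReal.ofReal_div_of_pos (by positivity), ENNReal.ofReal_coe_nnreal]
        change ENNReal.ofReal M / _ = _
        rw [ENNReal.div_eq_inv_mul, ENNReal.inv_div (by simp) (by simp [h0'.ne']),
          ENNReal.div_mul_cancel (by simpa using hM) (by simp)]
    _ = ε := ENNReal.add_halves ε

end Design

end CrossFit

namespace CrossFit

/-! ### Dispersion, measured through the arctangent -/

/-- The arctangent is 1-Lipschitz, bounded and injective. Thus it does not increase dispersion,
discarded units cost at most `π²` each, a law of large numbers follows from Chebyshev, and a
nondegenerate variable stays nondegenerate. -/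
lemma abs_arctan_sub_le (x y : ℝ) : |Real.arctan x - Real.arctan y| ≤ |x - y| := by
  have h := Convex.norm_image_sub_le_of_norm_deriv_le (f := Real.arctan) (C := 1) (s := Set.univ)
    (x := y) (y := x) (fun z _ => Real.differentiableAt_arctan z) (fun z _ => by
      rw [Real.deriv_arctan, Real.norm_of_nonneg (by positivity)]
      exact (div_le_one (by positivity)).2 (by nlinarith [sq_nonneg z])) convex_univ
    (Set.mem_univ _) (Set.mem_univ _)
  simpa using h

lemma abs_arctan_le (x : ℝ) : |Real.arctan x| ≤ Real.pi / 2 :=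
  abs_le.2 ⟨(Real.neg_pi_div_two_lt_arctan x).le, (Real.arctan_lt_pi_div_two x).le⟩

lemma sq_arctan_sub_le (x y : ℝ) : (Real.arctan x - Real.arctan y) ^ 2 ≤ Real.pi ^ 2 := by
  refine sq_le_sq' ?_ ?_ <;>
  linarith [abs_le.1 (abs_arctan_le x), abs_le.1 (abs_arctan_le y)]

/-- The sample variance of the arctangents is bounded by the dispersion of a perturbed sample
around an arbitrary center, even if some units, those with weight `χ`, are discarded. -/
lemma variance_arctan_le {S : Finset ℕ} (hS : S.Nonempty) (a r χ : ℕ → ℝ) (c : ℝ)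
    (hχ0 : ∀ i ∈ S, 0 ≤ χ i) (hχ1 : ∀ i ∈ S, χ i ≤ 1) :
    avg S (fun i => Real.arctan (a i) ^ 2) - avg S (fun i => Real.arctan (a i)) ^ 2 ≤
      2 * avg S (fun i => (1 - χ i) * (r i - c) ^ 2) + 2 * avg S (fun i => (r i - a i) ^ 2)
        + Real.pi ^ 2 * avg S χ := by
  have h1 : avg S (fun i => (Real.arctan (a i) - Real.arctan c) ^ 2) =
      avg S (fun i => Real.arctan (a i) ^ 2)
        - 2 * Real.arctan c * avg S (fun i => Real.arctan (a i)) + Real.arctan c ^ 2 := by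
    rw [← avg_const_mul, ← avg_sub, ← avg_const hS (Real.arctan c ^ 2), ← avg_add]
    congr 1; ext i; ring
  have h2 : avg S (fun i => (Real.arctan (a i) - Real.arctan c) ^ 2) ≤
      avg S (fun i => 2 * ((1 - χ i) * (r i - c) ^ 2) + 2 * (r i - a i) ^ 2
        + Real.pi ^ 2 * χ i) := by
    refine avg_mono fun i hi => ?_
    have h3 : (Real.arctan (a i) - Real.arctan c) ^ 2 ≤ 2 * (r i - c) ^ 2 + 2 * (r i - a i) ^ 2 := by
      have : (Real.arctan (a i) - Real.arctan c) ^ 2 ≤ (a i - c) ^ 2 :=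
        sq_le_sq.2 (abs_arctan_sub_le _ _)
      nlinarith [sq_nonneg (r i - c + (r i - a i))]
    have h4 := mul_le_mul_of_nonneg_left h3 (sub_nonneg.2 (hχ1 i hi))
    have h5 := mul_le_mul_of_nonneg_left (sq_arctan_sub_le (a i) c) (hχ0 i hi)
    have h6 := mul_nonneg (hχ0 i hi) (sq_nonneg (r i - a i))
    nlinarith
  rw [avg_add, avg_add, avg_const_mul, avg_const_mul, avg_const_mul] at h2
  -- The dispersion around `arctan c` exceeds the variance by exactly this square.
  nlinarith [sq_nonneg (avg S (fun i => Real.arctan (a i)) - Real.arctan c)]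

namespace Design

variable {Ω : Type*} {p q k d L : ℕ} {D : Design Ω p q k d L} [MeasurableSpace Ω] {P : Measure Ω}

lemma Setup.identDistrib_α (h : D.Setup P) (i : ℕ) : IdentDistrib (D.α i) (D.α 0) P P :=
  (h.ident i).comp (measurable_fst.comp measurable_snd)

/-- Weak law of large numbers over the folds, for bounded functions of the fixed effects. -/
lemma Setup.small_avg_sub [IsProbabilityMeasure P] (h : D.Setup P) {f : ℝ → ℝ}
    (hf : Measurable f) {B : ℝ} (hB : ∀ x, |f x| ≤ B) (l : Fin L) :
    SmallInProb P (fun N ω => |avg (D.fold N l) (fun i => f (D.α i ω)) - ∫ ω', f (D.α 0 ω') ∂P|) := by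
  set c := ∫ ω', f (D.α 0 ω') ∂P with hc
  have hB0 : 0 ≤ B := (abs_nonneg _).trans (hB 0)
  have hcB : |c| ≤ B := by
    have := norm_integral_le_of_norm_le_const (μ := P) (f := fun ω => f (D.α 0 ω)) (C := B)
      (Eventually.of_forall fun ω => hB (D.α 0 ω))
    simpa using this
  have hm : ∀ i, Measurable fun ω => f (D.α i ω) - c := fun i =>
    (hf.comp (h.measurable_α i)).sub_const c
  have hbd : ∀ i ω, ‖f (D.α i ω) - c‖ ≤ 2 * B := fun i ω => by
    rw [Real.norm_eq_abs]
    exact (abs_sub _ _).trans (by linarith [hB (D.α i ω)])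
  have hLp : ∀ i, MemLp (fun ω => f (D.α i ω) - c) 2 P := fun i =>
    MemLp.of_bound (hm i).aestronglyMeasurable (2 * B) (Eventually.of_forall (hbd i))
  have hint : ∀ i, ∫ ω, (f (D.α i ω) - c) ∂P = 0 := by
    intro i
    have h1 : Integrable (fun ω => f (D.α i ω)) P :=
      Integrable.of_bound (hf.comp (h.measurable_α i)).aestronglyMeasurable B
        (Eventually.of_forall fun ω => hB _)
    have h2 : ∫ ω, f (D.α i ω) ∂P = c := ((h.identDistrib_α i).comp hf).integral_eq
    rw [integral_sub h1 (integrable_const _), h2]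
    simp
  -- Chebyshev with the fold size itself as the scale; the other factor of inverse root size then
  -- tends to zero.
  have hbound : BddInProb P (fun N ω => ‖(√((D.fold N l).card : ℝ))⁻¹ •
      ∑ i ∈ D.fold N l, (f (D.α i ω) - c)‖ ^ 2) := by
    refine BddInProb.of_lintegral_le (C := ((2 * B) ^ 2).toNNReal)
      (Eventually.of_forall fun N => ?_) (Eventually.of_forall fun N => ?_)
    · exact (((Finset.measurable_fun_sum _ fun i _ => hm i).fun_const_smul _).norm.pow_const
        2).aemeasurable
    · refine lintegral_norm_scaled_sum_sq_le le_rfl (fun i _ => hLp i) ?_ ?_ (by positivity)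
      · intro i _ j _ hij
        have hind := h.indepFun_of_measurable_unit hij.symm
          ((hf.comp (D.measurable_unit_α j)).sub_const c)
          ((hf.comp (D.measurable_unit_α i)).sub_const c)
        have := hind.integral_fun_mul_eq_mul_integral (hm j).aestronglyMeasurable
          (hm i).aestronglyMeasurable
        rw [show ∫ ω, ((f ∘ D.α j) ω - c) ∂P = 0 from hint j, zero_mul] at this
        exact this
      · rw [← nsmul_eq_mul]
        refine Finset.sum_le_card_nsmul _ _ _ fun i _ => ?_
        have h2 : ∀ ω, ‖f (D.α i ω) - c‖ ^ 2 ≤ (2 * B) ^ 2 := fun ω =>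
          pow_le_pow_left₀ (norm_nonneg _) (hbd i ω) 2
        have := integral_mono ((hLp i).integrable_norm_pow (by simp))
          (integrable_const ((2 * B) ^ 2)) h2
        simpa using this
  have hr : Tendsto (fun N => (√((D.fold N l).card : ℝ))⁻¹) atTop (𝓝 0) :=
    tendsto_inv_atTop_zero.comp (Real.tendsto_sqrt_atTop.comp
      (tendsto_natCast_atTop_atTop.comp (h.tendsto_card_fold l)))
  refine (hbound.sqrt.tendsto_mul hr fun N => by positivity).mono ?_
  filter_upwards [(h.tendsto_card_fold l).eventually_gt_atTop 0] with N hN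
  refine Eventually.of_forall fun ω => le_of_eq ?_
  have hS : (D.fold N l).Nonempty := Finset.card_pos.1 hN
  have hn : (0 : ℝ) < (D.fold N l).card := by exact_mod_cast hN
  rw [Real.sqrt_sq (norm_nonneg _), ← avg_const hS c, ← avg_sub, avg, norm_smul, norm_inv,
    Real.norm_of_nonneg (Real.sqrt_nonneg _), ← mul_assoc, ← mul_inv,
    Real.mul_self_sqrt hn.le, abs_mul, abs_inv, abs_of_pos hn, Real.norm_eq_abs, avg_const hS]

/-- The fold variances of the arctangents of the fixed effects stay away from zero. -/
theorem exists_variance_arctan [IsProbabilityMeasure P] (h : D.Setup P)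
    (hvar : 0 < Var[D.α 0; P]) :
    ∃ v : ℝ, 0 < v ∧ ∀ l, SmallInProb P (fun N ω => v -
      (avg (D.fold N l) (fun i => Real.arctan (D.α i ω) ^ 2)
        - avg (D.fold N l) (fun i => Real.arctan (D.α i ω)) ^ 2)) := by
  have hm : Measurable fun ω => Real.arctan (D.α 0 ω) :=
    Real.measurable_arctan.comp (h.measurable_α 0)
  have hLp : MemLp (fun ω => Real.arctan (D.α 0 ω)) 2 P :=
    MemLp.of_bound hm.aestronglyMeasurable (Real.pi / 2)
      (Eventually.of_forall fun ω => abs_arctan_le _)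
  refine ⟨Var[fun ω => Real.arctan (D.α 0 ω); P], ?_, fun l => ?_⟩
  -- If the arctangent were almost surely a constant `c`, the fixed effect would be almost surely
  -- `tan c`, with variance zero.
  · refine lt_of_le_of_ne (variance_nonneg _ _) fun h0 => hvar.ne' ?_
    have h1 := ae_eq_integral_of_variance_eq_zero hLp h0.symm
    set c := ∫ ω, Real.arctan (D.α 0 ω) ∂P
    have h2 : D.α 0 =ᵐ[P] fun _ => Real.tan c := by
      filter_upwards [h1] with ω hω
      rw [← Real.tan_arctan (D.α 0 ω), hω]
    rw [variance_congr h2, variance_eq_integral aemeasurable_const]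
    simp
  · have h1 := h.small_avg_sub Real.measurable_arctan abs_arctan_le l
    have h2 := h.small_avg_sub (f := fun x => Real.arctan x ^ 2) (B := (Real.pi / 2) ^ 2)
      (Real.measurable_arctan.pow_const 2)
      (fun x => by rw [abs_pow]; exact pow_le_pow_left₀ (abs_nonneg _) (abs_arctan_le x) 2) l
    refine (h2.add (h1.const_mul (Real.pi) fun N ω => abs_nonneg _)).mono
      (Eventually.of_forall fun N => Eventually.of_forall fun ω => ?_)
    have hvs := variance_eq_sub hLp
    have e1 : P[(fun ω => Real.arctan (D.α 0 ω)) ^ 2] = ∫ ω, Real.arctan (D.α 0 ω) ^ 2 ∂P := rfl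
    rw [hvs, e1]
    set c := ∫ ω, Real.arctan (D.α 0 ω) ∂P
    set c2 := ∫ ω, Real.arctan (D.α 0 ω) ^ 2 ∂P
    set A := avg (D.fold N l) (fun i => Real.arctan (D.α i ω))
    set A2 := avg (D.fold N l) (fun i => Real.arctan (D.α i ω) ^ 2)
    have hcb : |c| ≤ Real.pi / 2 := by
      have := norm_integral_le_of_norm_le_const (μ := P) (f := fun ω => Real.arctan (D.α 0 ω))
        (C := Real.pi / 2) (Eventually.of_forall fun ω => abs_arctan_le (D.α 0 ω))
      simpa using this
    have hAb : |A| ≤ Real.pi / 2 := by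
      rcases (D.fold N l).eq_empty_or_nonempty with he | hS
      · simp only [A, he, avg, Finset.sum_empty, mul_zero, abs_zero]; positivity
      · have hup := avg_mono (S := D.fold N l) (f := fun i => Real.arctan (D.α i ω))
          (g := fun _ => Real.pi / 2) fun i _ => (abs_le.1 (abs_arctan_le _)).2
        have hlo := avg_mono (S := D.fold N l) (g := fun i => Real.arctan (D.α i ω))
          (f := fun _ => -(Real.pi / 2)) fun i _ => (abs_le.1 (abs_arctan_le _)).1
        rw [avg_const hS] at hup hlo
        exact abs_le.2 ⟨hlo, hup⟩
    have h5 : A ^ 2 - c ^ 2 ≤ Real.pi * |A - c| := by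
      calc A ^ 2 - c ^ 2 = (A + c) * (A - c) := by ring
        _ ≤ |A + c| * |A - c| := (le_abs_self _).trans (abs_mul _ _).le
        _ ≤ Real.pi * |A - c| := mul_le_mul_of_nonneg_right
            ((abs_add_le _ _).trans (by linarith)) (abs_nonneg _)
    linarith [neg_abs_le (A2 - c2)]

end Design

end CrossFit

namespace CrossFit

/-! ### Minimizers of Stein's unbiased risk estimate -/

/-- A minimizer of the risk estimate weighs the squared deviations by at most twice the total
variances. -/
lemma avg_le_of_isMinOn_risk {S : Finset ℕ} {v y : ℕ → ℝ} (hv : ∀ i ∈ S, 0 ≤ v i) {s : ℝ}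
    (hs : 0 ≤ s) (hmin : ∀ s' : ℝ, 0 < s' →
      avg S (fun i => v i + v i ^ 2 * y i ^ 2 / (s + v i) ^ 2 - 2 * v i ^ 2 / (s + v i)) ≤
      avg S (fun i => v i + v i ^ 2 * y i ^ 2 / (s' + v i) ^ 2 - 2 * v i ^ 2 / (s' + v i))) :
    avg S (fun i => (v i / (s + v i)) ^ 2 * y i ^ 2) ≤
      2 * avg S (fun i => (v i / (s + v i)) ^ 2 * (s + v i)) := by
  -- The minimizer competes with `s' → ∞`, where no shrinkage takes place and the risk estimate
  -- tends to the average variance.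
  have h1 : ∀ s' : ℝ, 0 < s' →
      avg S (fun i => v i + v i ^ 2 * y i ^ 2 / (s + v i) ^ 2 - 2 * v i ^ 2 / (s + v i)) ≤
      avg S v + (s' ^ 2)⁻¹ * avg S (fun i => v i ^ 2 * y i ^ 2) := by
    intro s' hs'
    refine (hmin s' hs').trans ?_
    rw [← avg_const_mul, ← avg_add]
    refine avg_mono fun i hi => ?_
    have hvi := hv i hi
    have h2 : v i ^ 2 * y i ^ 2 / (s' + v i) ^ 2 ≤ (s' ^ 2)⁻¹ * (v i ^ 2 * y i ^ 2) := by
      rw [div_eq_inv_mul]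
      refine mul_le_mul_of_nonneg_right (inv_anti₀ (by positivity) ?_) (by positivity)
      exact pow_le_pow_left₀ hs'.le (by linarith) 2
    have h3 : 0 ≤ 2 * v i ^ 2 / (s' + v i) := by positivity
    linarith
  have h2 : avg S (fun i => v i + v i ^ 2 * y i ^ 2 / (s + v i) ^ 2 - 2 * v i ^ 2 / (s + v i)) ≤
      avg S v := by
    have hlim : Tendsto (fun s' : ℝ => avg S v + (s' ^ 2)⁻¹ * avg S (fun i => v i ^ 2 * y i ^ 2))
        atTop (𝓝 (avg S v)) := by
      have : Tendsto (fun s' : ℝ => (s' ^ 2)⁻¹) atTop (𝓝 0) :=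
        tendsto_inv_atTop_zero.comp (tendsto_pow_atTop two_ne_zero)
      simpa using (this.mul_const (avg S (fun i => v i ^ 2 * y i ^ 2))).const_add (avg S v)
    exact ge_of_tendsto hlim ((eventually_gt_atTop 0).mono h1)
  have h3 : avg S (fun i => v i + v i ^ 2 * y i ^ 2 / (s + v i) ^ 2 - 2 * v i ^ 2 / (s + v i)) =
      avg S v + avg S (fun i => (v i / (s + v i)) ^ 2 * y i ^ 2)
        - 2 * avg S (fun i => (v i / (s + v i)) ^ 2 * (s + v i)) := by
    rw [← avg_const_mul, ← avg_add, ← avg_sub, avg, avg]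
    congr 1
    refine Finset.sum_congr rfl fun i hi => ?_
    rcases (add_nonneg hs (hv i hi)).eq_or_lt with h0 | h0
    · simp [← h0]
    · field_simp
  linarith

/-- If a minimizer of the risk estimate is small, then so is the dispersion of the units whose
sampling variance exceeds `t`. -/
lemma avg_sq_le_of_isMinOn_risk {S : Finset ℕ} {v y χ : ℕ → ℝ} (hv : ∀ i ∈ S, 0 ≤ v i) {s t η : ℝ}
    (hs : 0 ≤ s) (ht : 0 < t) (hη : ∀ i ∈ S, v i ≤ η)
    (hχ1 : ∀ i ∈ S, χ i ≤ 1) (hχt : ∀ i ∈ S, 0 < χ i → t ≤ v i)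
    (hmin : ∀ s' : ℝ, 0 < s' →
      avg S (fun i => v i + v i ^ 2 * y i ^ 2 / (s + v i) ^ 2 - 2 * v i ^ 2 / (s + v i)) ≤
      avg S (fun i => v i + v i ^ 2 * y i ^ 2 / (s' + v i) ^ 2 - 2 * v i ^ 2 / (s' + v i))) :
    avg S (fun i => χ i * y i ^ 2) ≤ 2 * (s + η) * avg S (fun i => (1 + v i / t) ^ 2) := by
  -- This is the squared weight of a unit with variance exactly `t`. It bounds the squared weights
  -- of the retained units from below, and those of all units from above up to the factor `(1 +
  -- v/t)²`. It therefore cancels, however small it is.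
  have hρ : 0 < (t / (s + t)) ^ 2 := by positivity
  have h1 : (t / (s + t)) ^ 2 * avg S (fun i => χ i * y i ^ 2) ≤
      avg S (fun i => (v i / (s + v i)) ^ 2 * y i ^ 2) := by
    rw [← avg_const_mul]
    refine avg_mono fun i hi => ?_
    by_cases h0 : 0 < χ i
    · have htv := hχt i hi h0
      have h2 : t / (s + t) ≤ v i / (s + v i) := by
        rw [div_le_div_iff₀ (by positivity) (by linarith)]
        nlinarith
      calc (t / (s + t)) ^ 2 * (χ i * y i ^ 2) ≤ (t / (s + t)) ^ 2 * (1 * y i ^ 2) := by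
            gcongr; exact hχ1 i hi
        _ ≤ _ := by rw [one_mul]; gcongr
    · have h2 : (t / (s + t)) ^ 2 * (χ i * y i ^ 2) ≤ 0 :=
        mul_nonpos_of_nonneg_of_nonpos hρ.le
          (mul_nonpos_of_nonpos_of_nonneg (not_lt.1 h0) (sq_nonneg _))
      exact h2.trans (by positivity)
  have h3 : avg S (fun i => (v i / (s + v i)) ^ 2 * (s + v i)) ≤
      (t / (s + t)) ^ 2 * ((s + η) * avg S (fun i => (1 + v i / t) ^ 2)) := by
    rw [← avg_const_mul, ← avg_const_mul]
    refine avg_mono fun i hi => ?_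
    have hvi := hv i hi
    have h4 : v i / (s + v i) ≤ t / (s + t) * (1 + v i / t) := by
      have h5 : t / (s + t) * (1 + v i / t) = (t + v i) / (s + t) := by field_simp
      rw [h5]
      rcases hvi.eq_or_lt with h0 | h0
      · rw [← h0]; simp only [zero_div, add_zero]; positivity
      · rw [div_le_div_iff₀ (by positivity) (by positivity)]
        nlinarith [mul_nonneg ht.le hs]
    calc (v i / (s + v i)) ^ 2 * (s + v i)
        ≤ (t / (s + t) * (1 + v i / t)) ^ 2 * (s + η) := by
          gcongr; exact hη i hi
      _ = _ := by ring
  have h6 := avg_le_of_isMinOn_risk hv hs hmin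
  have h7 : (t / (s + t)) ^ 2 * avg S (fun i => χ i * y i ^ 2) ≤
      (t / (s + t)) ^ 2 * (2 * (s + η) * avg S (fun i => (1 + v i / t) ^ 2)) := by linarith
  exact le_of_mul_le_mul_left h7 hρ

namespace Design

variable {Ω : Type*} {p q k d L : ℕ} {D : Design Ω p q k d L}

/-! ### Sizes of the estimated sampling variances -/

lemma rpow_one_div_le_one_add {x e : ℝ} (hx : 0 ≤ x) (he : 1 ≤ e) : x ^ (1 / e) ≤ 1 + x := by
  rcases le_total x 1 with h | h
  · exact (Real.rpow_le_one hx h (by positivity)).trans (by linarith)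
  · calc x ^ (1 / e) ≤ x ^ (1 : ℝ) := Real.rpow_le_rpow_of_exponent_le h
          ((div_le_one (by linarith)).2 he)
      _ ≤ 1 + x := by rw [Real.rpow_one]; linarith

lemma sq_le_one_add_rpow {x e : ℝ} (hx : 0 ≤ x) (he : 2 ≤ e) : x ^ 2 ≤ 1 + x ^ e := by
  rcases le_total x 1 with h | h
  · exact (pow_le_one₀ hx h).trans (by linarith [Real.rpow_nonneg hx e])
  · calc x ^ 2 = x ^ (2 : ℝ) := by norm_cast
      _ ≤ x ^ e := Real.rpow_le_rpow_of_exponent_le h he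
      _ ≤ 1 + x ^ e := by linarith

/-- A bound on all estimated sampling variances in a fold. -/
noncomputable def uhatBound (D : Design Ω p q k d L) (e : ℝ) (N : ℕ) (l : Fin L) (ω : Ω) : ℝ :=
  (N : ℝ) ^ (1 / e) * (D.T N : ℝ)⁻¹ *
    (1 + avg (D.fold N l) fun i => (D.T N * D.uhatSq N l i ω) ^ e)

lemma uhatBound_nonneg (hV0 : ∀ n r, 0 ≤ D.V n r) (e : ℝ) (N : ℕ) (l : Fin L) (ω : Ω) :
    0 ≤ D.uhatBound e N l ω := by
  have : 0 ≤ avg (D.fold N l) fun i => (D.T N * D.uhatSq N l i ω) ^ e := avg_nonneg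
    fun i _ => Real.rpow_nonneg (mul_nonneg (by positivity) (hV0 _ _)) _
  unfold uhatBound
  positivity

/-- The `e`-th power of a single term is at most the sum of all `e`-th powers, that is, at most `N`
times their average; take the `e`-th root. -/
lemma uhatSq_le_uhatBound {N : ℕ} {l : Fin L} (hV0 : ∀ n r, 0 ≤ D.V n r) (hT : 0 < D.T N)
    (hc : (D.fold N l).card ≤ N) {e : ℝ} (he : 1 ≤ e) (ω : Ω) {i : ℕ} (hi : i ∈ D.fold N l) :
    D.uhatSq N l i ω ≤ D.uhatBound e N l ω := by
  have hT' : (0 : ℝ) < D.T N := by exact_mod_cast hT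
  set F := avg (D.fold N l) fun i => (D.T N * D.uhatSq N l i ω) ^ e with hF
  have hnn : ∀ j, 0 ≤ D.T N * D.uhatSq N l j ω := fun j => mul_nonneg hT'.le (hV0 _ _)
  have hF0 : 0 ≤ F := avg_nonneg fun j _ => Real.rpow_nonneg (hnn j) _
  have h1 : (D.T N * D.uhatSq N l i ω) ^ e ≤ N * F := by
    calc (D.T N * D.uhatSq N l i ω) ^ e
        ≤ ∑ j ∈ D.fold N l, (D.T N * D.uhatSq N l j ω) ^ e :=
          Finset.single_le_sum (f := fun j => (D.T N * D.uhatSq N l j ω) ^ e)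
            (fun j _ => Real.rpow_nonneg (hnn j) _) hi
      _ = (D.fold N l).card * F := sum_eq_card_mul_avg
      _ ≤ N * F := mul_le_mul_of_nonneg_right (by exact_mod_cast hc) hF0
  have h2 : D.T N * D.uhatSq N l i ω ≤ (N : ℝ) ^ (1 / e) * (1 + F) := by
    calc D.T N * D.uhatSq N l i ω = ((D.T N * D.uhatSq N l i ω) ^ e) ^ (1 / e) := by
          rw [← Real.rpow_mul (hnn i), mul_one_div_cancel (by linarith), Real.rpow_one]
      _ ≤ (N * F) ^ (1 / e) := Real.rpow_le_rpow (Real.rpow_nonneg (hnn i) _) h1 (by positivity)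
      _ = (N : ℝ) ^ (1 / e) * F ^ (1 / e) := Real.mul_rpow (by positivity) hF0
      _ ≤ _ := mul_le_mul_of_nonneg_left (rpow_one_div_le_one_add hF0 he) (by positivity)
  calc D.uhatSq N l i ω = (D.T N : ℝ)⁻¹ * (D.T N * D.uhatSq N l i ω) := by
        rw [inv_mul_cancel_left₀ hT'.ne']
    _ ≤ (D.T N : ℝ)⁻¹ * ((N : ℝ) ^ (1 / e) * (1 + F)) :=
        mul_le_mul_of_nonneg_left h2 (by positivity)
    _ = _ := by rw [uhatBound, ← hF]; ring

variable [MeasurableSpace Ω] {P : Measure Ω}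

/-- Used with `r = 1/2` to absorb the factor `√N` in the shrinkage term, and with `r = 0` to bound
the prior variances below. -/
lemma small_rpow_mul_uhatBound {g e r : ℝ} {l : Fin L}
    (hT : (fun N => (D.T N : ℝ)) =Θ[atTop] fun N : ℕ => (N : ℝ) ^ g) (hr : r + 1 / e < g)
    (hF : BddInProb P (fun N ω => avg (D.fold N l) fun i => (D.T N * D.uhatSq N l i ω) ^ e)) :
    SmallInProb P (fun N ω => (N : ℝ) ^ r * D.uhatBound e N l ω) := by
  refine (((BddInProb.const (P := P) 1).add hF).tendsto_mul
    (tendsto_rpow_mul_inv_of_isTheta hr hT) fun N => by positivity).mono ?_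
  filter_upwards [eventually_gt_atTop 0] with N hN
  have hN' : (0 : ℝ) < N := by exact_mod_cast hN
  refine Eventually.of_forall fun ω => le_of_eq ?_
  rw [Real.rpow_add hN', uhatBound]
  ring

lemma small_uhatBound {g e : ℝ} {l : Fin L}
    (hT : (fun N => (D.T N : ℝ)) =Θ[atTop] fun N : ℕ => (N : ℝ) ^ g) (hr : 1 / e < g)
    (hF : BddInProb P (fun N ω => avg (D.fold N l) fun i => (D.T N * D.uhatSq N l i ω) ^ e)) :
    SmallInProb P (fun N ω => D.uhatBound e N l ω) := by
  simpa using small_rpow_mul_uhatBound (r := 0) hT (by simpa using hr) hF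

lemma AlphaRate.small {κ : Shrinkage} (ha : D.AlphaRate P κ) (hT : Tendsto D.T atTop atTop)
    (l : Fin L) : SmallInProb P (fun N ω =>
      avg (D.fold N l) fun i => (D.alphaT κ N l i ω - D.α i ω) ^ 2) := by
  have hr : Tendsto (fun N => (D.T N : ℝ)⁻¹) atTop (𝓝 0) :=
    tendsto_inv_atTop_zero.comp (tendsto_natCast_atTop_atTop.comp hT)
  refine ((ha.bdd hT l).tendsto_mul hr fun N => by positivity).mono ?_
  filter_upwards [hT.eventually_gt_atTop 0] with N hN
  have : (D.T N : ℝ) ≠ 0 := by exact_mod_cast hN.ne'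
  exact Eventually.of_forall fun ω => by rw [inv_mul_cancel_left₀ this]

/-! ### The estimated prior variances stay away from zero -/

/-- The Empirical Bayes estimate of the prior variance is bounded away from zero. -/
theorem tuneEB_lower [IsProbabilityMeasure P] {g e : ℝ} (h : D.Setup P)
    (hV0 : ∀ n r, 0 ≤ D.V n r) (hvar : 0 < Var[D.α 0; P])
    (hraw : D.AlphaRate P .none) (hg : 0 < g) (he : 1 ≤ e) (hge : 1 / e < g)
    (hT : (fun N => (D.T N : ℝ)) =Θ[atTop] fun N : ℕ => (N : ℝ) ^ g) (l : Fin L)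
    (hF : BddInProb P (fun N ω => avg (D.fold N l) fun i => (D.T N * D.uhatSq N l i ω) ^ e))
    {ε : ℝ≥0∞} (hε : 0 < ε) :
    ∃ c : ℝ, 0 < c ∧ ∀ᶠ N in atTop, P {ω | D.tuneEB N l ω < c} ≤ ε := by
  have hT' := tendsto_atTop_of_isTheta hg hT
  obtain ⟨v, hv, hvar⟩ := exists_variance_arctan h hvar
  have hsmall : SmallInProb P (fun N ω => v - 2 * D.tuneEB N l ω) := by
    refine (((hvar l).add ((hraw.small hT' l).const_mul 2 fun N ω =>
      avg_nonneg fun i _ => sq_nonneg _)).add ((small_uhatBound hT hge hF).const_mul 4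
        (uhatBound_nonneg hV0 e · l))).mono ?_
    filter_upwards [hT'.eventually_gt_atTop 0,
      (h.tendsto_card_fold l).eventually_ge_atTop 2] with N h1 h2
    refine Eventually.of_forall fun ω => ?_
    have hS : (D.fold N l).Nonempty := Finset.card_pos.1 (by omega)
    have h3 := variance_arctan_le hS (fun i => D.α i ω) (fun i => D.alphaRaw N l i ω)
      (fun _ => 0) (D.alphaMean N l ω) (fun _ _ => le_rfl) (fun _ _ => zero_le_one)
    simp only [sub_zero, one_mul, avg_const hS, mul_zero, add_zero] at h3
    have hn : (2 : ℝ) ≤ (D.fold N l).card := by exact_mod_cast h2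
    have h4 : avg (D.fold N l) (fun i => (D.alphaRaw N l i ω - D.alphaMean N l ω) ^ 2) ≤
        (((D.fold N l).card : ℝ) - 1)⁻¹ *
          ∑ i ∈ D.fold N l, (D.alphaRaw N l i ω - D.alphaMean N l ω) ^ 2 :=
      mul_le_mul_of_nonneg_right (inv_anti₀ (by linarith) (by linarith))
        (Finset.sum_nonneg fun i _ => sq_nonneg _)
    -- With at least two units, `n ≤ 2 (n - 1)`.
    have h5 : (((D.fold N l).card : ℝ) - 1)⁻¹ * ∑ i ∈ D.fold N l, D.uhatSq N l i ω ≤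
        2 * D.uhatBound e N l ω := by
      rw [inv_mul_le_iff₀ (by linarith)]
      have h6 := Finset.sum_le_card_nsmul (D.fold N l) (fun i => D.uhatSq N l i ω) _
        fun i hi => uhatSq_le_uhatBound hV0 h1 (h.card_fold_le N l) he ω hi
      rw [nsmul_eq_mul] at h6
      nlinarith [uhatBound_nonneg hV0 e N l ω]
    have h7 : D.alphaT .none N l = D.alphaRaw N l := rfl
    rw [h7, tuneEB]
    linarith
  -- An estimate below `v/4` makes `v - 2 * tuneEB` exceed `v/2`.
  refine ⟨v / 4, by positivity, ?_⟩
  filter_upwards [hsmall (v / 2) (by positivity) ε hε] with N hN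
  refine le_trans (measure_mono fun ω hω => ?_) hN
  simp only [Set.mem_ofPred_eq] at hω ⊢
  linarith

/-- With `t = c / T` this is the factor `(1 + v/t)²` averaged in `avg_sq_le_of_isMinOn_risk`. -/
lemma Setup.bdd_avg_one_add_sq (h : D.Setup P) {e c : ℝ}
    (hV0 : ∀ n r, 0 ≤ D.V n r) (he : 2 ≤ e) (l : Fin L)
    (hF : BddInProb P (fun N ω => avg (D.fold N l) fun i => (D.T N * D.uhatSq N l i ω) ^ e)) :
    BddInProb P (fun N ω => avg (D.fold N l) fun i => (1 + D.T N * D.uhatSq N l i ω / c) ^ 2) := by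
  refine ((BddInProb.const (P := P) (2 + 2 * (c ^ 2)⁻¹)).add (hF.const_mul
    (C := 2 * (c ^ 2)⁻¹) (by positivity))).mono ?_
  filter_upwards [(h.tendsto_card_fold l).eventually_gt_atTop 0] with N hN
  have hS : (D.fold N l).Nonempty := Finset.card_pos.1 hN
  refine Eventually.of_forall fun ω => ?_
  rw [← avg_const_mul, ← avg_const hS (2 + 2 * (c ^ 2)⁻¹), ← avg_add]
  refine avg_mono fun i _ => ?_
  have h1 := sq_le_one_add_rpow (x := D.T N * D.uhatSq N l i ω)
    (mul_nonneg (by positivity) (hV0 _ _)) he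
  have h2 := mul_le_mul_of_nonneg_left h1 (show 0 ≤ 2 * (c ^ 2)⁻¹ by positivity)
  calc (1 + D.T N * D.uhatSq N l i ω / c) ^ 2
      ≤ 2 + 2 * (D.T N * D.uhatSq N l i ω / c) ^ 2 := by
        nlinarith [sq_nonneg (1 - D.T N * D.uhatSq N l i ω / c)]
    _ = 2 + 2 * (c ^ 2)⁻¹ * (D.T N * D.uhatSq N l i ω) ^ 2 := by rw [div_pow]; ring
    _ ≤ _ := by linarith

/-- The prior variance chosen by SURE is bounded away from zero. -/
theorem tuneSURE_lower [IsProbabilityMeasure P] {g e : ℝ} (h : D.Setup P)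
    (hV : ∀ n, Measurable (D.V n)) (hV0 : ∀ n r, 0 ≤ D.V n r) (hvar : 0 < Var[D.α 0; P])
    (hraw : D.AlphaRate P .none) (hsure : D.SUREConditions P) (hg : 0 < g) (he : 2 ≤ e)
    (hge : 1 / e < g)
    (hT : (fun N => (D.T N : ℝ)) =Θ[atTop] fun N : ℕ => (N : ℝ) ^ g) (l : Fin L)
    (hF : BddInProb P (fun N ω => avg (D.fold N l) fun i => (D.T N * D.uhatSq N l i ω) ^ e))
    {ε : ℝ≥0∞} (hε : 0 < ε) :
    ∃ c : ℝ, 0 < c ∧ ∀ᶠ N in atTop, P {ω | D.tuneSURE N l ω < c} ≤ ε := by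
  have hT' := tendsto_atTop_of_isTheta hg hT
  obtain ⟨v, hv, hvar⟩ := exists_variance_arctan h hvar
  have hε4 : 0 < ε / 2 / 2 := ENNReal.half_pos (ENNReal.half_pos hε.ne').ne'
  obtain ⟨η, hη0, hη⟩ := ENNReal.lt_iff_exists_nnreal_btwn.1 hε4
  have hη0' : 0 < η := by simpa using hη0
  -- The proportion of units with small sampling variance that is tolerated: discarding them costs
  -- `π² w = v/4`. Nondegeneracy is invoked at level `η w`, so that Markov bounds the probability of
  -- a larger proportion by `η`.
  set w : ℝ := v / (4 * Real.pi ^ 2) with hw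
  have hw0 : 0 < w := by have := Real.pi_pos; positivity
  obtain ⟨c, hc, hbad⟩ := hsure.uhat_nondegenerate l (η * w.toNNReal)
    (mul_pos hη0' (by simpa using hw0))
  obtain ⟨M, hM, hQ⟩ := h.bdd_avg_one_add_sq (c := c) hV0 he l hF _ hε4
  have hZ := ((hvar l).add ((hraw.small hT' l).const_mul 2 fun N ω =>
      avg_nonneg fun i _ => sq_nonneg _)).add ((small_uhatBound hT hge hF).const_mul (4 * M)
        (uhatBound_nonneg hV0 e · l))
  -- The budget for `v`: discarded units take `v/4`, negligible terms `v/4`, and `4 M s` must supply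
  -- the remaining `v/2`.
  refine ⟨v / (8 * M), by positivity, ?_⟩
  filter_upwards [hbad, hQ, hZ (v / 4) (by positivity) _ (ENNReal.half_pos hε.ne'),
    hT'.eventually_gt_atTop 0, (h.tendsto_card_fold l).eventually_gt_atTop 0] with N h1 h2 h3 h4 h5
  have hS : (D.fold N l).Nonempty := Finset.card_pos.1 h5
  have hTN : (0 : ℝ) < D.T N := by exact_mod_cast h4
  set bad : ℕ → Set Ω := fun i => {ω | D.T N * D.uhatSq N l i ω < c} with hbaddef
  have hbm : ∀ i, MeasurableSet (bad i) := fun i =>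
    measurableSet_lt ((h.measurable_uhatSq hV N l i).const_mul _) measurable_const
  have hB : P {ω | w < avg (D.fold N l) fun i => (bad i).indicator (fun _ => (1 : ℝ)) ω}
      ≤ ε / 2 / 2 := by
    have hm : ∀ i ∈ D.fold N l, AEMeasurable ((bad i).indicator fun _ => (1 : ℝ)) P := fun i _ =>
      (measurable_const.indicator (hbm i)).aemeasurable
    refine (measure_lt_le_of_lintegral_le (aemeasurable_avg hm) (lintegral_avg_le hm
      (C := η * w.toNNReal) fun i hi => ?_) hw0).trans (le_trans (le_of_eq ?_) hη.le)
    · refine le_trans (le_of_eq ?_) (h1 i hi)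
      rw [← lintegral_indicator_one (hbm i)]
      refine lintegral_congr fun ω => ?_
      by_cases hω : ω ∈ bad i <;> simp [hω]
    · exact ENNReal.mul_div_cancel_right (by simpa using hw0) ENNReal.ofReal_ne_top
  calc P {ω | D.tuneSURE N l ω < v / (8 * M)} ≤ P {ω | v / 4 < (v -
          (avg (D.fold N l) (fun i => Real.arctan (D.α i ω) ^ 2)
            - avg (D.fold N l) (fun i => Real.arctan (D.α i ω)) ^ 2) +
          2 * avg (D.fold N l) fun i => (D.alphaT .none N l i ω - D.α i ω) ^ 2)
          + 4 * M * D.uhatBound e N l ω ∨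
        (M < (avg (D.fold N l) fun i => (1 + D.T N * D.uhatSq N l i ω / c) ^ 2) ∨
        w < avg (D.fold N l) fun i => (bad i).indicator (fun _ => (1 : ℝ)) ω)} := by
        refine measure_mono fun ω hω => ?_
        simp only [Set.mem_ofPred_eq] at hω ⊢
        by_contra! hcon
        obtain ⟨hcon1, hcon2, hcon3⟩ := hcon
        set s := D.tuneSURE N l ω
        have hs0 : 0 ≤ s := hsure.nonneg_tune N l ω
        have hind0 : ∀ i, 0 ≤ (bad i).indicator (fun _ => (1 : ℝ)) ω := fun i =>
          Set.indicator_nonneg (fun _ _ => zero_le_one) ω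
        have hind1 : ∀ i, (bad i).indicator (fun _ => (1 : ℝ)) ω ≤ 1 := fun i =>
          Set.indicator_le_self' (fun _ _ => zero_le_one) ω
        have h6 := variance_arctan_le hS (fun i => D.α i ω) (fun i => D.alphaRaw N l i ω)
          (fun i => (bad i).indicator (fun _ => (1 : ℝ)) ω) (D.alphaMean N l ω)
          (fun i _ => hind0 i) (fun i _ => hind1 i)
        -- The units kept are those with sampling variance at least `c / T`.
        have h7 := avg_sq_le_of_isMinOn_risk (S := D.fold N l) (v := fun i => D.uhatSq N l i ω)
          (y := fun i => D.alphaRaw N l i ω - D.alphaMean N l ω)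
          (χ := fun i => 1 - (bad i).indicator (fun _ => (1 : ℝ)) ω) (s := s) (t := c / D.T N)
          (η := D.uhatBound e N l ω)
          (fun i _ => hV0 _ _) hs0 (by positivity)
          (fun i hi => uhatSq_le_uhatBound hV0 h4 (h.card_fold_le N l) (by linarith) ω hi)
          (fun i _ => by linarith [hind0 i]) (fun i _ hi => by
            have hω' : ω ∉ bad i := fun hmem => by simp [hmem] at hi
            rw [div_le_iff₀' hTN]
            exact not_lt.1 hω')
          (fun s' hs' => hsure.isMinOn_tune N l ω (Set.mem_Ici.2 hs'.le))
        have h8 : avg (D.fold N l) (fun i => (1 + D.uhatSq N l i ω / (c / D.T N)) ^ 2) ≤ M := by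
          refine le_trans (le_of_eq ?_) hcon2
          congr 1; ext i
          rw [div_div_eq_mul_div, mul_comm]
        have h9 := uhatBound_nonneg hV0 e N l ω
        have h10 := mul_le_mul_of_nonneg_left h8 (show 0 ≤ 2 * (s + D.uhatBound e N l ω) by
          positivity)
        have h11 := mul_le_mul_of_nonneg_left hcon3 (sq_nonneg Real.pi)
        have h12 : Real.pi ^ 2 * w = v / 4 := by
          have := Real.pi_pos.ne'
          rw [hw]; field_simp
        rw [lt_div_iff₀ (by positivity)] at hω
        have h13 : D.alphaT .none N l = D.alphaRaw N l := rfl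
        rw [h13] at hcon1
        nlinarith
    _ ≤ ε / 2 + (ε / 2 / 2 + ε / 2 / 2) := (measure_or_le _ _).trans
        (add_le_add h3 ((measure_or_le _ _).trans (add_le_add h2 hB)))
    _ = ε := by rw [ENNReal.add_halves, ENNReal.add_halves]

end Design

end CrossFit

/-! ### Negligibility of the shrinkage and decomposition of the sample moment -/

namespace CrossFit

namespace Design

variable {Ω : Type*} {p q k d L : ℕ} {D : Design Ω p q k d L}

/-- Average the model equation over the pre-final periods. At least one such period is needed for
the average of the constant `α_i` to be `α_i`. -/
lemma alphaRaw_eq {N : ℕ} (hN : 0 < D.last N) (l : Fin L) (i : ℕ) (ω : Ω) :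
    D.alphaRaw N l i ω =
      D.α i ω + D.ubar N i ω - inner ℝ (D.Xbar N i ω) (D.betaT N l ω - D.β₀) := by
  have hN' : (D.last N : ℝ) ≠ 0 := by exact_mod_cast hN.ne'
  have h : D.ubar N i ω = D.Ybar N i ω - inner ℝ (D.Xbar N i ω) D.β₀ - D.α i ω := by
    simp only [ubar, u, Ybar, Xbar, Finset.sum_sub_distrib, mul_sub, real_inner_smul_left, sum_inner]
    simp [hN']
  rw [h, alphaRaw, inner_sub_right]
  ring

/-- The two weights sum to one, so shrinkage moves the estimate by the weight on the fold mean times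
the distance to that mean. -/
lemma abs_shrink_sub_le {N : ℕ} {l : Fin L} {i : ℕ} {ω : Ω} {s c : ℝ}
    (hV0 : ∀ n r, 0 ≤ D.V n r) (hc : 0 < c) (hs : c ≤ s) :
    |D.shrink N l i ω s - D.alphaRaw N l i ω| ≤
      c⁻¹ * D.uhatSq N l i ω * |D.alphaMean N l ω - D.alphaRaw N l i ω| := by
  have hu : 0 ≤ D.uhatSq N l i ω := hV0 _ _
  have hpos : 0 < D.uhatSq N l i ω + s := by linarith
  have h1 : D.shrink N l i ω s - D.alphaRaw N l i ω = D.uhatSq N l i ω / (D.uhatSq N l i ω + s) *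
      (D.alphaMean N l ω - D.alphaRaw N l i ω) := by
    rw [shrink, add_comm s]
    field_simp
    ring
  rw [h1, abs_mul, abs_of_nonneg (by positivity)]
  refine mul_le_mul_of_nonneg_right ?_ (abs_nonneg _)
  rw [div_eq_inv_mul]
  exact mul_le_mul_of_nonneg_right (inv_anti₀ hc (by linarith)) hu

variable [MeasurableSpace Ω] {P : Measure Ω}

lemma Setup.bdd_alphaMean_sub [IsProbabilityMeasure P] (h : D.Setup P)
    (hα : MemLp (D.α 0) 2 P) (hraw : D.AlphaRate P .none) (hT : Tendsto D.T atTop atTop)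
    (l : Fin L) (c : ℝ) : BddInProb P (fun N ω => |D.alphaMean N l ω - c|) := by
  have hint : Integrable (D.α 0) P := hα.integrable (by norm_num)
  have hA : BddInProb P (fun N ω => avg (D.fold N l) fun i => |D.α i ω|) := by
    refine BddInProb.avg_of_lintegral_le (C := (∫⁻ ω, ‖D.α 0 ω‖ₑ ∂P).toNNReal)
      (Eventually.of_forall fun N i _ => (h.measurable_α i).norm.aemeasurable)
      (Eventually.of_forall fun N i _ => ?_)
    rw [ENNReal.coe_toNNReal hint.2.ne]
    simp_rw [← Real.norm_eq_abs, ofReal_norm]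
    exact ((h.identDistrib_α i).comp measurable_enorm).lintegral_eq.le
  refine ((hA.add (hraw.small hT l).bdd).add (BddInProb.const (1 + |c|))).mono ?_
  filter_upwards [(h.tendsto_card_fold l).eventually_gt_atTop 0] with N hN
  have hS : (D.fold N l).Nonempty := Finset.card_pos.1 hN
  refine Eventually.of_forall fun ω => ?_
  have h1 : |D.alphaMean N l ω| ≤ avg (D.fold N l) fun i => |D.alphaRaw N l i ω| := by
    rw [alphaMean, abs_mul, abs_of_nonneg (by positivity)]
    exact mul_le_mul_of_nonneg_left (Finset.abs_sum_le_sum_abs _ _) (by positivity)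
  have h2 : (avg (D.fold N l) fun i => |D.alphaRaw N l i ω|) ≤ avg (D.fold N l) fun i =>
      (|D.α i ω| + (D.alphaT .none N l i ω - D.α i ω) ^ 2) + 1 := by
    refine avg_mono fun i _ => ?_
    have h3 : D.alphaT .none N l i ω = D.alphaRaw N l i ω := rfl
    rw [h3]
    have h4 := abs_add_le (D.α i ω) (D.alphaRaw N l i ω - D.α i ω)
    rw [add_sub_cancel] at h4
    nlinarith [sq_nonneg (|D.alphaRaw N l i ω - D.α i ω| - 1), sq_abs (D.alphaRaw N l i ω - D.α i ω),
      abs_nonneg (D.alphaRaw N l i ω - D.α i ω)]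
  rw [avg_add, avg_add, avg_const hS] at h2
  have h5 := abs_sub (D.alphaMean N l ω) c
  linarith

/-- The difference between shrunk and unshrunk estimates of the fixed effects is negligible, if the
estimated prior variance is bounded away from zero. -/
theorem small_shrink [IsProbabilityMeasure P] {κ' : Shrinkage} {g e ζ : ℝ} (h : D.Setup P)
    (hn : D.NuisanceRates P κ' ζ) (hmom : D.MomentBounds P κ')
    (hsc : D.ShrinkageConditions P g) (hraw : D.AlphaRate P .none)
    (hg : 0 < g) (he : 1 ≤ e) (hge : 1 / 2 + 1 / e < g)
    (hT : (fun N => (D.T N : ℝ)) =Θ[atTop] fun N : ℕ => (N : ℝ) ^ g) (l : Fin L)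
    (hF : BddInProb P (fun N ω => avg (D.fold N l) fun i => (D.T N * D.uhatSq N l i ω) ^ e))
    {s : ℕ → Ω → ℝ}
    (hs : ∀ ε : ℝ≥0∞, 0 < ε → ∃ c : ℝ, 0 < c ∧ ∀ᶠ N in atTop, P {ω | s N ω < c} ≤ ε) :
    SmallInProb P (fun N ω => ‖(√(N : ℝ))⁻¹ • ∑ i ∈ D.fold N l,
      (D.shrink N l i ω (s N ω) - D.alphaRaw N l i ω) • (D.dm i ω - D.a P N i ω)‖) := by
  have hT' := tendsto_atTop_of_isTheta hg hT
  have hdiff := h.aestronglyMeasurable_diff hmom.integrable_dm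
  set μα := ∫ ω, D.α 0 ω ∂P with hμα
  have hG1 : BddInProb P (fun N ω => avg (D.fold N l) fun i =>
      ‖D.dm i ω - D.a P N i ω‖ * |D.α i ω + D.ubar N i ω - μα|) := by
    obtain ⟨C, hC⟩ := hsc.dm_α
    refine BddInProb.avg_of_lintegral_le (C := C) (Eventually.of_forall fun N i _ => ?_) ?_
    · exact (hdiff N i).norm.aemeasurable.mul
        (((h.measurable_α i).add (h.measurable_ubar N i)).sub_const μα).norm.aemeasurable
    · filter_upwards [hC] with N hN i hi
      have h1 := hN i (h.mem_fold_lt hi)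
      rw [(h.identDistrib_α i).integral_eq] at h1
      simp_rw [← Real.norm_eq_abs, ENNReal.ofReal_mul (norm_nonneg _), ofReal_norm]
      exact h1
  -- The first moment comes from the fourth through `x ≤ 1 + x⁴`.
  have hG3 : BddInProb P (fun N ω => avg (D.fold N l) fun i => ‖D.dm i ω - D.a P N i ω‖) := by
    obtain ⟨C, hC⟩ := hmom.dm_fourth
    refine BddInProb.avg_of_lintegral_le (C := 1 + C)
      (Eventually.of_forall fun N i _ => (hdiff N i).norm.aemeasurable) ?_
    filter_upwards [hC] with N hN i hi
    calc ∫⁻ ω, ENNReal.ofReal ‖D.dm i ω - D.a P N i ω‖ ∂P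
        ≤ ∫⁻ ω, (1 + ‖D.dm i ω - D.a P N i ω‖ₑ ^ 4) ∂P := by
          refine lintegral_mono fun ω => ?_
          rw [ofReal_norm]
          rcases le_total ‖D.dm i ω - D.a P N i ω‖ₑ 1 with h1 | h1
          · exact h1.trans le_self_add
          · exact (le_self_pow₀ h1 (by norm_num)).trans le_add_self
      _ ≤ 1 + C := by
          rw [lintegral_add_left measurable_const]
          simpa using hN i (h.mem_fold_lt hi)
      _ = ((1 + C : ℝ≥0) : ℝ≥0∞) := by simp
  have hb : BddInProb P (fun N ω => ‖D.betaT N l ω - D.β₀‖) := by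
    refine (hn.small_beta hT' l).bdd.mono ?_
    filter_upwards [eventually_ge_atTop 1] with N hN
    exact Eventually.of_forall fun ω => le_mul_of_one_le_left (norm_nonneg _)
      (Real.one_le_sqrt.2 (by exact_mod_cast hN))
  have hsum := (hG1.add (hb.mul (bdd_avg_diff_Xbar h hmom l) fun N ω => norm_nonneg _)).add
    ((h.bdd_alphaMean_sub (hsc.memLp_α 0) hraw hT' l μα).mul hG3 fun N ω => abs_nonneg _)
  -- The whole factor `√N` is absorbed by the largest sampling variance, which is possible since
  -- `1/2 + 1/e < g`.
  have hU := small_rpow_mul_uhatBound (r := 1 / 2) hT hge hF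
  have hU0 : ∀ (N : ℕ) (ω : Ω), 0 ≤ (N : ℝ) ^ (1 / 2 : ℝ) * D.uhatBound e N l ω := fun N ω =>
    mul_nonneg (by positivity) (uhatBound_nonneg hsc.nonneg_V e N l ω)
  refine SmallInProb.of_forall_eps fun ε hε => ?_
  obtain ⟨c, hc, hsc'⟩ := hs ε hε
  refine ⟨_, (hU.const_mul c⁻¹ hU0).mul_bdd hsum
    fun N ω => mul_nonneg (by positivity) (hU0 N ω), ?_⟩
  filter_upwards [hsc', hT'.eventually_gt_atTop 1] with N h1 h2
  refine le_trans (measure_mono fun ω hω => ?_) h1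
  simp only [Set.mem_ofPred_eq] at hω ⊢
  by_contra! hcs
  refine absurd hω (not_lt.2 ?_)
  have hlast : 0 < D.last N := Nat.sub_pos_of_lt h2
  refine (norm_scaled_sum_le (h.card_fold_le N l) (f := fun i => c⁻¹ * D.uhatBound e N l ω *
    ((‖D.dm i ω - D.a P N i ω‖ * |D.α i ω + D.ubar N i ω - μα| +
      ‖D.betaT N l ω - D.β₀‖ * (‖D.dm i ω - D.a P N i ω‖ * ‖D.Xbar N i ω‖)) +
      |D.alphaMean N l ω - μα| * ‖D.dm i ω - D.a P N i ω‖)) fun i hi => ?_).trans (le_of_eq ?_)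
  · rw [norm_smul, Real.norm_eq_abs]
    have h3 := abs_shrink_sub_le (i := i) (l := l) (N := N) (ω := ω) hsc.nonneg_V hc hcs
    have h4 := uhatSq_le_uhatBound hsc.nonneg_V (by omega) (h.card_fold_le N l) he ω hi
    have h5 : |D.alphaMean N l ω - D.alphaRaw N l i ω| ≤ |D.α i ω + D.ubar N i ω - μα| +
        ‖D.betaT N l ω - D.β₀‖ * ‖D.Xbar N i ω‖ + |D.alphaMean N l ω - μα| := by
      have h6 := abs_real_inner_le_norm (D.Xbar N i ω) (D.betaT N l ω - D.β₀)
      rw [alphaRaw_eq hlast]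
      rw [mul_comm] at h6
      rw [abs_le] at h6 ⊢
      constructor <;> linarith [le_abs_self (D.α i ω + D.ubar N i ω - μα),
        neg_abs_le (D.α i ω + D.ubar N i ω - μα), le_abs_self (D.alphaMean N l ω - μα),
        neg_abs_le (D.alphaMean N l ω - μα)]
    calc |D.shrink N l i ω (s N ω) - D.alphaRaw N l i ω| * ‖D.dm i ω - D.a P N i ω‖
        ≤ (c⁻¹ * D.uhatBound e N l ω * (|D.α i ω + D.ubar N i ω - μα| +
          ‖D.betaT N l ω - D.β₀‖ * ‖D.Xbar N i ω‖ + |D.alphaMean N l ω - μα|)) *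
          ‖D.dm i ω - D.a P N i ω‖ := by
          refine mul_le_mul_of_nonneg_right (h3.trans ?_) (norm_nonneg _)
          refine mul_le_mul (mul_le_mul_of_nonneg_left h4 (by positivity)) h5 (abs_nonneg _) ?_
          exact mul_nonneg (by positivity) (uhatBound_nonneg hsc.nonneg_V e N l ω)
      _ = _ := by ring
  · rw [avg_const_mul, avg_add, avg_add, avg_const_mul, avg_const_mul, Real.sqrt_eq_rpow]
    ring

/-- The difference between shrunk and unshrunk estimates of the fixed effects is negligible. -/
theorem small_alphaT_sub_alphaRaw [IsProbabilityMeasure P] {κ κ' : Shrinkage} {g ζ : ℝ}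
    (h : D.Setup P) (hn : D.NuisanceRates P κ' ζ) (hmom : D.MomentBounds P κ')
    (hshrink : κ ≠ .none → D.ShrinkageConditions P g) (hsure : κ = .sure → D.SUREConditions P)
    (hraw : D.AlphaRate P .none) (hg : 0 < g)
    (hT : (fun N => (D.T N : ℝ)) =Θ[atTop] fun N : ℕ => (N : ℝ) ^ g) (l : Fin L) :
    SmallInProb P (fun N ω => ‖(√(N : ℝ))⁻¹ • ∑ i ∈ D.fold N l,
      (D.alphaT κ N l i ω - D.alphaRaw N l i ω) • (D.dm i ω - D.a P N i ω)‖) := by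
  by_cases hκ : κ = .none
  · subst hκ
    have : SmallInProb P (fun (_ : ℕ) (_ : Ω) => (0 : ℝ)) := SmallInProb.of_tendsto tendsto_const_nhds
    refine this.mono (Eventually.of_forall fun N => Eventually.of_forall fun ω => ?_)
    simp [alphaT]
  have hsc := hshrink hκ
  obtain ⟨δ, hδ, hδg, hF⟩ := hsc.uhat_moment
  have hF' := bdd_avg_uhatSq_rpow h hsc.measurable_V (hF l)
  have hge : 1 / (2 + δ) < g := by linarith
  cases κ
  · exact (hκ rfl).elim
  · exact small_shrink h hn hmom hsc hraw hg (by linarith) hδg hT l hF' fun ε hε =>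
      tuneEB_lower h hsc.nonneg_V (hsc.var_α 0) hraw hg (by linarith) hge hT l hF' hε
  · exact small_shrink h hn hmom hsc hraw hg (by linarith) hδg hT l hF' fun ε hε =>
      tuneSURE_lower h hsc.measurable_V hsc.nonneg_V (hsc.var_α 0) hraw (hsure rfl) hg
        (by linarith) hge hT l hF' hε

lemma Setup.sum_range_eq {E : Type*} [AddCommMonoid E] (h : D.Setup P) (N : ℕ) (f : ℕ → E) :
    ∑ i ∈ Finset.range N, f i = ∑ l : Fin L, ∑ i ∈ D.fold N l, f i := by
  rw [← h.fold_union N, Finset.sum_biUnion fun l _ l' _ hll => h.fold_disjoint N hll]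

/-- The decomposition of the difference of the feasible and infeasible moments of a fold. -/
lemma sum_moment_sub_eq {κ κ' : Shrinkage} {N : ℕ} (hN : 0 < D.last N) (l : Fin L) (ω : Ω) :
    ∑ i ∈ D.fold N l, (D.m (D.W i ω) (D.alphaT κ N l i ω) D.μ₀
        + (D.Y i (D.last N) ω - inner ℝ (D.X i (D.last N) ω) (D.betaT N l ω)
          - D.alphaT κ N l i ω) • D.aHat κ' N l i ω)
      - ∑ i ∈ D.fold N l, (D.m (D.W i ω) (D.α i ω) D.μ₀
        + (D.Y i (D.last N) ω - inner ℝ (D.X i (D.last N) ω) D.β₀ - D.α i ω) • D.a P N i ω) =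
    ∑ i ∈ D.fold N l, (D.m (D.W i ω) (D.alphaT κ N l i ω) D.μ₀ - D.m (D.W i ω) (D.α i ω) D.μ₀
        - (D.alphaT κ N l i ω - D.α i ω) • D.dm i ω)
      + ∑ i ∈ D.fold N l, D.ubar N i ω • (D.dm i ω - D.a P N i ω)
      - ∑ i ∈ D.fold N l, (inner ℝ (D.Xbar N i ω) (D.betaT N l ω - D.β₀) : ℝ) •
          (D.dm i ω - D.a P N i ω)
      + ∑ i ∈ D.fold N l, (D.alphaT κ N l i ω - D.alphaRaw N l i ω) • (D.dm i ω - D.a P N i ω)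
      - ∑ i ∈ D.fold N l, (D.alphaT κ N l i ω - D.α i ω) • (D.aHat κ' N l i ω - D.a P N i ω)
      + ∑ i ∈ D.fold N l, D.u i (D.last N) ω • (D.aHat κ' N l i ω - D.a P N i ω)
      - ∑ i ∈ D.fold N l, (inner ℝ (D.X i (D.last N) ω) (D.betaT N l ω - D.β₀) : ℝ) •
          D.aHat κ' N l i ω := by
  simp only [← Finset.sum_sub_distrib, ← Finset.sum_add_distrib]
  refine Finset.sum_congr rfl fun i _ => ?_
  -- After substituting for the raw estimate and the final error, both sides agree unit by unit as
  -- combinations of the same vectors.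
  rw [alphaRaw_eq hN, u, inner_sub_right, inner_sub_right]
  module

end Design

end CrossFit

theorem proposition1 {Ω : Type*} [MeasurableSpace Ω] (P : Measure Ω) [IsProbabilityMeasure P]
    {p q k d L : ℕ} (D : CrossFit.Design Ω p q k d L)
    (κ κ' : CrossFit.Shrinkage) (hκ : κ' = CrossFit.Shrinkage.none ∨ κ' = κ)
    (σ g ζ : ℝ) (hg : 1 / 2 < g) (hg' : g < 1) (hζ : ζ < 1 / 2) (hζg : 1 ≤ ζ + g)
    (hT : (fun N => (D.T N : ℝ)) =Θ[atTop] fun N : ℕ => (N : ℝ) ^ g)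
    (hsetup : D.Setup P) (hmodel : D.MomentModel P σ)
    (hnuis : D.NuisanceRates P κ' ζ)
    (hraw : D.AlphaRate P CrossFit.Shrinkage.none) (hrate : D.AlphaRate P κ)
    (hcorr : D.ErrorCorrelation P) (hmom : D.MomentBounds P κ')
    (hshrink : κ ≠ CrossFit.Shrinkage.none → D.ShrinkageConditions P g)
    (hsure : κ = CrossFit.Shrinkage.sure → D.SUREConditions P) :
    TendstoInMeasure P (fun N ω => D.feasible κ κ' N ω - D.infeasible P N ω) atTop
      (fun _ => 0) := by
  have hg0 : 0 < g := by linarith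
  have hT' := CrossFit.tendsto_atTop_of_isTheta hg0 hT
  -- The measurability conditions are assumed for `κ` but needed for the method that feeds the
  -- fitted function.
  have hκ' : κ' ≠ .none → κ' = κ := fun h => hκ.resolve_left h
  have hV : κ' ≠ .none → ∀ n, Measurable (D.V n) := fun h =>
    (hshrink (hκ' h ▸ h)).measurable_V
  have hs : κ' = .sure → ∀ N l, Measurable[D.preFinal N l] (D.tuneSURE N l) := fun h =>
    (hsure ((hκ' (by simp [h])) ▸ h)).measurable_tune
  refine CrossFit.SmallInProb.tendstoInMeasure ?_
  refine (CrossFit.SmallInProb.sum Finset.univ fun l _ =>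
    ((((((CrossFit.Design.small_taylor hsetup hmom hrate hg hT l).add
      (CrossFit.Design.small_errorCorrelation hsetup hmom hcorr l)).add
      (CrossFit.Design.small_slope_mean hsetup hnuis hmom hT' l)).add
      (CrossFit.Design.small_alphaT_sub_alphaRaw hsetup hnuis hmom hshrink hsure hraw hg0 hT l)).add
      (CrossFit.Design.small_product hsetup hnuis hrate hg0 hζg hT l)).add
      (CrossFit.Design.small_noise hsetup hmodel hV hs hnuis (by linarith) hmom l)).add
      (CrossFit.Design.small_slope_final hsetup hnuis hmom hT' l)).mono ?_
  -- Two periods guarantee a pre-final one, as the decomposition requires.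
  filter_upwards [hT'.eventually_gt_atTop 1] with N hN
  refine Filter.Eventually.of_forall fun ω => ?_
  rw [CrossFit.Design.feasible, CrossFit.Design.infeasible, hsetup.sum_range_eq, ← smul_sub,
    ← Finset.sum_sub_distrib, Finset.smul_sum]
  refine (norm_sum_le _ _).trans (Finset.sum_le_sum fun l _ => ?_)
  rw [CrossFit.Design.sum_moment_sub_eq (Nat.sub_pos_of_lt hN)]
  simp only [smul_add, smul_sub]
  refine (norm_sub_le _ _).trans (add_le_add_left ?_ _)
  refine (norm_add_le _ _).trans (add_le_add_left ?_ _)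
  refine (norm_sub_le _ _).trans (add_le_add_left ?_ _)
  refine (norm_add_le _ _).trans (add_le_add_left ?_ _)
  refine (norm_sub_le _ _).trans (add_le_add_left ?_ _)
  exact norm_add_le _ _
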